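/- **Setting.** Let $\mathcal U=[0,1]$, let $\mathcal X\subset\mathbb R^d$ be compact, and let $Q:\mathcal U\times\mathcal X\to\mathbb R$, $(u,x)\mapsto Q(u|x)$, be continuously differentiable, such that the number of elements of $\{u\in\mathcal U:\partial_uQ(u|x)=0\}$ is bounded uniformly in $x\in\mathcal X$. For a curve $Q$ put $$F(y|x)=\int_0^1 1\{Q(u|x)\le y\}\,du,\qquad Q^*(u|x)=\inf\{y: F(y|x)\ge u\}.$$ Let $\mathcal Y_x$ be the support of the law of $Q(U|x)$, $U$ uniform on $[0,1]$; let $\mathcal Y\subset\mathbb R$ be a compact set with $\mathcal Y_x\subset\mathcal Y$ for all $x\in\mathcal X$; put $\mathcal U\mathcal X=\mathcal U\times\mathcal X$ and $\mathcal Y\mathcal X=\{(y,x): y\in\mathcal Y_x,\ x\in\mathcal X\}$. Let $\mathcal Y_x^*$ be the set of $y\in\mathcal Y_x$ that are regular values of $u\mapsto Q(u|x)$ (i.e. $\partial_uQ(u|x)\neq0$ at every $u\in\mathcal U$ with $Q(u|x)=y$), and let $f(y|x)=\partial_yF(y|x)$ for $y\in\mathcal Y^*_x$, $f(y|x)=0$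 otherwise. For continuous $h:\mathcal U\mathcal X\to\mathbb R$ let $$D_h(y|x)=-\sum_{u\in\mathcal U:\,Q(u|x)=y}\frac{h(u|x)}{|\partial_uQ(u|x)|},\qquad \tilde D_h(u|x)=-\frac{1}{f(Q^*(u|x)|x)}\,D_h(Q^*(u|x)|x),$$ which are well defined for all but finitely many $y\in\mathcal Y$, respectively $u\in\mathcal U$, for each $x$. For a set $S$ let $\ell^\infty(S)$ be the space of bounded measurable real functions on $S$ with the supremum norm; $\Rightarrow$ denotes weak convergence in $\ell^\infty(S)$ in the sense of Hoffmann-Jørgensen (outer expectations of bounded continuous functionals of the processes converge to the expectation for the limit, which is Borel measurable). Let $\widehat Q=\widehat Q_n$ be random elements (maps on probability spaces, not assumed Borel measurable) with values in the bounded measurable functions on $\mathcal U\mathcal X$, let $a_n\to\infty$ be constants, and let $G$ be a stochastic process with continuous paths on $\mathcal U\mathcal X$, such that $$a_n(\widehat Q(u|x)-Q(u|x))\Rightarrow G(u|x)\quad\text{in }\ell^\infty(\mathcal U\mathcal X).$$ Let $\widehat F$ and $\widehat Q^*$ be obtained from $\widehat Q$ in the same way as $F$ and $Q^*$ from $Q$.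 **Proposition 6.** 1. Let $g(y|x,y')$, $y\in\mathcal Y$, $(y',x)\in\mathcal Y\mathcal X$, be measurable and bounded, and suppose that for every $(y',x)\in\mathcal Y\mathcal X$ and almost every $y\in\mathcal Y$ the map $g(y|\cdot,\cdot)$ on $\mathcal Y\mathcal X$ is continuous at $(y',x)$. Then all the integrals below exist, the limit process has continuous paths on $\mathcal Y\mathcal X$, and $$a_n\int_{\mathcal Y}g(y|x,y')(\widehat F(y|x)-F(y|x))\,dy\ \Rightarrow\ \int_{\mathcal Y}g(y|x,y')D_G(y|x)\,dy$$ as stochastic processes indexed by $(y',x)\in\mathcal Y\mathcal X$, in $\ell^\infty(\mathcal Y\mathcal X)$. 2. Let $g(u|x,u')$, $u\in\mathcal U$, $(u',x)\in\mathcal U\mathcal X$, be measurable, with $u\mapsto\sup_{(u',x)\in\mathcal U\mathcal X}|g(u|x,u')|$ (Lebesgue) measurable and integrable over $\mathcal U$, and suppose that for every $(u',x)\in\mathcal U\mathcal X$ and almost every $u\in\mathcal U$ the map $g(u|\cdot,\cdot)$ on $\mathcal U\mathcal X$ is continuous at $(u',x)$. Then all the integrals below exist, the limit process has continuous paths on $\mathcal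 U\mathcal X$, and $$a_n\int_{\mathcal U}g(u|x,u')(\widehat Q^*(u|x)-Q^*(u|x))\,du\ \Rightarrow\ \int_{\mathcal U}g(u|x,u')\tilde D_G(u|x)\,du$$ as stochastic processes indexed by $(u',x)\in\mathcal U\mathcal X$, in $\ell^\infty(\mathcal U\mathcal X)$. -/

import Mathlib

open Set Filter Topology MeasureTheory
open scoped ENNReal BoundedContinuousFunction

noncomputable section

namespace Rearrangement

/-! ### Weak convergence in the sense of Hoffmann-Jorgensen -/

/-- The outer expectation `E^* T = inf {E V : V ≥ T, V measurable and integrable}`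
of a bounded, not necessarily measurable, function `T` on a probability space. -/
def outerExpectation {Ω : Type*} [MeasurableSpace Ω] (P : Measure Ω) (T : Ω → ℝ) : ℝ :=
  sInf {r : ℝ | ∃ V : Ω → ℝ, Measurable V ∧ Integrable V P ∧ (∀ ω, T ω ≤ V ω) ∧ r = ∫ ω, V ω ∂P}

/-- Weak convergence `X n ⇒ Z` in a topological space `E`: the `X n` are arbitrary maps on
probability spaces, the limit `Z` is Borel measurable, and `E^* φ(X n) → E φ(Z)` for all
bounded continuous real functions `φ` on `E`. -/
def ConvergesWeakly {E : Type*} [TopologicalSpace E]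
    {Ω : ℕ → Type*} [∀ n, MeasurableSpace (Ω n)] (P : ∀ n, Measure (Ω n)) (X : ∀ n, Ω n → E)
    {Ω' : Type*} [MeasurableSpace Ω'] (P' : Measure Ω') (Z : Ω' → E) : Prop :=
  Measurable[_, borel E] Z ∧
    ∀ φ : E →ᵇ ℝ,
      Tendsto (fun n => outerExpectation (P n) (fun ω => φ (X n ω))) atTop
        (𝓝 (∫ ω, φ (Z ω) ∂P'))

/-- `ℓ^∞(S)`: the bounded measurable real functions on `S`, with the metric of the
supremum norm (inherited from Mathlib's space `lp` with exponent `∞`). -/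
abbrev EllInfty (S : Type*) [MeasurableSpace S] : Type _ :=
  {f : lp (fun _ : S => ℝ) ∞ // Measurable (fun s => f s)}

/-- Weak convergence in `ℓ^∞(S)`, for stochastic processes indexed by a subset `S` of an ambient
space `T` and given by functions on `T` of which only the restriction to `S` matters.
It includes that all paths (on `S`) of all the processes belong to `ℓ^∞(S)`. -/
def ConvergesWeaklyInEllInfty {T : Type*} [MeasurableSpace T] (S : Set T)
    {Ω : ℕ → Type*} [∀ n, MeasurableSpace (Ω n)] (P : ∀ n, Measure (Ω n))
    (X : ∀ n, Ω n → T → ℝ)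
    {Ω' : Type*} [MeasurableSpace Ω'] (P' : Measure Ω') (Z : Ω' → T → ℝ) : Prop :=
  ∃ (X' : ∀ n, Ω n → EllInfty S) (Z' : Ω' → EllInfty S),
    (∀ n ω (s : S), (X' n ω).1 s = X n ω s) ∧
    (∀ ω (s : S), (Z' ω).1 s = Z ω s) ∧
    ConvergesWeakly P X' P' Z'

/-! ### Rearrangement of a curve `Q(u|x)`, written `Q u x`, with `u ∈ [0,1]` -/

variable {E : Type*}

/-- `∂_u Q(u|x)`, one-sided at the end points of `[0,1]`. -/
def partialU (Q : ℝ → E → ℝ) (u : ℝ) (x : E) : ℝ :=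
  derivWithin (fun v => Q v x) (Icc 0 1) u

/-- `F(y|x) = ∫_0^1 1{Q(u|x) ≤ y} du`. -/
def distFn (Q : ℝ → E → ℝ) (y : ℝ) (x : E) : ℝ :=
  ∫ u in (0 : ℝ)..1, if Q u x ≤ y then 1 else 0

/-- `Q^*(u|x) = inf {y : F(y|x) ≥ u}`. -/
def rearranged (Q : ℝ → E → ℝ) (u : ℝ) (x : E) : ℝ :=
  sInf {y : ℝ | u ≤ distFn Q y x}

/-- `𝒴_x`, the support of (the law of) `Y_x = Q(U|x)`, with `U` uniform on `[0,1]`. -/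
def supportY (Q : ℝ → E → ℝ) (x : E) : Set ℝ :=
  (Measure.map (fun u => Q u x) (volume.restrict (Icc (0 : ℝ) 1))).support

/-- `y` is a regular value of `u ↦ Q(u|x)`. -/
def IsRegularValue (Q : ℝ → E → ℝ) (x : E) (y : ℝ) : Prop :=
  y ∈ (fun u => Q u x) '' Icc 0 1 ∧ ∀ u ∈ Icc (0 : ℝ) 1, Q u x = y → partialU Q u x ≠ 0

/-- `𝒴_x^*`, the regular values of `u ↦ Q(u|x)` in `𝒴_x`. -/
def regularY (Q : ℝ → E → ℝ) (x : E) : Set ℝ :=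
  {y ∈ supportY Q x | IsRegularValue Q x y}

open Classical in
/-- `f(y|x)`: the derivative `∂_y F(y|x)` for `y ∈ 𝒴_x^*`, and `0` otherwise. -/
def densityY (Q : ℝ → E → ℝ) (y : ℝ) (x : E) : ℝ :=
  if y ∈ regularY Q x then deriv (fun z => distFn Q z x) y else 0

/-- `D_h(y|x) = - ∑_k h(u_k|x) / |∂_u Q(u_k|x)|`, the sum being over the roots `u_k ∈ [0,1]` of
`Q(u|x) = y`. -/
def derivF (Q h : ℝ → E → ℝ) (y : ℝ) (x : E) : ℝ :=
  -∑ᶠ u ∈ {u : ℝ | u ∈ Icc (0 : ℝ) 1 ∧ Q u x = y}, h u x / |partialU Q u x|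

/-- `D̃_h(u|x) = - D_h(Q^*(u|x)|x) / f(Q^*(u|x)|x)`. -/
def derivQ (Q h : ℝ → E → ℝ) (u : ℝ) (x : E) : ℝ :=
  -(1 / densityY Q (rearranged Q u x) x) * derivF Q h (rearranged Q u x) x

/-- `𝒰𝒳 = [0,1] × 𝒳`. -/
def regionUX (X : Set E) : Set (ℝ × E) := Icc (0 : ℝ) 1 ×ˢ X

/-- `𝒴𝒳 = {(y,x) : y ∈ 𝒴_x, x ∈ 𝒳}`. -/
def regionYX (Q : ℝ → E → ℝ) (X : Set E) : Set (ℝ × E) :=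
  {p | p.1 ∈ supportY Q p.2 ∧ p.2 ∈ X}

/-! ### Restrictions on the weight functions

`g v p`, with `p = (v', x)`, stands for `g(v|x,v')`. -/

/-- `g` is (jointly) measurable on `V × S`, and `p ↦ g(v|p)` is continuous at `p` relative to `S`
for almost every `v ∈ V`, for each `p ∈ S`. -/
def IsWeight [TopologicalSpace E] [MeasurableSpace E]
    (V : Set ℝ) (S : Set (ℝ × E)) (g : ℝ → ℝ × E → ℝ) : Prop :=
  Measurable (fun q : ↥(V ×ˢ S) => g q.1.1 q.1.2) ∧
    ∀ p ∈ S, ∀ᵐ v ∂(volume.restrict V), ContinuousWithinAt (g v) S p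

/-- `g` is bounded on `V × S`. -/
def IsBoundedWeight (V : Set ℝ) (S : Set (ℝ × E)) (g : ℝ → ℝ × E → ℝ) : Prop :=
  ∃ C : ℝ, ∀ v ∈ V, ∀ p ∈ S, |g v p| ≤ C

/-- `v ↦ sup_{p ∈ S} |g(v|p)|` (with values in `[0,∞]`) is measurable with finite integral
over `V`. -/
def HasIntegrableSup (V : Set ℝ) (S : Set (ℝ × E)) (g : ℝ → ℝ × E → ℝ) : Prop :=
  AEMeasurable (fun v => ⨆ p ∈ S, ‖g v p‖ₑ) (volume.restrict V) ∧
    ∫⁻ v in V, ⨆ p ∈ S, ‖g v p‖ₑ < ∞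

end Rearrangement

end

/-!
# Rearranged curves: limits of integral functionals

The proof never looks at individual roots of `Q(u|x) = y` near critical values, where `D_h` is
unbounded; everything is transported to integrals over `u ∈ [0,1]`.

*Distribution functions.* By Fubini and the substitution `y = Q(u|x) + t s`, for a bounded weight
`g` and `t > 0`,
`t⁻¹ ∫ g(y) (F_{Q+th}(y|x) - F_Q(y|x)) dy = ∫_0^1 ∫ g(Q(u|x) + t s) (1{h(u|x) ≤ s} - 1{0 ≤ s}) ds du`
(`integral_mul_pathCdf_sub`). As `t → 0`, `h → h₀`, `x → x₀` and `g → g₀` almost everywhere, the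
right-hand side tends to `-∫_0^1 g₀(Q(u|x₀)) h₀(u|x₀) du`. The point is that `g(Q(u|x) + t s)`
converges in `L^1(du)` although `g` is only measurable: away from a set of `u` of small measure
`|∂_u Q|` is bounded below, and as the number of critical points is bounded uniformly in `x`, the
laws of the paths have uniformly bounded densities there (`IsRegularPath.lintegral_comp_le`,
`PathConvergence.tendsto_lintegral_comp`). The limit equals `∫ g₀(y) D_{h₀}(y|x₀) dy` by the area
formula (`IsRegularPath.integral_mul_fiberSum`); by Rolle's theorem a path is injective on each of
the finitely many intervals between its critical points.

*Quantile functions.* Rearrangement is a contraction in the supremum norm, so the difference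
quotients of `Q^*` are uniformly bounded and, by density of continuous functions in `L^1`, only
continuous weights `κ` matter (`tendsto_integral_mul_of_dense`). For these,
`∫ κ (R^* - Q^*) = -∫ w(y) (F_R(y) - F_Q(y)) dy`, where `w(y)` is the average of `κ` between
`F_Q(y)` and `F_R(y)`, a bounded convergent weight; this reduces the claim to distribution
functions. The limit `∫_0^1 κ(F(Q(u))) h(u) du` is `∫ κ D̃_h` since `Q^*` and `Q` have the same law,
`F(Q^*(u)) = u`, and `F` has derivative `∑ 1 / |∂_u Q|` almost everywhere
(`IsRegularPath.quantile_derivative`).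

*Weak convergence.* All these limits hold jointly in the direction, the step and the index, hence
uniformly over the compact index sets, and the extended continuous mapping theorem applies
(`ConvergesWeakly.extended_continuous_mapping`). Its proof squeezes a bounded functional between
Lipschitz envelopes, which needs neither separability of `ℓ^∞` nor measurability of the processes.
-/

noncomputable section

namespace Rearrangement

section

/-! ### The extended continuous mapping theorem for Hoffmann-Jørgensen weak convergence -/

lemma outerExpectation_mono {Ω : Type*} [MeasurableSpace Ω] (P : Measure Ω) [IsProbabilityMeasure P]
    {T T' : Ω → ℝ} {M : ℝ} (hle : ∀ ω, T ω ≤ T' ω) (hT : ∀ ω, -M ≤ T ω) (hT' : ∀ ω, T' ω ≤ M) :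
    outerExpectation P T ≤ outerExpectation P T' := by
  unfold outerExpectation
  apply csInf_le_csInf
  · refine ⟨-M, ?_⟩
    rintro r ⟨V, -, hVi, hV, rfl⟩
    calc -M = ∫ _, -M ∂P := by simp
      _ ≤ ∫ ω, V ω ∂P := integral_mono (integrable_const _) hVi fun ω => (hT ω).trans (hV ω)
  · exact ⟨_, fun _ => M, measurable_const, integrable_const _, hT', rfl⟩
  · rintro r ⟨V, hVm, hVi, hV, rfl⟩
    exact ⟨V, hVm, hVi, fun ω => (hle ω).trans (hV ω), rfl⟩

section Envelope

variable {E : Type*} [PseudoMetricSpace E]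

/-- The upper envelope `sup {f k w' - m * dist w w' : k ≥ m, w' ∈ E}` of the functions
`f m, f (m + 1), …`: it dominates all of them and is `m`-Lipschitz, whatever the `f k` are. -/
def upperEnvelope (f : ℕ → E → ℝ) (m : ℕ) (w : E) : ℝ :=
  ⨆ k : {k : ℕ × E // m ≤ k.1}, (f k.1.1 k.1.2 - m * dist w k.1.2)

variable {f : ℕ → E → ℝ} {M : ℝ}

lemma le_upperEnvelope (hf : ∀ n w, |f n w| ≤ M) {m n : ℕ} (hmn : m ≤ n) (w w' : E) :
    f n w' - m * dist w w' ≤ upperEnvelope f m w := by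
  refine le_ciSup (f := fun k : {k : ℕ × E // m ≤ k.1} => f k.1.1 k.1.2 - m * dist w k.1.2)
    ⟨M, ?_⟩ ⟨(n, w'), hmn⟩
  rintro _ ⟨k, rfl⟩
  have h1 := (abs_le.1 (hf k.1.1 k.1.2)).2
  have h2 : 0 ≤ (m : ℝ) * dist w k.1.2 := by positivity
  simp only
  linarith

lemma upperEnvelope_le {m : ℕ} {w : E} {c : ℝ}
    (h : ∀ n w', m ≤ n → f n w' - m * dist w w' ≤ c) : upperEnvelope f m w ≤ c := by
  have : Nonempty {k : ℕ × E // m ≤ k.1} := ⟨⟨(m, w), le_rfl⟩⟩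
  exact ciSup_le fun k => h _ _ k.2

lemma abs_upperEnvelope_le (hf : ∀ n w, |f n w| ≤ M) (m : ℕ) (w : E) :
    |upperEnvelope f m w| ≤ M := by
  refine abs_le.2 ⟨?_, upperEnvelope_le fun n w' _ => ?_⟩
  · have h := le_upperEnvelope hf le_rfl w w (m := m)
    have h1 := (abs_le.1 (hf m w)).1
    simp only [dist_self, mul_zero, sub_zero] at h
    linarith
  · have h1 := (abs_le.1 (hf n w')).2
    have h2 : 0 ≤ (m : ℝ) * dist w w' := by positivity
    linarith

lemma continuous_upperEnvelope (hf : ∀ n w, |f n w| ≤ M) (m : ℕ) :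
    Continuous (upperEnvelope f m) := by
  refine (LipschitzWith.of_le_add_mul (m : NNReal) fun w v => upperEnvelope_le fun n w' hn => ?_).continuous
  have h1 := le_upperEnvelope hf hn v w'
  have h2 : (m : ℝ) * dist v w' ≤ m * (dist w v + dist w w') := by
    gcongr
    rw [dist_comm w v]
    exact dist_triangle _ _ _
  simp only [NNReal.coe_natCast]
  linarith

/-- The upper envelopes converge wherever the `f n` converge continuously. -/
lemma tendsto_upperEnvelope (hf : ∀ n w, |f n w| ≤ M) {z : E} {y : ℝ}
    (hz : Tendsto (fun k : ℕ × E => f k.1 k.2) (atTop ×ˢ 𝓝 z) (𝓝 y)) :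
    Tendsto (fun m => upperEnvelope f m z) atTop (𝓝 y) := by
  have hdiag : Tendsto (fun n => f n z) atTop (𝓝 y) :=
    hz.comp (tendsto_id.prodMk tendsto_const_nhds)
  have hy : |y| ≤ M := le_of_tendsto hdiag.abs (Eventually.of_forall fun n => hf n z)
  refine tendsto_order.2 ⟨fun c hc => ?_, fun c hc => ?_⟩
  · filter_upwards [hdiag.eventually (lt_mem_nhds hc)] with m hm
    have h := le_upperEnvelope hf le_rfl z z (m := m)
    simp only [dist_self, mul_zero, sub_zero] at h
    exact hm.trans_le h
  · obtain ⟨c', hyc', hc'⟩ := exists_between hc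
    have hev := hz.eventually (gt_mem_nhds hyc')
    obtain ⟨S, hS, U, hU, hSU⟩ := mem_prod_iff.1 hev
    obtain ⟨m₀, hm₀⟩ := mem_atTop_sets.1 hS
    obtain ⟨δ, hδ, hball⟩ := Metric.mem_nhds_iff.1 hU
    obtain ⟨m₁, hm₁⟩ := exists_nat_gt (2 * M / δ)
    filter_upwards [eventually_ge_atTop m₀, eventually_ge_atTop m₁] with m h0 h1
    refine (upperEnvelope_le fun n w' hn => ?_).trans_lt hc'
    by_cases hw : dist w' z < δ
    · have h : f n w' < c' := hSU (a := (n, w')) ⟨hm₀ n (h0.trans hn), hball hw⟩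
      have h2 : 0 ≤ (m : ℝ) * dist z w' := by positivity
      linarith
    · -- far from `z` the penalty exceeds the oscillation `2 * M` of the functions
      have h3 : 2 * M < m * δ := by
        rw [div_lt_iff₀ hδ] at hm₁
        refine hm₁.trans_le ?_
        gcongr
      have h4 : (m : ℝ) * δ ≤ m * dist z w' := by
        rw [dist_comm]
        gcongr
        exact not_lt.1 hw
      have h5 := (abs_le.1 (hf n w')).2
      have h6 := (abs_le.1 hy).1
      linarith

end Envelope

variable {E E' : Type*} [PseudoMetricSpace E] [PseudoMetricSpace E']
  {Ω : ℕ → Type*} [∀ n, MeasurableSpace (Ω n)] {P : ∀ n, Measure (Ω n)}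
  [∀ n, IsProbabilityMeasure (P n)] {X : ∀ n, Ω n → E}
  {Ω' : Type*} [MeasurableSpace Ω'] {P' : Measure Ω'} [IsProbabilityMeasure P'] {Z : Ω' → E}

lemma measurable_comp_continuous (hZ : Measurable[_, borel E] Z) {φ : E → ℝ} (hφ : Continuous φ) :
    Measurable fun ω => φ (Z ω) := by
  borelize E
  exact hφ.measurable.comp hZ

/-- One half of the extended continuous mapping theorem, for real functionals `f n` that converge
continuously to `y ω` at every value `Z ω` of the limit. -/
lemma eventually_outerExpectation_lt (h : ConvergesWeakly P X P' Z) {f : ℕ → E → ℝ} {M : ℝ}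
    (hf : ∀ n w, |f n w| ≤ M) {y : Ω' → ℝ}
    (hy : ∀ ω, Tendsto (fun k : ℕ × E => f k.1 k.2) (atTop ×ˢ 𝓝 (Z ω)) (𝓝 (y ω)))
    {c : ℝ} (hc : ∫ ω, y ω ∂P' < c) :
    ∀ᶠ n in atTop, outerExpectation (P n) (fun ω => f n (X n ω)) < c := by
  have hlim : Tendsto (fun m => ∫ ω, upperEnvelope f m (Z ω) ∂P') atTop (𝓝 (∫ ω, y ω ∂P')) := by
    refine tendsto_integral_of_dominated_convergence (fun _ => M) (fun m => ?_)
      (integrable_const _) (fun m => ae_of_all _ fun ω => ?_)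
      (ae_of_all _ fun ω => tendsto_upperEnvelope hf (hy ω))
    · exact (measurable_comp_continuous h.1 (continuous_upperEnvelope hf m)).aestronglyMeasurable
    · exact abs_upperEnvelope_le hf m _
  obtain ⟨m, hm⟩ := (hlim.eventually (gt_mem_nhds hc)).exists
  have hconv := h.2 (BoundedContinuousFunction.ofNormedAddCommGroup (upperEnvelope f m)
    (continuous_upperEnvelope hf m) M (abs_upperEnvelope_le hf m))
  filter_upwards [hconv.eventually (gt_mem_nhds hm), eventually_ge_atTop m] with n hn hmn
  refine lt_of_le_of_lt (outerExpectation_mono (P n) (M := M) (fun ω => ?_)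
    (fun ω => (abs_le.1 (hf _ _)).1) (fun ω => (abs_le.1 (abs_upperEnvelope_le hf m _)).2)) hn
  simpa using le_upperEnvelope hf hmn (X n ω) (X n ω)

/-- The other half: the functionals are minorized by the lower envelopes. -/
lemma eventually_lt_outerExpectation (h : ConvergesWeakly P X P' Z) {f : ℕ → E → ℝ} {M : ℝ}
    (hf : ∀ n w, |f n w| ≤ M) {y : Ω' → ℝ}
    (hy : ∀ ω, Tendsto (fun k : ℕ × E => f k.1 k.2) (atTop ×ˢ 𝓝 (Z ω)) (𝓝 (y ω)))
    {c : ℝ} (hc : c < ∫ ω, y ω ∂P') :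
    ∀ᶠ n in atTop, c < outerExpectation (P n) (fun ω => f n (X n ω)) := by
  set g : ℕ → E → ℝ := fun n w => -f n w with hg
  have hgM : ∀ n w, |g n w| ≤ M := fun n w => by simpa [hg] using hf n w
  have hlim : Tendsto (fun m => ∫ ω, -upperEnvelope g m (Z ω) ∂P') atTop (𝓝 (∫ ω, y ω ∂P')) := by
    refine tendsto_integral_of_dominated_convergence (fun _ => M) (fun m => ?_)
      (integrable_const _) (fun m => ae_of_all _ fun ω => ?_)
      (ae_of_all _ fun ω => ?_)
    · exact (measurable_comp_continuous h.1
        (continuous_upperEnvelope hgM m)).neg.aestronglyMeasurable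
    · simpa using abs_upperEnvelope_le hgM m _
    · simpa using (tendsto_upperEnvelope hgM (hy ω).neg).neg
  obtain ⟨m, hm⟩ := (hlim.eventually (lt_mem_nhds hc)).exists
  have hconv := h.2 (BoundedContinuousFunction.ofNormedAddCommGroup (fun w => -upperEnvelope g m w)
    (continuous_upperEnvelope hgM m).neg M
    (fun w => by simpa using abs_upperEnvelope_le hgM m w))
  filter_upwards [hconv.eventually (lt_mem_nhds hm), eventually_ge_atTop m] with n hn hmn
  refine lt_of_lt_of_le hn (outerExpectation_mono (P n) (M := M) (fun ω => ?_)
    (fun ω => ?_) (fun ω => (abs_le.1 (hf _ _)).2))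
  · have := le_upperEnvelope hgM hmn (X n ω) (X n ω)
    simp only [hg, dist_self, mul_zero, sub_zero] at this
    simp only [BoundedContinuousFunction.coe_ofNormedAddCommGroup]
    linarith
  · have := (abs_le.1 (abs_upperEnvelope_le hgM m (X n ω))).2
    simp only [BoundedContinuousFunction.coe_ofNormedAddCommGroup]
    linarith

/-- The limit of continuously convergent functionals of a Borel map is measurable, because it is
the pointwise limit of envelopes. -/
lemma measurable_of_continuous_convergence (hZ : Measurable[_, borel E] Z) {f : ℕ → E → ℝ} {M : ℝ}
    (hf : ∀ n w, |f n w| ≤ M) {y : Ω' → ℝ}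
    (hy : ∀ ω, Tendsto (fun k : ℕ × E => f k.1 k.2) (atTop ×ˢ 𝓝 (Z ω)) (𝓝 (y ω))) :
    Measurable y :=
  measurable_of_tendsto_metrizable
    (fun m => measurable_comp_continuous hZ (continuous_upperEnvelope hf m))
    (tendsto_pi_nhds.2 fun ω => tendsto_upperEnvelope hf (hy ω))

/-- **Extended continuous mapping theorem.** If `X n ⇒ Z` and the maps `Ψ n` converge continuously
at every value of `Z`, then `Ψ n (X n) ⇒ Z'`, where `Z'` is the limit. No separability or
tightness is needed: a bounded functional of `Ψ n` is squeezed between Lipschitz envelopes. -/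
theorem ConvergesWeakly.extended_continuous_mapping (h : ConvergesWeakly P X P' Z)
    (Ψ : ℕ → E → E') {X' : ∀ n, Ω n → E'} {Z' : Ω' → E'} (hX' : ∀ n ω, Ψ n (X n ω) = X' n ω)
    (hΨ : ∀ ω, Tendsto (fun k : ℕ × E => Ψ k.1 k.2) (atTop ×ˢ 𝓝 (Z ω)) (𝓝 (Z' ω))) :
    ConvergesWeakly P X' P' Z' := by
  have key : ∀ (φ : E' →ᵇ ℝ) (ω : Ω'), Tendsto (fun k : ℕ × E => φ (Ψ k.1 k.2))
      (atTop ×ˢ 𝓝 (Z ω)) (𝓝 (φ (Z' ω))) := fun φ ω =>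
    (φ.continuous.tendsto _).comp (hΨ ω)
  have hbd : ∀ (φ : E' →ᵇ ℝ) (n : ℕ) (w : E), |φ (Ψ n w)| ≤ ‖φ‖ := fun φ n w =>
    φ.norm_coe_le_norm _
  refine ⟨?_, fun φ => ?_⟩
  · borelize E'
    refine measurable_of_isClosed fun C hC => ?_
    rcases C.eq_empty_or_nonempty with rfl | hne
    · simp
    -- `C` is the zero set of the bounded continuous function `min 1 (dist · C)`
    let φ : E' →ᵇ ℝ := BoundedContinuousFunction.ofNormedAddCommGroup
      (fun w => min 1 (Metric.infDist w C)) (continuous_const.min (Metric.continuous_infDist_pt C)) 1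
      (fun w => by
        rw [Real.norm_eq_abs, abs_of_nonneg (le_min zero_le_one Metric.infDist_nonneg)]
        exact min_le_left _ _)
    have hm : Measurable fun ω => φ (Z' ω) :=
      measurable_of_continuous_convergence h.1 (f := fun n w => φ (Ψ n w)) (hbd φ) (key φ)
    have : Z' ⁻¹' C = (fun ω => φ (Z' ω)) ⁻¹' {0} := by
      ext ω
      simp only [mem_preimage, mem_singleton_iff, φ,
        BoundedContinuousFunction.coe_ofNormedAddCommGroup]
      rw [hC.mem_iff_infDist_zero hne]
      constructor
      · intro h0
        simp [h0]
      · intro h0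
        rcases min_choice 1 (Metric.infDist (Z' ω) C) with h1 | h1 <;> rw [h1] at h0
        · norm_num at h0
        · exact h0
    rw [this]
    exact hm (measurableSet_singleton 0)
  · simp only [← hX']
    exact tendsto_order.2
      ⟨fun c hc => eventually_lt_outerExpectation h (f := fun n w => φ (Ψ n w)) (hbd φ) (key φ) hc,
       fun c hc => eventually_outerExpectation_lt h (f := fun n w => φ (Ψ n w)) (hbd φ) (key φ) hc⟩

end

/-! ### Distribution and quantile functions of a path -/

/-- The uniform distribution on `[0,1]`. -/
abbrev unif : Measure ℝ := volume.restrict (Icc (0 : ℝ) 1)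

instance : IsProbabilityMeasure unif := ⟨by simp [unif]⟩

/-- The distribution function `y ↦ ∫_0^1 1{q u ≤ y} du` of a single path `q`. -/
def pathCdf (q : ℝ → ℝ) (y : ℝ) : ℝ := ∫ u in (0 : ℝ)..1, if q u ≤ y then 1 else 0

/-- The increasing rearrangement of a single path `q`. -/
def pathQuantile (q : ℝ → ℝ) (u : ℝ) : ℝ := sInf {y : ℝ | u ≤ pathCdf q y}

variable {q r : ℝ → ℝ} {R y u c : ℝ}

lemma ae_unif_mem : ∀ᵐ u ∂unif, u ∈ Ioc (0 : ℝ) 1 := by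
  rw [unif, ← restrict_Ioc_eq_restrict_Icc]
  exact ae_restrict_mem measurableSet_Ioc

lemma pathCdf_eq_integral (q : ℝ → ℝ) (y : ℝ) :
    pathCdf q y = ∫ u, (if q u ≤ y then 1 else 0) ∂unif := by
  rw [pathCdf, intervalIntegral.integral_of_le zero_le_one, restrict_Ioc_eq_restrict_Icc]

lemma pathCdf_congr (h : ∀ u ∈ Icc (0 : ℝ) 1, q u = r u) : pathCdf q = pathCdf r := by
  ext y
  simp only [pathCdf_eq_integral]
  exact setIntegral_congr_fun measurableSet_Icc fun u hu => by simp only [h u hu]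

lemma pathCdf_eq_cdf (hq : AEMeasurable q unif) (y : ℝ) :
    pathCdf q y = ProbabilityTheory.cdf (unif.map q) y := by
  have : IsProbabilityMeasure (unif.map q) := Measure.isProbabilityMeasure_map hq
  have hs : NullMeasurableSet (q ⁻¹' Iic y) unif := hq.nullMeasurableSet_preimage measurableSet_Iic
  rw [ProbabilityTheory.cdf_eq_real, measureReal_def, Measure.map_apply_of_aemeasurable hq
    measurableSet_Iic, pathCdf_eq_integral]
  have : (fun u => if q u ≤ y then (1 : ℝ) else 0) = (q ⁻¹' Iic y).indicator fun _ => 1 := by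
    ext u
    by_cases h : q u ≤ y <;> simp [indicator, h]
  rw [this, integral_indicator₀ hs]
  simp [measureReal_def]

lemma pathCdf_monotone (hq : AEMeasurable q unif) : Monotone (pathCdf q) := fun a b h => by
  rw [pathCdf_eq_cdf hq, pathCdf_eq_cdf hq]
  exact (ProbabilityTheory.cdf _).mono h

lemma measurable_pathCdf (hq : AEMeasurable q unif) : Measurable (pathCdf q) :=
  (pathCdf_monotone hq).measurable

lemma pathCdf_mem_Icc (hq : AEMeasurable q unif) (y : ℝ) : pathCdf q y ∈ Icc (0 : ℝ) 1 := by
  rw [pathCdf_eq_cdf hq]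
  exact ⟨ProbabilityTheory.cdf_nonneg _ _, ProbabilityTheory.cdf_le_one _ _⟩

lemma pathCdf_of_lt (hR : ∀ u ∈ Icc (0 : ℝ) 1, |q u| ≤ R) (hy : y < -R) : pathCdf q y = 0 := by
  rw [pathCdf_eq_integral, setIntegral_congr_fun (g := fun _ => (0 : ℝ)) measurableSet_Icc]
  · simp
  · intro u hu
    have := (abs_le.1 (hR u hu)).1
    exact if_neg (by linarith)

lemma pathCdf_of_ge (hR : ∀ u ∈ Icc (0 : ℝ) 1, |q u| ≤ R) (hy : R ≤ y) : pathCdf q y = 1 := by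
  rw [pathCdf_eq_integral, setIntegral_congr_fun (g := fun _ => (1 : ℝ)) measurableSet_Icc]
  · simp
  · intro u hu
    have := (abs_le.1 (hR u hu)).2
    exact if_pos (by linarith)

/-- The defining Galois connection of the quantile function, away from `u = 0`, where the infimum
is over all of `ℝ`. -/
lemma le_pathCdf_iff (hq : AEMeasurable q unif) (hR : ∀ u ∈ Icc (0 : ℝ) 1, |q u| ≤ R)
    (hu : u ∈ Ioc (0 : ℝ) 1) : u ≤ pathCdf q y ↔ pathQuantile q u ≤ y := by
  have hbdd : BddBelow {y : ℝ | u ≤ pathCdf q y} := by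
    refine ⟨-R, fun z hz => not_lt.1 fun hlt => ?_⟩
    have h1 : u ≤ pathCdf q z := hz
    rw [pathCdf_of_lt hR hlt] at h1
    exact absurd hu.1 (not_lt.2 h1)
  have hne : {y : ℝ | u ≤ pathCdf q y}.Nonempty :=
    ⟨R, by simpa [pathCdf_of_ge hR le_rfl] using hu.2⟩
  refine ⟨fun h => csInf_le hbdd h, fun h => ?_⟩
  -- by right-continuity the infimum is attained
  have hev : ∀ᶠ z in 𝓝[>] (pathQuantile q u), u ≤ pathCdf q z := by
    filter_upwards [self_mem_nhdsWithin] with z hz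
    obtain ⟨w, hw, hwz⟩ := exists_lt_of_csInf_lt hne hz
    exact le_trans hw (pathCdf_monotone hq hwz.le)
  have hrc : Tendsto (pathCdf q) (𝓝[>] (pathQuantile q u)) (𝓝 (pathCdf q (pathQuantile q u))) := by
    have := ((ProbabilityTheory.cdf (unif.map q)).right_continuous (pathQuantile q u)).mono
      Ioi_subset_Ici_self
    simpa only [funext (pathCdf_eq_cdf hq)] using this.tendsto
  exact (ge_of_tendsto hrc hev).trans (pathCdf_monotone hq h)

lemma abs_pathQuantile_le (hq : AEMeasurable q unif) (hR : ∀ u ∈ Icc (0 : ℝ) 1, |q u| ≤ R)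
    (hu : u ∈ Ioc (0 : ℝ) 1) : |pathQuantile q u| ≤ R := by
  refine abs_le.2 ⟨not_lt.1 fun h => ?_, ?_⟩
  · have h1 := (le_pathCdf_iff hq hR hu).2 le_rfl
    rw [pathCdf_of_lt hR h] at h1
    exact absurd hu.1 (not_lt.2 h1)
  · rw [← le_pathCdf_iff hq hR hu, pathCdf_of_ge hR le_rfl]
    exact hu.2

lemma pathQuantile_le_add (hq : AEMeasurable q unif) (hr : AEMeasurable r unif)
    (hR : ∀ u ∈ Icc (0 : ℝ) 1, |q u| ≤ R) (hR' : ∀ u ∈ Icc (0 : ℝ) 1, |r u| ≤ R)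
    (hc : ∀ u ∈ Icc (0 : ℝ) 1, |q u - r u| ≤ c) (hu : u ∈ Ioc (0 : ℝ) 1) :
    pathQuantile q u ≤ pathQuantile r u + c := by
  rw [← le_pathCdf_iff hq hR hu]
  refine ((le_pathCdf_iff hr hR' hu).2 le_rfl).trans ?_
  have hint : ∀ (p : ℝ → ℝ), AEMeasurable p unif → ∀ z,
      Integrable (fun u => if p u ≤ z then (1 : ℝ) else 0) unif := by
    intro p hp z
    have hs : NullMeasurableSet (p ⁻¹' Iic z) unif := hp.nullMeasurableSet_preimage measurableSet_Iic
    exact ((integrable_const (1 : ℝ)).indicator₀ hs).congr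
      (ae_of_all _ fun u => by by_cases h : p u ≤ z <;> simp [indicator, h])
  rw [pathCdf_eq_integral, pathCdf_eq_integral]
  refine integral_mono_ae (hint _ hr _) (hint _ hq _) ?_
  filter_upwards [ae_restrict_mem measurableSet_Icc] with v hv
  have := (abs_le.1 (hc v hv)).2
  split_ifs <;> linarith

/-- Rearrangement is a contraction for the supremum norm. -/
lemma abs_pathQuantile_sub_le (hq : AEMeasurable q unif) (hr : AEMeasurable r unif)
    (hR : ∀ u ∈ Icc (0 : ℝ) 1, |q u| ≤ R) (hR' : ∀ u ∈ Icc (0 : ℝ) 1, |r u| ≤ R)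
    (hc : ∀ u ∈ Icc (0 : ℝ) 1, |q u - r u| ≤ c) (hu : u ∈ Ioc (0 : ℝ) 1) :
    |pathQuantile q u - pathQuantile r u| ≤ c := by
  have h1 := pathQuantile_le_add hq hr hR hR' hc hu
  have h2 := pathQuantile_le_add hr hq hR' hR (fun v hv => by rw [abs_sub_comm]; exact hc v hv) hu
  exact abs_le.2 ⟨by linarith, by linarith⟩

lemma aemeasurable_pathQuantile (hq : AEMeasurable q unif)
    (hR : ∀ u ∈ Icc (0 : ℝ) 1, |q u| ≤ R) : AEMeasurable (pathQuantile q) unif := by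
  rw [unif, ← restrict_Ioc_eq_restrict_Icc]
  refine aemeasurable_restrict_of_monotoneOn measurableSet_Ioc fun u hu v hv huv => ?_
  rw [← le_pathCdf_iff hq hR hu]
  exact huv.trans ((le_pathCdf_iff hq hR hv).2 le_rfl)

/-- The rearranged path has the distribution of the path. -/
lemma map_pathQuantile (hq : AEMeasurable q unif) (hR : ∀ u ∈ Icc (0 : ℝ) 1, |q u| ≤ R) :
    unif.map (pathQuantile q) = unif.map q := by
  have hm := aemeasurable_pathQuantile hq hR
  have : IsProbabilityMeasure (unif.map q) := Measure.isProbabilityMeasure_map hq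
  have : IsProbabilityMeasure (unif.map (pathQuantile q)) := Measure.isProbabilityMeasure_map hm
  refine Measure.ext_of_Iic _ _ fun z => ?_
  have h1 : unif.map q (Iic z) = ENNReal.ofReal (pathCdf q z) := by
    rw [pathCdf_eq_cdf hq, ProbabilityTheory.cdf_eq_real, ofReal_measureReal]
  rw [h1, Measure.map_apply_of_aemeasurable hm measurableSet_Iic]
  have h2 : (pathQuantile q ⁻¹' Iic z) =ᵐ[unif] Iic (pathCdf q z) := by
    filter_upwards [ae_unif_mem] with u hu
    exact propext (le_pathCdf_iff hq hR hu).symm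
  rw [measure_congr h2, unif, ← restrict_Ioc_eq_restrict_Icc,
    Measure.restrict_apply measurableSet_Iic]
  have h3 : Iic (pathCdf q z) ∩ Ioc (0 : ℝ) 1 = Ioc 0 (pathCdf q z) := by
    ext u
    have := (pathCdf_mem_Icc hq z).2
    simp only [mem_inter_iff, mem_Iic, mem_Ioc]
    exact ⟨fun h => ⟨h.2.1, h.1⟩, fun h => ⟨h.2, h.1, h.2.trans this⟩⟩
  rw [h3, Real.volume_Ioc, sub_zero]

lemma pathCdf_pathQuantile (hq : AEMeasurable q unif) (hR : ∀ u ∈ Icc (0 : ℝ) 1, |q u| ≤ R)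
    (hcont : Continuous (pathCdf q)) (hu : u ∈ Ioc (0 : ℝ) 1) :
    pathCdf q (pathQuantile q u) = u := by
  refine le_antisymm ?_ ((le_pathCdf_iff hq hR hu).2 le_rfl)
  have hev : ∀ᶠ z in 𝓝[<] (pathQuantile q u), pathCdf q z ≤ u := by
    filter_upwards [self_mem_nhdsWithin] with z hz
    exact (not_le.1 fun h => absurd ((le_pathCdf_iff hq hR hu).1 h) (not_le.2 hz)).le
  exact le_of_tendsto (hcont.tendsto _ |>.mono_left nhdsWithin_le_nhds) hev

/-- The average of `k` over the segment from `a` to `b`. -/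
def segmentAverage (k : ℝ → ℝ) (a b : ℝ) : ℝ := ∫ θ in (0 : ℝ)..1, k (a + (b - a) * θ)

lemma continuous_segmentAverage {k : ℝ → ℝ} (hk : Continuous k) :
    Continuous fun p : ℝ × ℝ => segmentAverage k p.1 p.2 := by
  unfold segmentAverage
  apply intervalIntegral.continuous_parametric_intervalIntegral_of_continuous'
  fun_prop

lemma segmentAverage_self (k : ℝ → ℝ) (a : ℝ) : segmentAverage k a a = k a := by
  simp [segmentAverage]

lemma abs_segmentAverage_le {k : ℝ → ℝ} {C : ℝ} (hC : ∀ v, |k v| ≤ C) (a b : ℝ) :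
    |segmentAverage k a b| ≤ C := by
  have := intervalIntegral.norm_integral_le_of_norm_le_const (a := 0) (b := 1)
    (f := fun θ => k (a + (b - a) * θ)) (C := C) fun θ _ => hC _
  simpa [segmentAverage] using this

lemma mul_segmentAverage (k : ℝ → ℝ) (a b : ℝ) :
    (b - a) * segmentAverage k a b = ∫ v in a..b, k v := by
  rw [segmentAverage, intervalIntegral.mul_integral_comp_add_mul]
  simp

lemma integral_mul_step_sub_step {k : ℝ → ℝ} (hk : Continuous k) {a b : ℝ}
    (ha : a ∈ Icc (0 : ℝ) 1) (hb : b ∈ Icc (0 : ℝ) 1) :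
    ∫ u, k u * ((if u ≤ a then 1 else 0) - if u ≤ b then 1 else 0) ∂unif = ∫ u in b..a, k u := by
  have key : ∀ a ∈ Icc (0 : ℝ) 1, ∫ u, k u * (if u ≤ a then 1 else 0) ∂unif = ∫ u in (0 : ℝ)..a, k u := by
    intro a ha
    have h1 : (fun u => k u * (if u ≤ a then (1 : ℝ) else 0)) = (Iic a).indicator k := by
      ext u
      simp [indicator_apply]
    rw [h1, integral_indicator measurableSet_Iic, intervalIntegral.integral_of_le ha.1, unif,
      ← restrict_Ioc_eq_restrict_Icc, Measure.restrict_restrict measurableSet_Iic]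
    congr 2
    ext u
    simp only [mem_inter_iff, mem_Iic, mem_Ioc]
    exact ⟨fun h => ⟨h.2.1, h.1⟩, fun h => ⟨h.2, h.1, h.2.trans ha.2⟩⟩
  have hint : ∀ a, Integrable (fun u => k u * (if u ≤ a then (1 : ℝ) else 0)) unif := by
    intro a
    have h1 : (fun u => k u * (if u ≤ a then (1 : ℝ) else 0)) = (Iic a).indicator k := by
      ext u
      simp [indicator_apply]
    rw [h1]
    exact (hk.continuousOn.integrableOn_compact isCompact_Icc).indicator measurableSet_Iic
  simp only [mul_sub]
  rw [integral_sub (hint a) (hint b), key a ha, key b hb,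
    intervalIntegral.integral_interval_sub_left (hk.intervalIntegrable _ _)
      (hk.intervalIntegrable _ _)]

/-- Weighted differences of quantile functions, as integrals of differences of distribution
functions. -/
lemma integral_mul_pathQuantile_sub {k : ℝ → ℝ} (hk : Continuous k) {C : ℝ} (hC : ∀ v, |k v| ≤ C)
    (hq : AEMeasurable q unif) (hr : AEMeasurable r unif)
    (hR : ∀ u ∈ Icc (0 : ℝ) 1, |q u| ≤ R) (hR' : ∀ u ∈ Icc (0 : ℝ) 1, |r u| ≤ R) :
    ∫ u, k u * (pathQuantile r u - pathQuantile q u) ∂unif =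
      -∫ y in Icc (-R) R,
        segmentAverage k (pathCdf q y) (pathCdf r y) * (pathCdf r y - pathCdf q y) := by
  have hstep : ∀ p : ℝ → ℝ, AEMeasurable p unif → (∀ u ∈ Icc (0 : ℝ) 1, |p u| ≤ R) →
      ∀ u ∈ Ioc (0 : ℝ) 1, IntegrableOn (fun y => if u ≤ pathCdf p y then (1 : ℝ) else 0) (Icc (-R) R) ∧
        ∫ y in Icc (-R) R, (if u ≤ pathCdf p y then (1 : ℝ) else 0) = R - pathQuantile p u := by
    intro p hp hRp u hu
    have h1 : (fun y => if u ≤ pathCdf p y then (1 : ℝ) else 0) =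
        (Ici (pathQuantile p u)).indicator fun _ => 1 := by
      ext y
      simp [indicator_apply, le_pathCdf_iff hp hRp hu]
    have h2 := abs_le.1 (abs_pathQuantile_le hp hRp hu)
    rw [h1]
    refine ⟨(integrableOn_const (by simp)).indicator measurableSet_Ici, ?_⟩
    rw [integral_indicator measurableSet_Ici, Measure.restrict_restrict measurableSet_Ici]
    have h3 : Ici (pathQuantile p u) ∩ Icc (-R) R = Icc (pathQuantile p u) R := by
      ext y
      simp only [mem_inter_iff, mem_Ici, mem_Icc]
      exact ⟨fun h => ⟨h.1, h.2.2⟩, fun h => ⟨h.1, h2.1.trans h.1, h.2⟩⟩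
    rw [h3]
    simp [h2.2]
  have h1 : ∀ᵐ u ∂unif, k u * (pathQuantile r u - pathQuantile q u) =
      ∫ y in Icc (-R) R, k u * ((if u ≤ pathCdf q y then 1 else 0) -
        if u ≤ pathCdf r y then 1 else 0) := by
    filter_upwards [ae_unif_mem] with u hu
    rw [integral_const_mul, integral_sub (hstep q hq hR u hu).1 (hstep r hr hR' u hu).1,
      (hstep q hq hR u hu).2, (hstep r hr hR' u hu).2]
    ring
  rw [integral_congr_ae h1, integral_integral_swap, ← integral_neg]
  · refine integral_congr_ae (ae_of_all _ fun y => ?_)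
    simp only
    rw [integral_mul_step_sub_step hk (pathCdf_mem_Icc hq y) (pathCdf_mem_Icc hr y),
      intervalIntegral.integral_symm, mul_comm, mul_segmentAverage]
  · have hm : ∀ p : ℝ → ℝ, AEMeasurable p unif →
        Measurable fun z : ℝ × ℝ => if z.1 ≤ pathCdf p z.2 then (1 : ℝ) else 0 := fun p hp =>
      Measurable.ite (measurableSet_le measurable_fst ((measurable_pathCdf hp).comp measurable_snd))
        measurable_const measurable_const
    refine Integrable.of_bound (C := C)
      (((hk.measurable.comp measurable_fst).mul ((hm q hq).sub (hm r hr))).aestronglyMeasurable)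
      (ae_of_all _ fun z => ?_)
    have hC0 : 0 ≤ C := (abs_nonneg _).trans (hC 0)
    simp only [Function.uncurry, norm_mul, Real.norm_eq_abs]
    calc |k z.1| * |(if z.1 ≤ pathCdf q z.2 then (1 : ℝ) else 0) -
          if z.1 ≤ pathCdf r z.2 then 1 else 0| ≤ C * 1 := by
          gcongr
          · exact hC _
          · split_ifs <;> simp
      _ = C := mul_one C

/-! ### The area formula for a path with finitely many critical points -/

/-- The critical points in `[0,1]` of a path, with one-sided derivatives at the end points. -/
def critSet (q : ℝ → ℝ) : Set ℝ := {u : ℝ | u ∈ Icc (0 : ℝ) 1 ∧ derivWithin q (Icc 0 1) u = 0}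

/-- A continuously differentiable path on `[0,1]` with at most `N` critical points. -/
structure IsRegularPath (N : ℕ) (q : ℝ → ℝ) : Prop where
  contDiffOn : ContDiffOn ℝ 1 q (Icc 0 1)
  encard_le : (critSet q).encard ≤ N

/-- The part of `[0,1] \ C` on which exactly the points of `B` among those of `C` lie to the
left. When `C` holds the critical points of a path, these are its intervals of strict
monotonicity (or empty), for `B` running through the subsets of `C`. -/
def piece (C B : Finset ℝ) : Set ℝ := {u | u ∈ Icc (0 : ℝ) 1 ∧ u ∉ C ∧ ∀ c ∈ C, c < u ↔ c ∈ B}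

lemma ordConnected_piece (C B : Finset ℝ) : (piece C B).OrdConnected := by
  refine ⟨fun u hu v hv w hw => ⟨⟨hu.1.1.trans hw.1, hw.2.trans hv.1.2⟩, fun hwC => ?_,
    fun c hc => ⟨fun h => ?_, fun h => ?_⟩⟩⟩
  · rcases hw.2.lt_or_eq with h | h
    · exact absurd ((hu.2.2 w hwC).2 ((hv.2.2 w hwC).1 h)) (not_lt.2 hw.1)
    · exact hv.2.1 (h ▸ hwC)
  · exact (hv.2.2 c hc).1 (h.trans_le hw.2)
  · exact ((hu.2.2 c hc).2 h).trans_le hw.1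

lemma measurableSet_piece (C B : Finset ℝ) : MeasurableSet (piece C B) :=
  (ordConnected_piece C B).measurableSet

lemma piece_subset (C B : Finset ℝ) : piece C B ⊆ Icc 0 1 := fun _ hu => hu.1

lemma pairwiseDisjoint_piece (C : Finset ℝ) :
    (C.powerset : Set (Finset ℝ)).PairwiseDisjoint (piece C) := by
  intro B hB B' hB' hne
  refine Set.disjoint_left.2 fun u hu hu' => hne ?_
  have hB := Finset.mem_powerset.1 hB
  have hB' := Finset.mem_powerset.1 hB'
  ext c
  exact ⟨fun h => (hu'.2.2 c (hB h)).1 ((hu.2.2 c (hB h)).2 h),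
    fun h => (hu.2.2 c (hB' h)).1 ((hu'.2.2 c (hB' h)).2 h)⟩

lemma biUnion_piece (C : Finset ℝ) : ⋃ B ∈ C.powerset, piece C B = Icc 0 1 \ (C : Set ℝ) := by
  classical
  ext u
  simp only [mem_iUnion, exists_prop]
  refine ⟨fun ⟨B, _, h⟩ => ⟨h.1, h.2.1⟩, fun h => ⟨C.filter (· < u), ?_, h.1, h.2, ?_⟩⟩
  · exact Finset.mem_powerset.2 (Finset.filter_subset _ _)
  · intro c hc
    simp [hc]

namespace IsRegularPath

variable {N : ℕ} {q h g : ℝ → ℝ}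

lemma continuousOn (hq : IsRegularPath N q) : ContinuousOn q (Icc 0 1) := hq.contDiffOn.continuousOn

lemma continuousOn_deriv (hq : IsRegularPath N q) :
    ContinuousOn (derivWithin q (Icc 0 1)) (Icc 0 1) :=
  hq.contDiffOn.continuousOn_derivWithin (uniqueDiffOn_Icc zero_lt_one) le_rfl

lemma aemeasurable (hq : IsRegularPath N q) : AEMeasurable q unif :=
  hq.continuousOn.aemeasurable measurableSet_Icc

lemma hasDerivWithinAt (hq : IsRegularPath N q) {u : ℝ} (hu : u ∈ Icc (0 : ℝ) 1) :
    HasDerivWithinAt q (derivWithin q (Icc 0 1) u) (Icc 0 1) u :=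
  ((hq.contDiffOn.differentiableOn one_ne_zero) u hu).hasDerivWithinAt

lemma finite_critSet (hq : IsRegularPath N q) : (critSet q).Finite :=
  Set.finite_of_encard_le_coe hq.encard_le

/-- The critical points as a finset. -/
def crit (hq : IsRegularPath N q) : Finset ℝ := hq.finite_critSet.toFinset

lemma coe_crit (hq : IsRegularPath N q) : (hq.crit : Set ℝ) = critSet q := by simp [crit]

lemma card_powerset_crit (hq : IsRegularPath N q) : hq.crit.powerset.card ≤ 2 ^ N := by
  rw [Finset.card_powerset]
  refine Nat.pow_le_pow_right two_pos ?_
  have := hq.encard_le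
  rw [← hq.coe_crit, Set.encard_coe_eq_coe_finsetCard] at this
  exact_mod_cast this

lemma deriv_ne_zero (hq : IsRegularPath N q) {B : Finset ℝ} {u : ℝ} (hu : u ∈ piece hq.crit B) :
    derivWithin q (Icc 0 1) u ≠ 0 := fun h0 =>
  hu.2.1 (by
    rw [← Finset.mem_coe, hq.coe_crit]
    exact ⟨hu.1, h0⟩)

lemma hasDerivWithinAt_piece (hq : IsRegularPath N q) {B : Finset ℝ} {u : ℝ}
    (hu : u ∈ piece hq.crit B) :
    HasDerivWithinAt q (derivWithin q (Icc 0 1) u) (piece hq.crit B) u :=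
  (hq.hasDerivWithinAt hu.1).mono (piece_subset _ _)

/-- By Rolle's theorem, the path is injective on each piece. -/
lemma injOn_piece (hq : IsRegularPath N q) (B : Finset ℝ) : InjOn q (piece hq.crit B) := by
  have key : ∀ u ∈ piece hq.crit B, ∀ v ∈ piece hq.crit B, u < v → q u ≠ q v := by
    intro u hu v hv huv heq
    have hsub : Icc u v ⊆ piece hq.crit B := (ordConnected_piece _ _).out hu hv
    obtain ⟨c, hc, hc0⟩ := exists_hasDerivAt_eq_zero (f' := derivWithin q (Icc 0 1)) huv
      (hq.continuousOn.mono (hsub.trans (piece_subset _ _))) heq fun x hx =>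
        (hq.hasDerivWithinAt (hsub (Ioo_subset_Icc_self hx)).1).hasDerivAt
          (Icc_mem_nhds (hu.1.1.trans_lt hx.1) (hx.2.trans_le hv.1.2))
    exact hq.deriv_ne_zero (hsub (Ioo_subset_Icc_self hc)) hc0
  intro u hu v hv heq
  rcases lt_trichotomy u v with h | h | h
  · exact absurd heq (key u hu v hv h)
  · exact h
  · exact absurd heq.symm (key v hv u hu h)

lemma measurableSet_image_piece (hq : IsRegularPath N q) (B : Finset ℝ) :
    MeasurableSet (q '' piece hq.crit B) :=
  (measurableSet_piece _ _).image_of_continuousOn_injOn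
    (hq.continuousOn.mono (piece_subset _ _)) (hq.injOn_piece B)

/-- The law of a path has density at most `2 ^ N / δ` on the set where the derivative is at
least `δ` in absolute value. The bound depends on the path only through `N` and `δ`. -/
lemma lintegral_comp_le (hq : IsRegularPath N q) {J : Set ℝ} (hJ : MeasurableSet J)
    (hJI : J ⊆ Icc 0 1) {δ : ℝ} (hδ : 0 < δ) (hJδ : ∀ u ∈ J, δ ≤ |derivWithin q (Icc 0 1) u|)
    (k : ℝ → ℝ≥0∞) :
    ∫⁻ u in J, k (q u) ≤ 2 ^ N * (ENNReal.ofReal δ)⁻¹ * ∫⁻ y, k y := by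
  have hδ0 : ENNReal.ofReal δ ≠ 0 := by simpa using hδ
  have hpiece : ∀ B ∈ hq.crit.powerset,
      ∫⁻ u in J ∩ piece hq.crit B, k (q u) ≤ (ENNReal.ofReal δ)⁻¹ * ∫⁻ y, k y := by
    intro B _
    have hm := hJ.inter (measurableSet_piece hq.crit B)
    calc ∫⁻ u in J ∩ piece hq.crit B, k (q u)
        ≤ ∫⁻ u in J ∩ piece hq.crit B, (ENNReal.ofReal δ)⁻¹ *
            (ENNReal.ofReal |derivWithin q (Icc 0 1) u| * k (q u)) := by
          refine setLIntegral_mono' hm fun u hu => ?_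
          rw [← mul_assoc]
          refine le_mul_of_one_le_left zero_le ?_
          rw [← ENNReal.inv_mul_cancel hδ0 ENNReal.ofReal_ne_top]
          gcongr
          exact hJδ u hu.1
      _ = (ENNReal.ofReal δ)⁻¹ * ∫⁻ y in q '' (J ∩ piece hq.crit B), k y := by
          rw [lintegral_const_mul' _ _ (by simpa using hδ), lintegral_image_eq_lintegral_abs_deriv_mul hm
            (fun u hu => (hq.hasDerivWithinAt_piece hu.2).mono inter_subset_right)
            ((hq.injOn_piece B).mono inter_subset_right)]
      _ ≤ (ENNReal.ofReal δ)⁻¹ * ∫⁻ y, k y := by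
          gcongr
          exact Measure.restrict_le_self
  have hsub : J ⊆ ⋃ B ∈ hq.crit.powerset, J ∩ piece hq.crit B := by
    intro u hu
    have : u ∈ ⋃ B ∈ hq.crit.powerset, piece hq.crit B := by
      rw [biUnion_piece]
      refine ⟨hJI hu, fun hc => ?_⟩
      rw [hq.coe_crit] at hc
      have := hJδ u hu
      rw [hc.2, abs_zero] at this
      exact absurd hδ (not_lt.2 this)
    simp only [mem_iUnion] at this ⊢
    obtain ⟨B, hB, h⟩ := this
    exact ⟨B, hB, hu, h⟩
  calc ∫⁻ u in J, k (q u) ≤ ∫⁻ u in ⋃ B ∈ hq.crit.powerset, J ∩ piece hq.crit B, k (q u) :=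
        lintegral_mono_set hsub
    _ = ∑ B ∈ hq.crit.powerset, ∫⁻ u in J ∩ piece hq.crit B, k (q u) :=
        lintegral_biUnion_finset
          ((pairwiseDisjoint_piece hq.crit).mono fun B => inter_subset_right)
          (fun B _ => hJ.inter (measurableSet_piece _ _)) _
    _ ≤ ∑ _B ∈ hq.crit.powerset, (ENNReal.ofReal δ)⁻¹ * ∫⁻ y, k y := Finset.sum_le_sum hpiece
    _ ≤ 2 ^ N * (ENNReal.ofReal δ)⁻¹ * ∫⁻ y, k y := by
        rw [Finset.sum_const, nsmul_eq_mul, mul_assoc]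
        gcongr
        exact_mod_cast hq.card_powerset_crit

end IsRegularPath

/-- The roots in `[0,1]` of `q u = y`. -/
def fiber (q : ℝ → ℝ) (y : ℝ) : Set ℝ := {u : ℝ | u ∈ Icc (0 : ℝ) 1 ∧ q u = y}

/-- The sum of `h u / |q' u|` over the roots `u` of `q u = y`. -/
def fiberSum (q h : ℝ → ℝ) (y : ℝ) : ℝ := ∑ᶠ u ∈ fiber q y, h u / |derivWithin q (Icc 0 1) u|

namespace IsRegularPath

variable {N : ℕ} {q h g : ℝ → ℝ}

lemma finite_fiber (hq : IsRegularPath N q) (y : ℝ) : (fiber q y).Finite := by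
  have hsub : fiber q y ⊆ hq.crit ∪ ⋃ B ∈ hq.crit.powerset, piece hq.crit B ∩ q ⁻¹' {y} := by
    intro u hu
    by_cases hc : u ∈ hq.crit
    · exact Or.inl hc
    · right
      have : u ∈ ⋃ B ∈ hq.crit.powerset, piece hq.crit B := by
        rw [biUnion_piece]
        exact ⟨hu.1, hc⟩
      simp only [mem_iUnion] at this ⊢
      obtain ⟨B, hB, h⟩ := this
      exact ⟨B, hB, h, hu.2⟩
  refine Set.Finite.subset ((Finset.finite_toSet _).union ?_) hsub
  refine Set.Finite.biUnion (Finset.finite_toSet _) fun B _ => Set.Subsingleton.finite ?_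
  intro u hu v hv
  exact hq.injOn_piece B hu.1 hv.1 (hu.2.trans hv.2.symm)

lemma ae_ne (hq : IsRegularPath N q) (y : ℝ) : ∀ᵐ u ∂unif, q u ≠ y := by
  have h0 : ∀ᵐ u ∂unif, u ∉ fiber q y :=
    (ae_restrict_of_ae ((hq.finite_fiber y).countable.ae_notMem volume))
  filter_upwards [h0, ae_restrict_mem measurableSet_Icc] with u hu hI h
  exact hu ⟨hI, h⟩

lemma fiberSum_eq (hq : IsRegularPath N q) (h : ℝ → ℝ) {y : ℝ} (hy : y ∉ q '' critSet q) :
    fiberSum q h y = ∑ B ∈ hq.crit.powerset, (q '' piece hq.crit B).indicator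
      (fun y => h (Function.invFunOn q (piece hq.crit B) y) /
        |derivWithin q (Icc 0 1) (Function.invFunOn q (piece hq.crit B) y)|) y := by
  have hfib : fiber q y = ⋃ B ∈ (hq.crit.powerset : Set (Finset ℝ)),
      (piece hq.crit B ∩ q ⁻¹' {y}) := by
    ext u
    constructor
    · intro hu
      have : u ∈ ⋃ B ∈ hq.crit.powerset, piece hq.crit B := by
        rw [biUnion_piece, hq.coe_crit]
        exact ⟨hu.1, fun hc => hy ⟨u, hc, hu.2⟩⟩
      simp only [mem_iUnion] at this ⊢
      obtain ⟨B, hB, h⟩ := this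
      exact ⟨B, hB, h, hu.2⟩
    · intro hu
      simp only [mem_iUnion] at hu
      obtain ⟨B, hB, h, hu⟩ := hu
      exact ⟨h.1, hu⟩
  have hsub : ∀ B, (piece hq.crit B ∩ q ⁻¹' {y}).Subsingleton := fun B u hu v hv =>
    hq.injOn_piece B hu.1 hv.1 (hu.2.trans hv.2.symm)
  rw [fiberSum, hfib, finsum_mem_biUnion
    ((pairwiseDisjoint_piece hq.crit).mono fun B => inter_subset_left) (Finset.finite_toSet _)
    (fun B _ => (hsub B).finite), finsum_mem_coe_finset]
  refine Finset.sum_congr rfl fun B _ => ?_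
  by_cases hB : y ∈ q '' piece hq.crit B
  · rw [indicator_of_mem hB]
    have h1 : piece hq.crit B ∩ q ⁻¹' {y} = {Function.invFunOn q (piece hq.crit B) y} := by
      refine (hsub B).eq_singleton_of_mem ⟨?_, ?_⟩
      · exact Function.invFunOn_mem hB
      · exact Function.invFunOn_eq hB
    rw [h1, finsum_mem_singleton]
  · rw [indicator_of_notMem hB]
    have h1 : piece hq.crit B ∩ q ⁻¹' {y} = ∅ := by
      refine eq_empty_of_forall_notMem fun u hu => hB ⟨u, hu.1, hu.2⟩
    rw [h1, finsum_mem_empty]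

lemma ae_notMem_image_critSet (hq : IsRegularPath N q) : ∀ᵐ y, y ∉ q '' critSet q :=
  ((hq.finite_critSet.image q).countable.ae_notMem volume)

/-- **Area formula**: weighting the roots of `q u = y` by `h u / |q' u|` turns integrals in `y`
into integrals in `u`. -/
lemma integral_mul_fiberSum (hq : IsRegularPath N q)
    (hint : Integrable (fun u => g (q u) * h u) unif) :
    Integrable (fun y => g y * fiberSum q h y) ∧
      ∫ y, g y * fiberSum q h y = ∫ u, g (q u) * h u ∂unif := by
  set G : Finset ℝ → ℝ → ℝ := fun B y => g y * (h (Function.invFunOn q (piece hq.crit B) y) /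
        |derivWithin q (Icc 0 1) (Function.invFunOn q (piece hq.crit B) y)|) with hG
  have hae : (fun y => g y * fiberSum q h y) =ᵐ[volume] fun y => ∑ B ∈ hq.crit.powerset,
      (q '' piece hq.crit B).indicator (G B) y := by
    filter_upwards [hq.ae_notMem_image_critSet] with y hy
    rw [hq.fiberSum_eq h hy, Finset.mul_sum]
    refine Finset.sum_congr rfl fun B _ => ?_
    by_cases hB : y ∈ q '' piece hq.crit B
    · rw [indicator_of_mem hB, indicator_of_mem hB]
    · rw [indicator_of_notMem hB, indicator_of_notMem hB, mul_zero]
  have hpt : ∀ B, ∀ u ∈ piece hq.crit B,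
      |derivWithin q (Icc 0 1) u| • G B (q u) = g (q u) * h u := by
    intro B u hu
    have h0 := abs_ne_zero.2 (hq.deriv_ne_zero hu)
    simp only [hG, smul_eq_mul]
    rw [(hq.injOn_piece B).leftInvOn_invFunOn hu]
    field_simp
  have hintB : ∀ B, IntegrableOn (fun u => g (q u) * h u) (piece hq.crit B) := fun B =>
    IntegrableOn.mono_set hint (piece_subset _ _)
  have hGint : ∀ B, IntegrableOn (G B) (q '' piece hq.crit B) := by
    intro B
    rw [integrableOn_image_iff_integrableOn_abs_deriv_smul (measurableSet_piece _ _)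
      (fun u hu => hq.hasDerivWithinAt_piece hu) (hq.injOn_piece B)]
    exact (integrableOn_congr_fun (hpt B) (measurableSet_piece _ _)).2 (hintB B)
  have hGi : ∀ B ∈ hq.crit.powerset,
      Integrable ((q '' piece hq.crit B).indicator (G B)) := fun B _ =>
    (hGint B).integrable_indicator (hq.measurableSet_image_piece B)
  refine ⟨(integrable_finsetSum _ hGi).congr hae.symm, ?_⟩
  rw [integral_congr_ae hae, integral_finsetSum _ hGi]
  have h1 : ∀ B ∈ hq.crit.powerset, ∫ y, (q '' piece hq.crit B).indicator (G B) y =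
      ∫ u in piece hq.crit B, g (q u) * h u := by
    intro B _
    rw [integral_indicator (hq.measurableSet_image_piece B),
      integral_image_eq_integral_abs_deriv_smul (measurableSet_piece _ _)
      (fun u hu => hq.hasDerivWithinAt_piece hu) (hq.injOn_piece B)]
    exact setIntegral_congr_fun (measurableSet_piece _ _) (hpt B)
  rw [Finset.sum_congr rfl h1, ← integral_biUnion_finset _ (fun B _ => measurableSet_piece _ _)
    (pairwiseDisjoint_piece _) (fun B _ => hintB B), biUnion_piece]
  refine setIntegral_congr_set ?_
  exact sdiff_null_ae_eq_self ((Finset.finite_toSet _).measure_zero _)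

lemma abs_fiberSum_le (hq : IsRegularPath N q) {c : ℝ} (hc : ∀ u ∈ Icc (0 : ℝ) 1, |h u| ≤ c)
    (y : ℝ) : |fiberSum q h y| ≤ c * fiberSum q 1 y := by
  rw [fiberSum, fiberSum, finsum_mem_eq_finite_toFinset_sum _ (hq.finite_fiber y),
    finsum_mem_eq_finite_toFinset_sum _ (hq.finite_fiber y), Finset.mul_sum]
  refine (Finset.abs_sum_le_sum_abs _ _).trans (Finset.sum_le_sum fun u hu => ?_)
  have hu' : u ∈ fiber q y := by simpa using hu
  rw [abs_div, abs_abs, Pi.one_apply, mul_one_div]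
  gcongr
  exact hc u hu'.1

lemma fiberSum_one_nonneg (q : ℝ → ℝ) (y : ℝ) : 0 ≤ fiberSum q 1 y := by
  refine finsum_nonneg fun u => finsum_nonneg fun _ => ?_
  rw [Pi.one_apply]
  positivity

lemma integrable_fiberSum (hq : IsRegularPath N q) (hh : Integrable h unif) :
    Integrable (fiberSum q h) := by
  simpa using (hq.integral_mul_fiberSum (g := fun _ => 1) (h := h) (by simpa using hh)).1

lemma fiberSum_of_notMem {y : ℝ} (hy : y ∉ q '' Icc 0 1) : fiberSum q h y = 0 := by
  have : fiber q y = ∅ := eq_empty_of_forall_notMem fun u hu => hy ⟨u, hu.1, hu.2⟩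
  rw [fiberSum, this, finsum_mem_empty]

/-- The law of the path has density `∑ 1 / |q' u|`. -/
lemma map_eq_withDensity (hq : IsRegularPath N q) :
    unif.map q = volume.withDensity fun y => ENNReal.ofReal (fiberSum q 1 y) := by
  ext s hs
  have hpre : NullMeasurableSet (q ⁻¹' s) unif := hq.aemeasurable.nullMeasurableSet_preimage hs
  have hcomp : (fun u => s.indicator (fun _ => (1 : ℝ)) (q u) * (1 : ℝ → ℝ) u) =
      (q ⁻¹' s).indicator fun _ => 1 := by
    ext u
    by_cases hu : q u ∈ s <;> simp [indicator, hu]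
  have harea := hq.integral_mul_fiberSum (g := s.indicator fun _ => 1) (h := 1) (by
    rw [hcomp]
    exact (integrable_const (1 : ℝ)).indicator₀ hpre)
  have hind : (fun y => s.indicator (fun _ => (1 : ℝ)) y * fiberSum q 1 y) =
      s.indicator (fiberSum q 1) := by
    ext y
    by_cases hy : y ∈ s <;> simp [hy]
  have hfi : Integrable (fiberSum q 1) := hq.integrable_fiberSum (integrable_const (1 : ℝ))
  rw [hind, integral_indicator hs, hcomp, integral_indicator₀ hpre] at harea
  rw [withDensity_apply _ hs, ← ofReal_integral_eq_lintegral_ofReal hfi.integrableOn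
    (ae_of_all _ (fiberSum_one_nonneg q)), harea.2, Measure.map_apply_of_aemeasurable
    hq.aemeasurable hs, setIntegral_const, smul_eq_mul, mul_one, ofReal_measureReal]

lemma map_absolutelyContinuous (hq : IsRegularPath N q) : unif.map q ≪ volume := by
  rw [hq.map_eq_withDensity]
  exact withDensity_absolutelyContinuous _ _

/-- By Lebesgue's differentiation theorem, the density is the derivative of the distribution
function. -/
lemma ae_hasDerivAt_pathCdf (hq : IsRegularPath N q) :
    ∀ᵐ y, HasDerivAt (pathCdf q) (fiberSum q 1 y) y := by
  have : IsProbabilityMeasure (unif.map q) := Measure.isProbabilityMeasure_map hq.aemeasurable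
  have hfi : Integrable (fiberSum q 1) := hq.integrable_fiberSum (integrable_const (1 : ℝ))
  have h1 := (ProbabilityTheory.cdf (unif.map q)).ae_hasDerivAt
  rw [ProbabilityTheory.measure_cdf, hq.map_eq_withDensity] at h1
  have h2 := Measure.rnDeriv_withDensity₀ volume hfi.aestronglyMeasurable.aemeasurable.ennreal_ofReal
  filter_upwards [h1, h2] with y hy1 hy2
  rw [hy2, ENNReal.toReal_ofReal (fiberSum_one_nonneg q y)] at hy1
  rw [funext (pathCdf_eq_cdf hq.aemeasurable), hq.map_eq_withDensity]
  exact hy1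

/-- Distribution functions converge along convergent paths, as the level sets of the limit are
null. -/
lemma tendsto_pathCdf (hq : IsRegularPath N q) {ι : Type*} {l : Filter ι} [l.IsCountablyGenerated]
    {p : ι → ℝ → ℝ} (hp : ∀ᶠ i in l, AEMeasurable (p i) unif)
    (hpq : ∀ u ∈ Icc (0 : ℝ) 1, Tendsto (fun i => p i u) l (𝓝 (q u))) {y : ι → ℝ} {z : ℝ}
    (hy : Tendsto y l (𝓝 z)) :
    Tendsto (fun i => pathCdf (p i) (y i)) l (𝓝 (pathCdf q z)) := by
  simp only [pathCdf_eq_integral]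
  refine tendsto_integral_filter_of_dominated_convergence (fun _ => 1) ?_ ?_ (integrable_const _) ?_
  · filter_upwards [hp] with i hi
    have hs : NullMeasurableSet (p i ⁻¹' Iic (y i)) unif := hi.nullMeasurableSet_preimage measurableSet_Iic
    exact ((integrable_const (1 : ℝ)).indicator₀ hs).aestronglyMeasurable.congr
      (ae_of_all _ fun u => by by_cases h : p i u ≤ y i <;> simp [indicator, h])
  · refine Eventually.of_forall fun i => ae_of_all _ fun u => ?_
    split_ifs <;> simp
  · filter_upwards [hq.ae_ne z, ae_restrict_mem measurableSet_Icc] with u hu hI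
    refine tendsto_const_nhds.congr' ?_
    rcases hu.lt_or_gt with h | h
    · filter_upwards [(hpq u hI).eventually_lt hy h] with i hi
      rw [if_pos h.le, if_pos hi.le]
    · filter_upwards [hy.eventually_lt (hpq u hI) h] with i hi
      rw [if_neg (not_le.2 h), if_neg (not_le.2 hi)]

lemma continuous_pathCdf (hq : IsRegularPath N q) : Continuous (pathCdf q) :=
  continuous_iff_continuousAt.2 fun _ => hq.tendsto_pathCdf
    (Eventually.of_forall fun _ => hq.aemeasurable) (fun _ _ => tendsto_const_nhds) tendsto_id

lemma exists_bound (hq : IsRegularPath N q) : ∃ R, ∀ u ∈ Icc (0 : ℝ) 1, |q u| ≤ R :=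
  isCompact_Icc.exists_bound_of_continuousOn hq.continuousOn

/-- The change of variables `v = F(y)`: the derivative of the rearrangement operator in direction
`h`, in which `f` is a version of the density of the law of `q`, is a bounded function, and its
integrals against `k` are those of `k (F (q u)) * h u`. -/
lemma quantile_derivative (hq : IsRegularPath N q) {f : ℝ → ℝ}
    (hf : ∀ᵐ y, y ∈ q '' Icc 0 1 → f y = fiberSum q 1 y) (hh : ContinuousOn h (Icc 0 1))
    {c : ℝ} (hc : ∀ u ∈ Icc (0 : ℝ) 1, |h u| ≤ c) :
    AEStronglyMeasurable (fun v => 1 / f (pathQuantile q v) * fiberSum q h (pathQuantile q v)) unif ∧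
    (∀ᵐ v ∂unif, |1 / f (pathQuantile q v) * fiberSum q h (pathQuantile q v)| ≤ c) ∧
    ∀ k : ℝ → ℝ, Continuous k →
      ∫ v, k v * (1 / f (pathQuantile q v) * fiberSum q h (pathQuantile q v)) ∂unif =
        ∫ u, k (pathCdf q (q u)) * h u ∂unif := by
  obtain ⟨R, hR⟩ := hq.exists_bound
  have hqm := hq.aemeasurable
  have hQm := aemeasurable_pathQuantile hqm hR
  have hmap := map_pathQuantile hqm hR
  have hac := hq.map_absolutelyContinuous
  have hc0 : 0 ≤ c := (abs_nonneg _).trans (hc 0 (by simp))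
  have hhi : Integrable h unif := hh.integrableOn_compact isCompact_Icc
  have hSh := hq.integrable_fiberSum hhi
  have hS1 : Integrable (fiberSum q 1) := hq.integrable_fiberSum (integrable_const (1 : ℝ))
  set φ : ℝ → ℝ := fun y => 1 / f y * fiberSum q h y with hφ
  have hφeq : ∀ᵐ y, φ y = (fiberSum q 1 y)⁻¹ * fiberSum q h y := by
    filter_upwards [hf] with y hy
    by_cases hyI : y ∈ q '' Icc 0 1
    · simp only [hφ, hy hyI, one_div]
    · simp only [hφ, fiberSum_of_notMem hyI, mul_zero]
  have hφm : AEStronglyMeasurable φ volume :=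
    (hS1.aestronglyMeasurable.aemeasurable.inv.mul
      hSh.aestronglyMeasurable.aemeasurable).aestronglyMeasurable.congr
      (hφeq.mono fun y hy => hy.symm)
  have hφc : ∀ᵐ y, |φ y| ≤ c := by
    filter_upwards [hφeq] with y hy
    rw [hy, abs_mul, abs_inv, abs_of_nonneg (fiberSum_one_nonneg q y)]
    rcases (fiberSum_one_nonneg q y).eq_or_lt with h0 | h0
    · rw [← h0]
      simpa using hc0
    · rw [inv_mul_le_iff₀ h0, mul_comm]
      exact hq.abs_fiberSum_le hc y
  have hφS : ∀ᵐ y, φ y * fiberSum q 1 y = fiberSum q h y := by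
    filter_upwards [hφeq] with y hy
    rw [hy]
    rcases (fiberSum_one_nonneg q y).eq_or_lt with h0 | h0
    · have := hq.abs_fiberSum_le hc y
      rw [← h0, mul_zero] at this
      rw [abs_nonpos_iff.1 this, mul_zero, zero_mul]
    · field_simp
  have hφlaw : AEStronglyMeasurable φ (unif.map (pathQuantile q)) := by
    rw [hmap]
    exact hφm.mono_ac hac
  refine ⟨hφlaw.comp_aemeasurable hQm, ?_, fun k hk => ?_⟩
  · refine ae_of_ae_map (p := fun y => |φ y| ≤ c) hQm ?_
    rw [hmap]
    exact hac.ae_le hφc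
  · have hFc := hq.continuous_pathCdf
    obtain ⟨C, hC⟩ := isCompact_Icc.exists_bound_of_continuousOn (hk.continuousOn (s := Icc (0 : ℝ) 1))
    have hkF : ∀ y, |k (pathCdf q y)| ≤ C := fun y => hC _ (pathCdf_mem_Icc hqm y)
    have hψlaw : AEStronglyMeasurable (fun y => k (pathCdf q y) * φ y) (unif.map q) :=
      (hk.comp hFc).aestronglyMeasurable.mul (hφm.mono_ac hac)
    have hψlaw' : AEStronglyMeasurable (fun y => k (pathCdf q y) * φ y)
      (unif.map (pathQuantile q)) := by rwa [hmap]
    calc ∫ v, k v * φ (pathQuantile q v) ∂unif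
        = ∫ v, k (pathCdf q (pathQuantile q v)) * φ (pathQuantile q v) ∂unif := by
          refine integral_congr_ae ?_
          filter_upwards [ae_unif_mem] with v hv
          rw [pathCdf_pathQuantile hqm hR hFc hv]
      _ = ∫ y, k (pathCdf q y) * φ y ∂(unif.map (pathQuantile q)) := (integral_map hQm hψlaw').symm
      _ = ∫ u, k (pathCdf q (q u)) * φ (q u) * (1 : ℝ → ℝ) u ∂unif := by
          rw [hmap, integral_map hqm hψlaw]
          simp
      _ = ∫ y, k (pathCdf q y) * φ y * fiberSum q 1 y := by
          refine ((hq.integral_mul_fiberSum (g := fun y => k (pathCdf q y) * φ y) ?_).2).symm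
          refine Integrable.of_bound (C := C * c) ?_ ?_
          · exact (hψlaw.comp_aemeasurable hqm).congr (ae_of_all _ fun u => by simp)
          · filter_upwards [ae_of_ae_map hqm (hac.ae_le hφc)] with u hu
            simp only [Pi.one_apply, mul_one, norm_mul, Real.norm_eq_abs]
            have := hkF (q u)
            have hC0 : 0 ≤ C := (abs_nonneg _).trans this
            gcongr
      _ = ∫ y, k (pathCdf q y) * fiberSum q h y := by
          refine integral_congr_ae ?_
          filter_upwards [hφS] with y hy
          rw [mul_assoc, hy]
      _ = ∫ u, k (pathCdf q (q u)) * h u ∂unif := by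
          refine (hq.integral_mul_fiberSum (g := fun y => k (pathCdf q y)) ?_).2
          exact ((hk.comp hFc).comp_continuousOn hq.continuousOn |>.mul hh).integrableOn_compact
            isCompact_Icc

end IsRegularPath

/-! ### Weights along converging paths -/

/-- `C^1` convergence on `[0,1]` of paths with a common bound on the number of critical points. -/
structure PathConvergence {ι : Type*} (l : Filter ι) (N : ℕ) (p : ι → ℝ → ℝ) (q : ℝ → ℝ) :
    Prop where
  limit : IsRegularPath N q
  regular : ∀ᶠ i in l, IsRegularPath N (p i)
  tendsto_path : TendstoUniformlyOn p q l (Icc 0 1)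
  tendsto_deriv : TendstoUniformlyOn (fun i => derivWithin (p i) (Icc 0 1))
    (derivWithin q (Icc 0 1)) l (Icc 0 1)

/-- Almost everywhere convergence of weights with a common bound `C`, which vanish outside of a
common set `K` of finite measure. -/
structure WeightConvergence {ι : Type*} (l : Filter ι) (K : Set ℝ) (C : ℝ) (γ : ι → ℝ → ℝ)
    (g : ℝ → ℝ) : Prop where
  measurableSet : MeasurableSet K
  measure_ne_top : volume K ≠ ∞
  measurable_limit : Measurable g
  measurable : ∀ᶠ i in l, Measurable (γ i)
  abs_limit_le : ∀ y, |g y| ≤ C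
  abs_le : ∀ᶠ i in l, ∀ y, |γ i y| ≤ C
  limit_of_notMem : ∀ y ∉ K, g y = 0
  of_notMem : ∀ᶠ i in l, ∀ y ∉ K, γ i y = 0
  ae_tendsto : ∀ᵐ y, Tendsto (fun i => γ i y) l (𝓝 (g y))

lemma IsRegularPath.add_const {N : ℕ} {q : ℝ → ℝ} (hq : IsRegularPath N q) (c : ℝ) :
    IsRegularPath N fun u => q u + c := by
  refine ⟨hq.contDiffOn.add contDiffOn_const, ?_⟩
  have : critSet (fun u => q u + c) = critSet q := by
    ext u
    simp only [critSet, derivWithin_add_const]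
  rw [this]
  exact hq.encard_le

lemma eventually_abs_le {ι : Type*} {l : Filter ι} {k : ι → ℝ → ℝ} {h : ℝ → ℝ} {c : ℝ}
    (hkh : TendstoUniformlyOn k h l (Icc 0 1)) (hc : ∀ u ∈ Icc (0 : ℝ) 1, |h u| ≤ c) :
    ∀ᶠ i in l, ∀ u ∈ Icc (0 : ℝ) 1, |k i u| ≤ c + 1 := by
  filter_upwards [Metric.tendstoUniformlyOn_iff.1 hkh 1 one_pos] with i hi u hu
  have h1 := hi u hu
  have h2 := hc u hu
  rw [Real.dist_eq, abs_sub_comm] at h1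
  have h3 := abs_sub_abs_le_abs_sub (k i u) (h u)
  linarith

lemma enorm_sub_le_of_abs_le {a b C : ℝ} (ha : |a| ≤ C) (hb : |b| ≤ C) :
    ‖a - b‖ₑ ≤ ENNReal.ofReal (2 * C) := by
  rw [Real.enorm_eq_ofReal_abs]
  apply ENNReal.ofReal_le_ofReal
  have := abs_sub a b
  linarith

section

variable {ι : Type*} {l : Filter ι} {N : ℕ} {p : ι → ℝ → ℝ} {q : ℝ → ℝ}
  {K : Set ℝ} {C : ℝ} {γ : ι → ℝ → ℝ} {g : ℝ → ℝ}

lemma PathConvergence.add_const (hp : PathConvergence l N p q) {c : ι → ℝ}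
    (hc : Tendsto c l (𝓝 0)) : PathConvergence l N (fun i u => p i u + c i) q := by
  refine ⟨hp.limit, hp.regular.mono fun i hi => hi.add_const _, ?_, ?_⟩
  · rw [Metric.tendstoUniformlyOn_iff]
    intro ε hε
    filter_upwards [Metric.tendstoUniformlyOn_iff.1 hp.tendsto_path (ε / 2) (half_pos hε),
      Metric.tendsto_nhds.1 hc (ε / 2) (half_pos hε)] with i h1 h2 u hu
    have h3 := h1 u hu
    rw [Real.dist_eq] at h2 h3 ⊢
    calc |q u - (p i u + c i)| = |(q u - p i u) - (c i - 0)| := by ring_nf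
      _ ≤ |q u - p i u| + |c i - 0| := abs_sub _ _
      _ < ε := by linarith
  · have : ∀ i, derivWithin (fun u => p i u + c i) (Icc 0 1) = derivWithin (p i) (Icc 0 1) :=
      fun i => funext fun u => derivWithin_add_const _
    simpa only [this] using hp.tendsto_deriv

variable [l.IsCountablyGenerated]

lemma WeightConvergence.tendsto_lintegral (h : WeightConvergence l K C γ g) :
    Tendsto (fun i => ∫⁻ y, ‖γ i y - g y‖ₑ) l (𝓝 0) := by
  have hlim := tendsto_lintegral_filter_of_dominated_convergence' (μ := volume) (l := l)
    (F := fun i y => ‖γ i y - g y‖ₑ) (f := fun _ => 0)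
    (K.indicator fun _ => ENNReal.ofReal (2 * C)) ?_ ?_ ?_ ?_
  · simpa using hlim
  · filter_upwards [h.measurable] with i hi
    exact (hi.sub h.measurable_limit).enorm.aemeasurable
  · filter_upwards [h.abs_le, h.of_notMem] with i h1 h2
    refine ae_of_all _ fun y => ?_
    by_cases hy : y ∈ K
    · rw [indicator_of_mem hy]
      exact enorm_sub_le_of_abs_le (h1 y) (h.abs_limit_le y)
    · simp [h2 y hy, h.limit_of_notMem y hy]
  · rw [lintegral_indicator_const h.measurableSet]
    exact ENNReal.mul_ne_top ENNReal.ofReal_ne_top h.measure_ne_top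
  · filter_upwards [h.ae_tendsto] with y hy
    have : Tendsto (fun i => ‖γ i y - g y‖ₑ) l (𝓝 ‖g y - g y‖ₑ) := (hy.sub_const _).enorm
    simpa using this

lemma IsRegularPath.exists_small_deriv (hq : IsRegularPath N q) {ε : ℝ≥0∞} (hε : 0 < ε) :
    ∃ δ : ℝ, 0 < δ ∧ ∃ J : Set ℝ, MeasurableSet J ∧ J ⊆ Icc 0 1 ∧
      (∀ u ∈ J, 2 * δ ≤ |derivWithin q (Icc 0 1) u|) ∧ volume (Icc 0 1 \ J) ≤ ε := by
  set J : ℕ → Set ℝ := fun n =>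
    Icc 0 1 ∩ (fun u => |derivWithin q (Icc 0 1) u|) ⁻¹' Ici (2 * (1 / ((n : ℝ) + 1))) with hJ
  have hJm : ∀ n, MeasurableSet (J n) := fun n =>
    (hq.continuousOn_deriv.abs.preimage_isClosed_of_isClosed isClosed_Icc isClosed_Ici).measurableSet
  have hanti : Antitone fun n => Icc (0 : ℝ) 1 \ J n := by
    intro m n hmn u hu
    refine ⟨hu.1, fun hum => hu.2 ⟨hu.1, ?_⟩⟩
    have h1 : 1 / ((n : ℝ) + 1) ≤ 1 / ((m : ℝ) + 1) := Nat.one_div_le_one_div hmn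
    have h2 : 2 * (1 / ((m : ℝ) + 1)) ≤ |derivWithin q (Icc 0 1) u| := hum.2
    simp only [mem_preimage, mem_Ici]
    linarith
  have hinter : ⋂ n, Icc (0 : ℝ) 1 \ J n ⊆ critSet q := by
    intro u hu
    rw [mem_iInter] at hu
    refine ⟨(hu 0).1, by_contra fun h0 => ?_⟩
    obtain ⟨n, hn⟩ := exists_nat_one_div_lt (half_pos (abs_pos.2 h0))
    exact (hu n).2 ⟨(hu 0).1, by simp only [mem_preimage, mem_Ici]; linarith⟩
  have hlim := tendsto_measure_iInter_atTop (μ := volume) (s := fun n => Icc (0 : ℝ) 1 \ J n)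
    (fun n => (measurableSet_Icc.diff (hJm n)).nullMeasurableSet) hanti
    ⟨0, ((measure_mono sdiff_subset).trans_lt (by simp : volume (Icc (0 : ℝ) 1) < ∞)).ne⟩
  rw [measure_mono_null hinter (hq.finite_critSet.measure_zero _)] at hlim
  obtain ⟨n, hn⟩ := (ENNReal.tendsto_nhds_zero.1 hlim ε hε).exists
  exact ⟨1 / ((n : ℝ) + 1), by positivity, J n, hJm n, inter_subset_left, fun u hu => hu.2, hn⟩

/-- Weights that converge almost everywhere, composed with paths that converge in `C^1`, converge
in `L^1`: off a set of small measure the laws of the paths have uniformly bounded densities, and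
there the limit weight may be replaced by a continuous function. -/
lemma PathConvergence.tendsto_lintegral_comp (hp : PathConvergence l N p q)
    (hγ : WeightConvergence l K C γ g) :
    Tendsto (fun i => ∫⁻ u, ‖γ i (p i u) - g (q u)‖ₑ ∂unif) l (𝓝 0) := by
  have hq := hp.limit
  rw [ENNReal.tendsto_nhds_zero]
  intro ε' hε'
  set D : ℝ≥0∞ := ENNReal.ofReal (2 * C) + 4 with hD
  have hD0 : D ≠ 0 := by simp [hD]
  have hDtop : D ≠ ∞ := ENNReal.add_ne_top.2 ⟨ENNReal.ofReal_ne_top, by simp⟩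
  set ε : ℝ≥0∞ := ε' / D with hε_def
  have hε : 0 < ε := ENNReal.div_pos hε'.ne' hDtop
  obtain ⟨δ, hδ, J, hJm, hJI, hJδ, hJvol⟩ := hq.exists_small_deriv hε
  set A : ℝ≥0∞ := 2 ^ N * (ENNReal.ofReal δ)⁻¹ with hA
  have hA0 : A ≠ 0 := by simp [hA]
  have hAtop : A ≠ ∞ := ENNReal.mul_ne_top (by simp) (by simpa using hδ)
  have hgint : Integrable g := by
    refine Integrable.mono' (g := K.indicator fun _ => C)
      ((integrable_indicator_iff hγ.measurableSet).2 (integrableOn_const hγ.measure_ne_top))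
      hγ.measurable_limit.aestronglyMeasurable (ae_of_all _ fun y => ?_)
    by_cases hy : y ∈ K
    · rw [indicator_of_mem hy]
      exact hγ.abs_limit_le y
    · rw [indicator_of_notMem hy, hγ.limit_of_notMem y hy, norm_zero]
  obtain ⟨φ, hφs, hφε, hφc, -⟩ := hgint.exists_hasCompactSupport_lintegral_sub_le
    (ENNReal.div_pos hε.ne' hAtop).ne'
  have hAφ : A * ∫⁻ y, ‖g y - φ y‖ₑ ≤ ε := by
    calc A * ∫⁻ y, ‖g y - φ y‖ₑ ≤ A * (ε / A) := by gcongr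
      _ = ε := ENNReal.mul_div_cancel hA0 hAtop
  have hAγ : ∀ᶠ i in l, A * ∫⁻ y, ‖γ i y - g y‖ₑ ≤ ε := by
    have h := ENNReal.Tendsto.const_mul (a := A) hγ.tendsto_lintegral (Or.inr hAtop)
    rw [mul_zero] at h
    exact ENNReal.tendsto_nhds_zero.1 h ε hε
  have hφu := (hφs.uniformContinuous_of_continuous hφc).comp_tendstoUniformlyOn hp.tendsto_path
  filter_upwards [hAγ, hγ.measurable, hγ.abs_le, hp.regular,
    EMetric.tendstoUniformlyOn_iff.1 hφu ε hε,
    Metric.tendstoUniformlyOn_iff.1 hp.tendsto_deriv δ hδ] with i hi1 hi2 hi3 hi4 hi5 hi6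
  have hderiv : ∀ u ∈ J, δ ≤ |derivWithin (p i) (Icc 0 1) u| := by
    intro u hu
    have h1 := hJδ u hu
    have h2 := hi6 u (hJI hu)
    rw [Real.dist_eq] at h2
    have h3 := abs_sub_abs_le_abs_sub (derivWithin q (Icc 0 1) u) (derivWithin (p i) (Icc 0 1) u)
    linarith
  have hpm : AEMeasurable (p i) (volume.restrict J) :=
    hi4.aemeasurable.mono_measure (Measure.restrict_mono hJI le_rfl)
  have hsplit : ∫⁻ u in J, ‖γ i (p i u) - g (q u)‖ₑ ≤ ε + (ε + (ε + ε)) := by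
    calc ∫⁻ u in J, ‖γ i (p i u) - g (q u)‖ₑ
        ≤ ∫⁻ u in J, (‖γ i (p i u) - g (p i u)‖ₑ + (‖g (p i u) - φ (p i u)‖ₑ +
            (ε + ‖g (q u) - φ (q u)‖ₑ))) := by
          refine setLIntegral_mono' hJm fun u hu => ?_
          have h5 := (hi5 u (hJI hu)).le
          rw [edist_comm, edist_eq_enorm_sub] at h5
          calc ‖γ i (p i u) - g (q u)‖ₑ
              = ‖(γ i (p i u) - g (p i u)) + ((g (p i u) - φ (p i u)) +
                  ((φ (p i u) - φ (q u)) + -(g (q u) - φ (q u))))‖ₑ := by ring_nf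
            _ ≤ ‖γ i (p i u) - g (p i u)‖ₑ + (‖g (p i u) - φ (p i u)‖ₑ +
                  (‖φ (p i u) - φ (q u)‖ₑ + ‖-(g (q u) - φ (q u))‖ₑ)) :=
                (enorm_add_le _ _).trans (add_le_add_right ((enorm_add_le _ _).trans
                  (add_le_add_right (enorm_add_le _ _) _)) _)
            _ ≤ _ := by
                rw [enorm_neg]
                gcongr
                exact h5
      _ = (∫⁻ u in J, ‖γ i (p i u) - g (p i u)‖ₑ) + ((∫⁻ u in J, ‖g (p i u) - φ (p i u)‖ₑ) +
            ((∫⁻ _ in J, ε) + ∫⁻ u in J, ‖g (q u) - φ (q u)‖ₑ)) := by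
          rw [lintegral_add_left', lintegral_add_left', lintegral_add_left' aemeasurable_const]
          · exact ((hγ.measurable_limit.sub hφc.measurable).enorm).comp_aemeasurable hpm
          · exact ((hi2.sub hγ.measurable_limit).enorm).comp_aemeasurable hpm
      _ ≤ A * (∫⁻ y, ‖γ i y - g y‖ₑ) + (A * (∫⁻ y, ‖g y - φ y‖ₑ) +
            (ε + A * ∫⁻ y, ‖g y - φ y‖ₑ)) := by
          gcongr
          · exact hi4.lintegral_comp_le hJm hJI hδ hderiv fun y => ‖γ i y - g y‖ₑ
          · exact hi4.lintegral_comp_le hJm hJI hδ hderiv fun y => ‖g y - φ y‖ₑ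
          · rw [setLIntegral_const]
            refine mul_le_of_le_one_right zero_le ((measure_mono hJI).trans ?_)
            simp
          · exact hq.lintegral_comp_le hJm hJI hδ
              (fun u hu => by linarith [hJδ u hu]) fun y => ‖g y - φ y‖ₑ
      _ ≤ ε + (ε + (ε + ε)) := by gcongr
  calc ∫⁻ u, ‖γ i (p i u) - g (q u)‖ₑ ∂unif
      ≤ ∫⁻ u in J ∪ Icc 0 1 \ J, ‖γ i (p i u) - g (q u)‖ₑ :=
        lintegral_mono_set (by rw [union_sdiff_self]; exact subset_union_right)
    _ ≤ (∫⁻ u in J, ‖γ i (p i u) - g (q u)‖ₑ) + ∫⁻ u in Icc 0 1 \ J, ‖γ i (p i u) - g (q u)‖ₑ :=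
        lintegral_union_le _ _ _
    _ ≤ (ε + (ε + (ε + ε))) + ENNReal.ofReal (2 * C) * ε := by
        gcongr
        calc ∫⁻ u in Icc 0 1 \ J, ‖γ i (p i u) - g (q u)‖ₑ
            ≤ ∫⁻ _ in Icc 0 1 \ J, ENNReal.ofReal (2 * C) :=
              lintegral_mono fun u => enorm_sub_le_of_abs_le (hi3 _) (hγ.abs_limit_le _)
          _ = ENNReal.ofReal (2 * C) * volume (Icc 0 1 \ J) := setLIntegral_const _ _
          _ ≤ _ := by gcongr
    _ = D * ε := by
        rw [hD]
        ring
    _ = ε' := ENNReal.mul_div_cancel hD0 hDtop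

end

/-! ### Difference quotients of distribution functions -/

/-- The signed indicator `1{a ≤ s} - 1{0 ≤ s}` of the interval between `0` and `a`. -/
def stepDiff (a s : ℝ) : ℝ := (if a ≤ s then 1 else 0) - if 0 ≤ s then 1 else 0

lemma measurable_stepDiff : Measurable fun z : ℝ × ℝ => stepDiff z.1 z.2 :=
  (Measurable.ite (measurableSet_le measurable_fst measurable_snd) measurable_const
    measurable_const).sub
    (Measurable.ite (measurableSet_le measurable_const measurable_snd) measurable_const
      measurable_const)

lemma abs_stepDiff_le_one (a s : ℝ) : |stepDiff a s| ≤ 1 := by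
  unfold stepDiff
  split_ifs <;> simp

lemma stepDiff_of_notMem {a c s : ℝ} (ha : |a| ≤ c) (hs : s ∉ Icc (-c) c) : stepDiff a s = 0 := by
  have h1 := abs_le.1 ha
  have hc : 0 ≤ c := (abs_nonneg a).trans ha
  unfold stepDiff
  rcases lt_or_ge s (-c) with h | h
  · rw [if_neg (by linarith), if_neg (by linarith), sub_zero]
  · have h2 : c < s := not_le.1 fun h' => hs ⟨h, h'⟩
    rw [if_pos (by linarith), if_pos (by linarith), sub_self]

lemma stepDiff_sub (a b s : ℝ) :
    ‖stepDiff a s - stepDiff b s‖ₑ ≤ (Icc (min a b) (max a b)).indicator (fun _ => 1) s := by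
  by_cases hs : s ∈ Icc (min a b) (max a b)
  · rw [indicator_of_mem hs]
    unfold stepDiff
    split_ifs <;> simp
  · have : stepDiff a s = stepDiff b s := by
      unfold stepDiff
      rcases lt_or_ge s (min a b) with h | h
      · rw [lt_min_iff] at h
        rw [if_neg (not_le.2 h.1), if_neg (not_le.2 h.2)]
      · have h2 : max a b < s := not_le.1 fun h' => hs ⟨h, h'⟩
        rw [max_lt_iff] at h2
        rw [if_pos h2.1.le, if_pos h2.2.le]
    simp [this]

lemma lintegral_stepDiff_sub_le (a b : ℝ) :
    ∫⁻ s, ‖stepDiff a s - stepDiff b s‖ₑ ≤ ENNReal.ofReal |a - b| := by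
  calc ∫⁻ s, ‖stepDiff a s - stepDiff b s‖ₑ
      ≤ ∫⁻ s, (Icc (min a b) (max a b)).indicator (fun _ => 1) s := lintegral_mono (stepDiff_sub a b)
    _ = ENNReal.ofReal |a - b| := by
        rw [lintegral_indicator_const measurableSet_Icc, Real.volume_Icc, one_mul,
          max_sub_min_eq_abs, abs_sub_comm]

lemma integral_stepDiff (a : ℝ) : ∫ s, stepDiff a s = -a := by
  rcases le_total 0 a with h | h
  · have : stepDiff a = (Ico 0 a).indicator fun _ => -1 := by
      ext s
      unfold stepDiff indicator
      simp only [mem_Ico]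
      split_ifs <;> grind
    rw [this, integral_indicator measurableSet_Ico]
    simp [h]
  · have : stepDiff a = (Ico a 0).indicator fun _ => 1 := by
      ext s
      unfold stepDiff indicator
      simp only [mem_Ico]
      split_ifs <;> grind
    rw [this, integral_indicator measurableSet_Ico]
    simp [h]

lemma integrable_mul_stepDiff {q h g : ℝ → ℝ} {C c t : ℝ} (hq : AEMeasurable q unif)
    (hh : AEMeasurable h unif) (hg : Measurable g) (hgC : ∀ y, |g y| ≤ C)
    (hc : ∀ u ∈ Icc (0 : ℝ) 1, |h u| ≤ c) :
    Integrable (fun z : ℝ × ℝ => g (q z.1 + t * z.2) * stepDiff (h z.1) z.2)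
      (unif.prod volume) := by
  have hm : AEMeasurable (fun z : ℝ × ℝ => g (q z.1 + t * z.2) * stepDiff (h z.1) z.2)
      (unif.prod volume) :=
    (hg.comp_aemeasurable (hq.comp_fst.add (measurable_snd.const_mul t).aemeasurable)).mul
      (measurable_stepDiff.comp_aemeasurable (hh.comp_fst.prodMk measurable_snd.aemeasurable))
  have hbound : Integrable ((Icc (-c) c).indicator fun _ => C) (volume : Measure ℝ) :=
    (integrable_indicator_iff measurableSet_Icc).2 (integrableOn_const (by simp))
  refine (hbound.comp_snd unif).mono' hm.aestronglyMeasurable ?_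
  filter_upwards [Measure.quasiMeasurePreserving_fst.ae
    (ae_restrict_mem (μ := volume) (measurableSet_Icc (a := (0 : ℝ)) (b := 1)))] with z hz
  have hC : 0 ≤ C := (abs_nonneg _).trans (hgC 0)
  by_cases hs : z.2 ∈ Icc (-c) c
  · rw [indicator_of_mem hs, norm_mul, Real.norm_eq_abs, Real.norm_eq_abs]
    calc |g (q z.1 + t * z.2)| * |stepDiff (h z.1) z.2| ≤ C * 1 := by
          gcongr
          · exact hgC _
          · exact abs_stepDiff_le_one _ _
      _ = C := mul_one C
  · rw [indicator_of_notMem hs, stepDiff_of_notMem (hc _ hz) hs, mul_zero, norm_zero]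

lemma integral_mul_stepDiff_zero {q h g : ℝ → ℝ} {C c : ℝ} (hq : AEMeasurable q unif)
    (hh : AEMeasurable h unif) (hg : Measurable g) (hgC : ∀ y, |g y| ≤ C)
    (hc : ∀ u ∈ Icc (0 : ℝ) 1, |h u| ≤ c) :
    ∫ z, g (q z.1 + 0 * z.2) * stepDiff (h z.1) z.2 ∂(unif.prod volume) =
      -∫ u, g (q u) * h u ∂unif := by
  rw [integral_prod _ (integrable_mul_stepDiff hq hh hg hgC hc), ← integral_neg]
  refine integral_congr_ae (ae_of_all _ fun u => ?_)
  simp only [zero_mul, add_zero]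
  rw [integral_const_mul, integral_stepDiff, mul_neg]

/-- Weighted difference quotients of distribution functions, in the direction of the path: the
substitution `y = q u + t * s` removes the singular factor `1 / t`. -/
lemma integral_mul_pathCdf_sub {q h r g : ℝ → ℝ} {C c t : ℝ} {K : Set ℝ} (ht : 0 < t)
    (hq : AEMeasurable q unif) (hh : AEMeasurable h unif)
    (hr : ∀ u ∈ Icc (0 : ℝ) 1, r u = q u + t * h u)
    (hg : Measurable g) (hgC : ∀ y, |g y| ≤ C) (hKm : MeasurableSet K) (hK : volume K ≠ ∞)
    (hgK : ∀ y ∉ K, g y = 0) (hc : ∀ u ∈ Icc (0 : ℝ) 1, |h u| ≤ c) :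
    t⁻¹ * ∫ y, g y * (pathCdf r y - pathCdf q y) =
      ∫ z, g (q z.1 + t * z.2) * stepDiff (h z.1) z.2 ∂(unif.prod volume) := by
  have hC : 0 ≤ C := (abs_nonneg _).trans (hgC 0)
  have hr' : AEMeasurable (fun u => q u + t * h u) unif := hq.add (hh.const_mul t)
  rw [pathCdf_congr hr, integral_prod _ (integrable_mul_stepDiff hq hh hg hgC hc)]
  have hinner : ∀ u, ∫ s, g (q u + t * s) * stepDiff (h u) s =
      t⁻¹ * ∫ y, g y * ((if q u + t * h u ≤ y then 1 else 0) - if q u ≤ y then 1 else 0) := by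
    intro u
    have h1 : ∀ s, g (q u + t * s) * stepDiff (h u) s = (fun y => g y *
        ((if q u + t * h u ≤ y then 1 else 0) - if q u ≤ y then 1 else 0)) (q u + t * s) := by
      intro s
      simp only [stepDiff, add_le_add_iff_left, le_add_iff_nonneg_right, mul_le_mul_iff_right₀ ht,
        mul_nonneg_iff_of_pos_left ht]
    simp only [h1]
    rw [Measure.integral_comp_mul_left (fun y => (fun y => g y *
        ((if q u + t * h u ≤ y then 1 else 0) - if q u ≤ y then 1 else 0)) (q u + y)) t,
      integral_add_left_eq_self (fun y => g y *
        ((if q u + t * h u ≤ y then 1 else 0) - if q u ≤ y then 1 else 0)), abs_of_pos (by positivity),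
        smul_eq_mul]
  simp only [hinner]
  rw [integral_const_mul]
  congr 1
  have hstep : ∀ p : ℝ → ℝ, AEMeasurable p unif → ∀ y,
      Integrable (fun u => if p u ≤ y then (1 : ℝ) else 0) unif := by
    intro p hp y
    have hs : NullMeasurableSet (p ⁻¹' Iic y) unif := hp.nullMeasurableSet_preimage measurableSet_Iic
    exact ((integrable_const (1 : ℝ)).indicator₀ hs).congr
      (ae_of_all _ fun u => by by_cases h : p u ≤ y <;> simp [indicator, h])
  rw [integral_integral_swap]
  · refine integral_congr_ae (ae_of_all _ fun y => ?_)
    simp only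
    rw [integral_const_mul, integral_sub (hstep _ hr' y) (hstep _ hq y), pathCdf_eq_integral,
      pathCdf_eq_integral]
  · have hle : Measurable fun z : ℝ × ℝ => if z.1 ≤ z.2 then (1 : ℝ) else 0 :=
      Measurable.ite (measurableSet_le measurable_fst measurable_snd) measurable_const
        measurable_const
    have hbound : Integrable (K.indicator fun _ => C) (volume : Measure ℝ) :=
      (integrable_indicator_iff hKm).2 (integrableOn_const hK)
    refine (hbound.comp_snd unif).mono' ?_ (ae_of_all _ fun z => ?_)
    · refine AEMeasurable.aestronglyMeasurable ?_
      exact (hg.comp measurable_snd).aemeasurable.mul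
        ((hle.comp_aemeasurable (hr'.comp_fst.prodMk measurable_snd.aemeasurable)).sub
          (hle.comp_aemeasurable (hq.comp_fst.prodMk measurable_snd.aemeasurable)))
    · simp only [Function.uncurry, norm_mul, Real.norm_eq_abs]
      by_cases hz : z.2 ∈ K
      · rw [indicator_of_mem hz]
        calc |g z.2| * |(if q z.1 + t * h z.1 ≤ z.2 then (1 : ℝ) else 0) -
              if q z.1 ≤ z.2 then 1 else 0| ≤ C * 1 := by
              gcongr
              · exact hgC _
              · split_ifs <;> simp
          _ = C := mul_one C
      · rw [indicator_of_notMem hz, hgK _ hz, abs_zero, zero_mul]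

/-- The limit of the weighted difference quotients of distribution functions. With `t = 0` it also
gives the continuity of the limit in the path, the direction and the weight. -/
lemma PathConvergence.tendsto_integral_stepDiff {ι : Type*} {l : Filter ι}
    [l.IsCountablyGenerated] {N : ℕ} {p : ι → ℝ → ℝ} {q : ℝ → ℝ} {K : Set ℝ} {C : ℝ}
    {γ : ι → ℝ → ℝ} {g : ℝ → ℝ} (hp : PathConvergence l N p q) (hγ : WeightConvergence l K C γ g)
    {t : ι → ℝ} (ht : Tendsto t l (𝓝 0)) {k : ι → ℝ → ℝ} {h : ℝ → ℝ}
    (hk : ∀ᶠ i in l, AEMeasurable (k i) unif) (hh : ContinuousOn h (Icc 0 1))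
    (hkh : TendstoUniformlyOn k h l (Icc 0 1)) :
    Tendsto (fun i => ∫ z, γ i (p i z.1 + t i * z.2) * stepDiff (k i z.1) z.2
      ∂(unif.prod volume)) l
      (𝓝 (-∫ u, g (q u) * h u ∂unif)) := by
  have hq := hp.limit
  have hhm : AEMeasurable h unif := hh.aemeasurable measurableSet_Icc
  obtain ⟨c', hc'⟩ := isCompact_Icc.exists_bound_of_continuousOn hh
  set c := c' + 1 with hc_def
  have hc : ∀ u ∈ Icc (0 : ℝ) 1, |h u| ≤ c := fun u hu => (hc' u hu).trans (by linarith)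
  have hkc : ∀ᶠ i in l, ∀ u ∈ Icc (0 : ℝ) 1, |k i u| ≤ c := eventually_abs_le hkh hc'
  have hlimit := integral_mul_stepDiff_zero hq.aemeasurable hhm hγ.measurable_limit
    hγ.abs_limit_le hc
  rw [← hlimit]
  have hHint := integrable_mul_stepDiff (t := 0) hq.aemeasurable hhm hγ.measurable_limit
    hγ.abs_limit_le hc
  refine tendsto_integral_of_L1 _ hHint.aestronglyMeasurable ?_ ?_
  · filter_upwards [hp.regular, hk, hγ.measurable, hγ.abs_le, hkc] with i h1 h2 h3 h4 h5
    exact integrable_mul_stepDiff h1.aemeasurable h2 h3 h4 h5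
  -- the two contributions to the distance in `L^1`
  set e : ι → ℝ → ℝ≥0∞ := fun i s => (Icc (-c) c).indicator (fun s =>
    ∫⁻ u, ‖γ i (p i u + t i * s) - g (q u)‖ₑ ∂unif) s with he
  set r : ι → ℝ≥0∞ := fun i => ∫⁻ u, ENNReal.ofReal |k i u - h u| ∂unif with hr
  have he0 : Tendsto (fun i => ∫⁻ s, e i s) l (𝓝 0) := by
    have hlim := tendsto_lintegral_filter_of_dominated_convergence' (μ := volume) (l := l)
      (F := e) (f := fun _ => 0)
      ((Icc (-c) c).indicator fun _ => ENNReal.ofReal (2 * C)) ?_ ?_ ?_ ?_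
    · simpa using hlim
    · filter_upwards [hp.regular, hγ.measurable] with i h1 h2
      refine AEMeasurable.indicator ?_ measurableSet_Icc
      refine AEMeasurable.lintegral_prod_left'
        (f := fun z : ℝ × ℝ => ‖γ i (p i z.1 + t i * z.2) - g (q z.1)‖ₑ) ?_
      exact ((h2.comp_aemeasurable (h1.aemeasurable.comp_fst.add
        (measurable_snd.const_mul (t i)).aemeasurable)).sub
        (hγ.measurable_limit.comp_aemeasurable hq.aemeasurable.comp_fst)).enorm
    · filter_upwards [hγ.abs_le] with i h1
      refine ae_of_all _ fun s => ?_
      simp only [he]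
      refine indicator_le_indicator ?_
      calc ∫⁻ u, ‖γ i (p i u + t i * s) - g (q u)‖ₑ ∂unif
          ≤ ∫⁻ _, ENNReal.ofReal (2 * C) ∂unif :=
            lintegral_mono fun u => enorm_sub_le_of_abs_le (h1 _) (hγ.abs_limit_le _)
        _ = ENNReal.ofReal (2 * C) := by simp
    · rw [lintegral_indicator_const measurableSet_Icc]
      exact ENNReal.mul_ne_top ENNReal.ofReal_ne_top (by simp)
    · refine ae_of_all _ fun s => ?_
      by_cases hs : s ∈ Icc (-c) c
      · simp only [he, indicator_of_mem hs]
        refine (hp.add_const (c := fun i => t i * s) ?_).tendsto_lintegral_comp hγ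
        simpa using ht.mul_const s
      · simp only [he, indicator_of_notMem hs]
        exact tendsto_const_nhds
  have hr0 : Tendsto r l (𝓝 0) := by
    rw [ENNReal.tendsto_nhds_zero]
    intro ε hε
    filter_upwards [EMetric.tendstoUniformlyOn_iff.1 hkh ε hε] with i hi
    calc r i ≤ ∫⁻ _, ε ∂unif := by
          refine setLIntegral_mono' measurableSet_Icc fun u hu => ?_
          have := (hi u hu).le
          rwa [edist_comm, edist_dist, Real.dist_eq] at this
      _ = ε := by simp
  have hsum : Tendsto (fun i => (∫⁻ s, e i s) + ENNReal.ofReal C * r i) l (𝓝 0) := by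
    have := he0.add (ENNReal.Tendsto.const_mul (a := ENNReal.ofReal C) hr0
      (Or.inr ENNReal.ofReal_ne_top))
    simpa using this
  refine tendsto_of_tendsto_of_tendsto_of_le_of_le' tendsto_const_nhds hsum
    (Eventually.of_forall fun _ => zero_le) ?_
  filter_upwards [hp.regular, hk, hγ.measurable, hγ.abs_le, hkc] with i h1 h2 h3 h4 h5
  have hm1 : AEMeasurable (fun z : ℝ × ℝ => (Icc (-c) c).indicator (fun _ => (1 : ℝ≥0∞)) z.2 *
      ‖γ i (p i z.1 + t i * z.2) - g (q z.1)‖ₑ) (unif.prod volume) := by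
    refine ((measurable_const.indicator measurableSet_Icc).comp measurable_snd).aemeasurable.mul ?_
    exact ((h3.comp_aemeasurable (h1.aemeasurable.comp_fst.add
        (measurable_snd.const_mul (t i)).aemeasurable)).sub
        (hγ.measurable_limit.comp_aemeasurable hq.aemeasurable.comp_fst)).enorm
  have hm2 : AEMeasurable (fun z : ℝ × ℝ => ‖stepDiff (k i z.1) z.2 - stepDiff (h z.1) z.2‖ₑ)
      (unif.prod volume) :=
    ((measurable_stepDiff.comp_aemeasurable (h2.comp_fst.prodMk measurable_snd.aemeasurable)).sub
      (measurable_stepDiff.comp_aemeasurable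
        (hhm.comp_fst.prodMk measurable_snd.aemeasurable))).enorm
  calc ∫⁻ z, ‖γ i (p i z.1 + t i * z.2) * stepDiff (k i z.1) z.2 -
          g (q z.1 + 0 * z.2) * stepDiff (h z.1) z.2‖ₑ ∂(unif.prod volume)
      ≤ ∫⁻ z, ((Icc (-c) c).indicator (fun _ => (1 : ℝ≥0∞)) z.2 *
          ‖γ i (p i z.1 + t i * z.2) - g (q z.1)‖ₑ +
          ENNReal.ofReal C * ‖stepDiff (k i z.1) z.2 - stepDiff (h z.1) z.2‖ₑ)
          ∂(unif.prod volume) := by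
        refine lintegral_mono_ae ?_
        filter_upwards [Measure.quasiMeasurePreserving_fst.ae
          (ae_restrict_mem (μ := volume) (measurableSet_Icc (a := (0 : ℝ)) (b := 1)))] with z hz
        have hsplit : γ i (p i z.1 + t i * z.2) * stepDiff (k i z.1) z.2 -
            g (q z.1 + 0 * z.2) * stepDiff (h z.1) z.2 =
            stepDiff (k i z.1) z.2 * (γ i (p i z.1 + t i * z.2) - g (q z.1)) +
            g (q z.1) * (stepDiff (k i z.1) z.2 - stepDiff (h z.1) z.2) := by
          rw [zero_mul, add_zero]
          ring
        rw [hsplit]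
        refine (enorm_add_le _ _).trans ?_
        rw [enorm_mul, enorm_mul]
        gcongr
        · by_cases hs : z.2 ∈ Icc (-c) c
          · rw [indicator_of_mem hs, Real.enorm_eq_ofReal_abs]
            exact ENNReal.ofReal_le_one.2 (abs_stepDiff_le_one _ _)
          · rw [stepDiff_of_notMem (h5 _ hz) hs]
            simp
        · rw [Real.enorm_eq_ofReal_abs]
          exact ENNReal.ofReal_le_ofReal (hγ.abs_limit_le _)
    _ = (∫⁻ s, e i s) + ENNReal.ofReal C * ∫⁻ u, (∫⁻ s, ‖stepDiff (k i u) s - stepDiff (h u) s‖ₑ)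
          ∂unif := by
        rw [lintegral_add_left' hm1, lintegral_const_mul' _ _ ENNReal.ofReal_ne_top,
          lintegral_prod _ hm2, lintegral_prod_symm _ hm1]
        congr 1
        refine lintegral_congr fun s => ?_
        by_cases hs : s ∈ Icc (-c) c
        · simp [he, indicator_of_mem hs]
        · simp [he, indicator_of_notMem hs]
    _ ≤ (∫⁻ s, e i s) + ENNReal.ofReal C * r i := by
        gcongr
        exact lintegral_mono fun u => lintegral_stepDiff_sub_le _ _

/-- The weak derivative of the distribution functions: a bounded weight is integrated against
difference quotients with vanishing positive steps `t i`. -/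
lemma PathConvergence.tendsto_integral_pathCdf {ι : Type*} {l : Filter ι}
    [l.IsCountablyGenerated] {N : ℕ} {p : ι → ℝ → ℝ} {q : ℝ → ℝ} {K : Set ℝ} {C : ℝ}
    {γ : ι → ℝ → ℝ} {g : ℝ → ℝ} (hp : PathConvergence l N p q) (hγ : WeightConvergence l K C γ g)
    {t : ι → ℝ} (ht : Tendsto t l (𝓝 0)) (ht0 : ∀ᶠ i in l, 0 < t i) {k : ι → ℝ → ℝ} {h : ℝ → ℝ}
    (hk : ∀ᶠ i in l, AEMeasurable (k i) unif) (hh : ContinuousOn h (Icc 0 1))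
    (hkh : TendstoUniformlyOn k h l (Icc 0 1)) {r : ι → ℝ → ℝ}
    (hr : ∀ᶠ i in l, ∀ u ∈ Icc (0 : ℝ) 1, r i u = p i u + t i * k i u) :
    Tendsto (fun i => (t i)⁻¹ * ∫ y, γ i y * (pathCdf (r i) y - pathCdf (p i) y)) l
      (𝓝 (-∫ u, g (q u) * h u ∂unif)) := by
  obtain ⟨c, hc⟩ := isCompact_Icc.exists_bound_of_continuousOn hh
  refine (hp.tendsto_integral_stepDiff hγ ht hk hh hkh).congr' ?_
  filter_upwards [hp.regular, hγ.measurable, hγ.abs_le, hγ.of_notMem, ht0, hk,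
    eventually_abs_le hkh hc, hr] with i h1 h2 h3 h4 h5 h6 h7 h8
  exact (integral_mul_pathCdf_sub h5 h1.aemeasurable h6 h8 h2 h3 hγ.measurableSet
    hγ.measure_ne_top h4 h7).symm

/-- Continuity of the derivative of the distribution functions, as a functional of the path, the
direction and the weight. -/
lemma PathConvergence.tendsto_integral_comp {ι : Type*} {l : Filter ι}
    [l.IsCountablyGenerated] {N : ℕ} {p : ι → ℝ → ℝ} {q : ℝ → ℝ} {K : Set ℝ} {C : ℝ}
    {γ : ι → ℝ → ℝ} {g : ℝ → ℝ} (hp : PathConvergence l N p q) (hγ : WeightConvergence l K C γ g)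
    {k : ι → ℝ → ℝ} {h : ℝ → ℝ}
    (hk : ∀ᶠ i in l, AEMeasurable (k i) unif) (hh : ContinuousOn h (Icc 0 1))
    (hkh : TendstoUniformlyOn k h l (Icc 0 1)) :
    Tendsto (fun i => -∫ u, γ i (p i u) * k i u ∂unif) l (𝓝 (-∫ u, g (q u) * h u ∂unif)) := by
  obtain ⟨c, hc⟩ := isCompact_Icc.exists_bound_of_continuousOn hh
  refine (hp.tendsto_integral_stepDiff hγ (t := fun _ => 0) tendsto_const_nhds hk hh hkh).congr' ?_
  filter_upwards [hp.regular, hγ.measurable, hγ.abs_le, hk, eventually_abs_le hkh hc]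
    with i h1 h2 h3 h4 h5
  exact integral_mul_stepDiff_zero h1.aemeasurable h4 h2 h3 h5

/-! ### Difference quotients of quantile functions -/

/-- The derivative of the quantile functions, tested against a continuous function `κ`. Since
`∫ κ (r^* - p^*) = -∫ w (F_r - F_p)`, where `w y` is the average of `κ` between `F_p y` and
`F_r y`, this is the case of distribution functions with a variable weight. -/
lemma PathConvergence.tendsto_integral_pathQuantile_of_continuous {ι : Type*} {l : Filter ι}
    [l.IsCountablyGenerated] {N : ℕ} {p : ι → ℝ → ℝ} {q : ℝ → ℝ} (hp : PathConvergence l N p q)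
    {t : ι → ℝ} (ht : Tendsto t l (𝓝 0)) (ht0 : ∀ᶠ i in l, 0 < t i) {k : ι → ℝ → ℝ} {h : ℝ → ℝ}
    (hk : ∀ᶠ i in l, AEMeasurable (k i) unif) (hh : ContinuousOn h (Icc 0 1))
    (hkh : TendstoUniformlyOn k h l (Icc 0 1)) {r : ι → ℝ → ℝ}
    (hr : ∀ᶠ i in l, ∀ u ∈ Icc (0 : ℝ) 1, r i u = p i u + t i * k i u)
    {κ : ℝ → ℝ} (hκ : Continuous κ) {C : ℝ} (hκC : ∀ v, |κ v| ≤ C) :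
    Tendsto (fun i => (t i)⁻¹ * ∫ u, κ u * (pathQuantile (r i) u - pathQuantile (p i) u) ∂unif) l
      (𝓝 (∫ u, κ (pathCdf q (q u)) * h u ∂unif)) := by
  have hq := hp.limit
  obtain ⟨c, hc⟩ := isCompact_Icc.exists_bound_of_continuousOn hh
  obtain ⟨R₀, hR₀⟩ := hq.exists_bound
  set R := R₀ + 1 + (c + 1) with hR
  have hc0 : 0 ≤ c := (norm_nonneg _).trans (hc 0 (by simp))
  have hpR : ∀ᶠ i in l, ∀ u ∈ Icc (0 : ℝ) 1, |p i u| ≤ R := by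
    filter_upwards [eventually_abs_le hp.tendsto_path hR₀] with i hi u hu
    linarith [hi u hu]
  have hrR : ∀ᶠ i in l, ∀ u ∈ Icc (0 : ℝ) 1, |r i u| ≤ R := by
    filter_upwards [eventually_abs_le hp.tendsto_path hR₀, eventually_abs_le hkh hc, hr, ht0,
      ht.eventually (gt_mem_nhds one_pos)] with i h1 h2 h3 h4 h5 u hu
    rw [h3 u hu]
    calc |p i u + t i * k i u| ≤ |p i u| + |t i * k i u| := abs_add_le _ _
      _ = |p i u| + t i * |k i u| := by rw [abs_mul, abs_of_pos h4]
      _ ≤ (R₀ + 1) + 1 * (c + 1) := by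
          gcongr
          · exact h1 u hu
          · exact h2 u hu
      _ = R := by rw [hR]; ring
  have hrm : ∀ᶠ i in l, AEMeasurable (r i) unif := by
    filter_upwards [hp.regular, hk, hr] with i h1 h2 h3
    refine (h1.aemeasurable.add (h2.const_mul (t i))).congr ?_
    filter_upwards [ae_restrict_mem measurableSet_Icc] with u hu
    exact (h3 u hu).symm
  have hrq : ∀ u ∈ Icc (0 : ℝ) 1, Tendsto (fun i => r i u) l (𝓝 (q u)) := by
    intro u hu
    have h1 : Tendsto (fun i => p i u + t i * k i u) l (𝓝 (q u + 0 * h u)) :=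
      (hp.tendsto_path.tendsto_at hu).add (ht.mul (hkh.tendsto_at hu))
    rw [zero_mul, add_zero] at h1
    refine h1.congr' ?_
    filter_upwards [hr] with i hi
    exact (hi u hu).symm
  have hC0 : 0 ≤ C := (abs_nonneg _).trans (hκC 0)
  have hγ : WeightConvergence l (Icc (-R) R) C
      (fun i => (Icc (-R) R).indicator fun y => segmentAverage κ (pathCdf (p i) y) (pathCdf (r i) y))
      ((Icc (-R) R).indicator fun y => κ (pathCdf q y)) := by
    refine ⟨measurableSet_Icc, by simp, ?_, ?_, ?_, ?_, ?_, ?_, ?_⟩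
    · exact (hκ.comp hq.continuous_pathCdf).measurable.indicator measurableSet_Icc
    · filter_upwards [hp.regular, hrm] with i h1 h2
      exact ((continuous_segmentAverage hκ).measurable.comp
        ((measurable_pathCdf h1.aemeasurable).prodMk (measurable_pathCdf h2))).indicator
        measurableSet_Icc
    · intro y
      by_cases hy : y ∈ Icc (-R) R
      · rw [indicator_of_mem hy]
        exact hκC _
      · rw [indicator_of_notMem hy, abs_zero]
        exact hC0
    · refine Eventually.of_forall fun i y => ?_
      by_cases hy : y ∈ Icc (-R) R
      · rw [indicator_of_mem hy]
        exact abs_segmentAverage_le hκC _ _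
      · rw [indicator_of_notMem hy, abs_zero]
        exact hC0
    · exact fun y hy => indicator_of_notMem hy _
    · exact Eventually.of_forall fun i y hy => indicator_of_notMem hy _
    · refine ae_of_all _ fun y => ?_
      by_cases hy : y ∈ Icc (-R) R
      · simp only [indicator_of_mem hy]
        have h1 : Tendsto (fun i => pathCdf (p i) y) l (𝓝 (pathCdf q y)) :=
          hq.tendsto_pathCdf (hp.regular.mono fun i hi => hi.aemeasurable)
            (fun u hu => hp.tendsto_path.tendsto_at hu) tendsto_const_nhds
        have h2 : Tendsto (fun i => pathCdf (r i) y) l (𝓝 (pathCdf q y)) :=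
          hq.tendsto_pathCdf hrm hrq tendsto_const_nhds
        rw [← segmentAverage_self κ (pathCdf q y)]
        exact ((continuous_segmentAverage hκ).tendsto (pathCdf q y, pathCdf q y)).comp
          (h1.prodMk_nhds h2)
      · simp only [indicator_of_notMem hy]
        exact tendsto_const_nhds
  have hlim := (hp.tendsto_integral_pathCdf hγ ht ht0 hk hh hkh hr).neg
  rw [neg_neg] at hlim
  have hlimit : ∫ u, (Icc (-R) R).indicator (fun y => κ (pathCdf q y)) (q u) * h u ∂unif =
      ∫ u, κ (pathCdf q (q u)) * h u ∂unif := by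
    refine setIntegral_congr_fun measurableSet_Icc fun u hu => ?_
    have h1 := hR₀ u hu
    have : q u ∈ Icc (-R) R := abs_le.1 (by linarith)
    simp only [indicator_of_mem this]
  rw [hlimit] at hlim
  refine hlim.congr' ?_
  filter_upwards [hp.regular, hrm, hpR, hrR] with i h1 h2 h3 h4
  rw [integral_mul_pathQuantile_sub hκ hκC h1.aemeasurable h2 h3 h4, ← mul_neg,
    ← integral_indicator measurableSet_Icc]
  congr 2
  refine integral_congr_ae (ae_of_all _ fun y => ?_)
  by_cases hy : y ∈ Icc (-R) R <;> simp [hy]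

lemma PathConvergence.tendsto_integral_comp_pathCdf {ι : Type*} {l : Filter ι}
    [l.IsCountablyGenerated] {N : ℕ} {p : ι → ℝ → ℝ} {q : ℝ → ℝ} (hp : PathConvergence l N p q)
    {k : ι → ℝ → ℝ} {h : ℝ → ℝ} (hk : ∀ᶠ i in l, AEMeasurable (k i) unif)
    (hh : ContinuousOn h (Icc 0 1)) (hkh : TendstoUniformlyOn k h l (Icc 0 1))
    {κ : ℝ → ℝ} (hκ : Continuous κ) {C : ℝ} (hκC : ∀ v, |κ v| ≤ C) :
    Tendsto (fun i => ∫ u, κ (pathCdf (p i) (p i u)) * k i u ∂unif) l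
      (𝓝 (∫ u, κ (pathCdf q (q u)) * h u ∂unif)) := by
  obtain ⟨c, hc⟩ := isCompact_Icc.exists_bound_of_continuousOn hh
  have hC0 : 0 ≤ C := (abs_nonneg _).trans (hκC 0)
  refine tendsto_integral_filter_of_dominated_convergence (fun _ => C * (c + 1)) ?_ ?_
    (integrable_const _) ?_
  · filter_upwards [hp.regular, hk] with i h1 h2
    exact (((hκ.measurable.comp (measurable_pathCdf h1.aemeasurable)).comp_aemeasurable
      h1.aemeasurable).mul h2).aestronglyMeasurable
  · filter_upwards [eventually_abs_le hkh hc] with i hi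
    filter_upwards [ae_restrict_mem measurableSet_Icc] with u hu
    rw [norm_mul]
    gcongr
    · exact hκC _
    · exact hi u hu
  · filter_upwards [ae_restrict_mem measurableSet_Icc] with u hu
    refine ((hκ.tendsto _).comp ?_).mul (hkh.tendsto_at hu)
    exact hp.limit.tendsto_pathCdf (hp.regular.mono fun i hi => hi.aemeasurable)
      (fun v hv => hp.tendsto_path.tendsto_at hv) (hp.tendsto_path.tendsto_at hu)

/-- Uniformly bounded functions that converge when tested against continuous functions also
converge when tested against a dominated, almost everywhere convergent family, since continuous
functions are dense in `L^1`. -/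
lemma tendsto_integral_mul_of_dense {ι : Type*} {l : Filter ι} [l.IsCountablyGenerated]
    {μ : Measure ℝ} [IsFiniteMeasure μ]
    {ρ : ι → ℝ → ℝ} {ρ₀ : ℝ → ℝ} {c : ℝ} (hρm : ∀ᶠ i in l, AEStronglyMeasurable (ρ i) μ)
    (hρ : ∀ᶠ i in l, ∀ᵐ u ∂μ, |ρ i u| ≤ c)
    (hρ₀m : AEStronglyMeasurable ρ₀ μ) (hρ₀ : ∀ᵐ u ∂μ, |ρ₀ u| ≤ c)
    (hlim : ∀ κ : ℝ → ℝ, Continuous κ → ∀ C, (∀ v, |κ v| ≤ C) →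
      Tendsto (fun i => ∫ u, κ u * ρ i u ∂μ) l (𝓝 (∫ u, κ u * ρ₀ u ∂μ)))
    {γ : ι → ℝ → ℝ} {g b : ℝ → ℝ} (hγm : ∀ᶠ i in l, AEStronglyMeasurable (γ i) μ)
    (hgm : AEStronglyMeasurable g μ)
    (hb : Integrable b μ) (hγb : ∀ᶠ i in l, ∀ᵐ u ∂μ, |γ i u| ≤ b u)
    (hgb : ∀ᵐ u ∂μ, |g u| ≤ b u)
    (hγ : ∀ᵐ u ∂μ, Tendsto (fun i => γ i u) l (𝓝 (g u))) :
    Tendsto (fun i => ∫ u, γ i u * ρ i u ∂μ) l (𝓝 (∫ u, g u * ρ₀ u ∂μ)) := by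
  rcases eq_zero_or_neZero μ with rfl | hμ
  · simpa using tendsto_const_nhds
  have hc0 : 0 ≤ c := by
    obtain ⟨u, hu⟩ := hρ₀.exists
    exact (abs_nonneg _).trans hu
  have hgi : Integrable g μ := hb.mono' hgm hgb
  have hprod : ∀ {f r : ℝ → ℝ}, Integrable f μ → AEStronglyMeasurable r μ →
      (∀ᵐ u ∂μ, |r u| ≤ c) → Integrable (fun u => f u * r u) μ := fun hf hr hrc =>
    hf.mul_bdd (c := c) hr hrc
  have hle : ∀ {f r : ℝ → ℝ}, Integrable f μ → (∀ᵐ u ∂μ, |r u| ≤ c) →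
      |∫ u, f u * r u ∂μ| ≤ c * ∫ u, |f u| ∂μ := by
    intro f r hf hrc
    rw [← integral_const_mul, ← Real.norm_eq_abs]
    refine norm_integral_le_of_norm_le (hf.abs.const_mul c) ?_
    filter_upwards [hrc] with u hu
    rw [norm_mul, mul_comm]
    exact mul_le_mul_of_nonneg_right hu (abs_nonneg _)
  have hL1 : Tendsto (fun i => ∫ u, |γ i u - g u| ∂μ) l (𝓝 0) := by
    have := tendsto_integral_filter_of_dominated_convergence (μ := μ) (l := l)
      (F := fun i u => |γ i u - g u|) (f := fun _ => 0) (fun u => b u + b u) ?_ ?_ (hb.add hb) ?_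
    · simpa using this
    · filter_upwards [hγm] with i hi
      exact (hi.sub hgm).norm
    · filter_upwards [hγb] with i hi
      filter_upwards [hi, hgb] with u h1 h2
      rw [Real.norm_eq_abs, abs_abs]
      exact (abs_sub _ _).trans (add_le_add h1 h2)
    · filter_upwards [hγ] with u hu
      simpa using (hu.sub_const (g u)).abs
  rw [Metric.tendsto_nhds]
  intro ε hε
  set η : ℝ := ε / (4 * (c + 1)) with hη
  have hη0 : 0 < η := by positivity
  have hcη : c * η ≤ ε / 4 := by
    rw [hη, mul_div_assoc', div_le_div_iff₀ (by positivity) (by norm_num)]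
    nlinarith
  obtain ⟨κ, hκs, hκη, hκc, hκi⟩ := hgi.exists_hasCompactSupport_integral_sub_le hη0
  obtain ⟨C, hC⟩ := hκs.exists_bound_of_continuous hκc
  have hκη' : ∫ u, |g u - κ u| ∂μ ≤ η := hκη
  filter_upwards [hρm, hρ, hγm, hγb, Metric.tendsto_nhds.1 (hlim κ hκc C hC) (ε / 4) (by positivity),
    hL1.eventually (gt_mem_nhds hη0)] with i h1 h2 h3 h4 h5 h6
  have hγi : Integrable (γ i) μ := hb.mono' h3 h4
  have e1 : |∫ u, (γ i u - g u) * ρ i u ∂μ| ≤ ε / 4 :=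
    (hle (hγi.sub hgi) h2).trans ((mul_le_mul_of_nonneg_left h6.le hc0).trans hcη)
  have e2 : |∫ u, (g u - κ u) * ρ i u ∂μ| ≤ ε / 4 :=
    (hle (hgi.sub hκi) h2).trans ((mul_le_mul_of_nonneg_left hκη' hc0).trans hcη)
  have e3 : |∫ u, (g u - κ u) * ρ₀ u ∂μ| ≤ ε / 4 :=
    (hle (hgi.sub hκi) hρ₀).trans ((mul_le_mul_of_nonneg_left hκη' hc0).trans hcη)
  have s1 : ∫ u, (γ i u - g u) * ρ i u ∂μ = ∫ u, γ i u * ρ i u ∂μ - ∫ u, g u * ρ i u ∂μ := by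
    simp only [sub_mul]
    exact integral_sub (hprod hγi h1 h2) (hprod hgi h1 h2)
  have s2 : ∫ u, (g u - κ u) * ρ i u ∂μ = ∫ u, g u * ρ i u ∂μ - ∫ u, κ u * ρ i u ∂μ := by
    simp only [sub_mul]
    exact integral_sub (hprod hgi h1 h2) (hprod hκi h1 h2)
  have s3 : ∫ u, (g u - κ u) * ρ₀ u ∂μ = ∫ u, g u * ρ₀ u ∂μ - ∫ u, κ u * ρ₀ u ∂μ := by
    simp only [sub_mul]
    exact integral_sub (hprod hgi hρ₀m hρ₀) (hprod hκi hρ₀m hρ₀)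
  rw [s1] at e1
  rw [s2] at e2
  rw [s3] at e3
  rw [Real.dist_eq] at h5 ⊢
  rw [abs_le] at e1 e2 e3
  rw [abs_lt] at h5 ⊢
  constructor <;> linarith [e1.1, e1.2, e2.1, e2.2, e3.1, e3.2, h5.1, h5.2]

section

variable {ι : Type*} {l : Filter ι} [l.IsCountablyGenerated] {N : ℕ} {p : ι → ℝ → ℝ} {q : ℝ → ℝ}
  {k : ι → ℝ → ℝ} {h : ℝ → ℝ} {γ : ι → ℝ → ℝ} {g b : ℝ → ℝ} {f : ℝ → ℝ}

/-- The weak derivative of the quantile functions, integrated against dominated weights. -/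
lemma PathConvergence.tendsto_integral_pathQuantile (hp : PathConvergence l N p q)
    {t : ι → ℝ} (ht : Tendsto t l (𝓝 0)) (ht0 : ∀ᶠ i in l, 0 < t i)
    (hk : ∀ᶠ i in l, AEMeasurable (k i) unif) (hh : ContinuousOn h (Icc 0 1))
    (hkh : TendstoUniformlyOn k h l (Icc 0 1)) {r : ι → ℝ → ℝ}
    (hr : ∀ᶠ i in l, ∀ u ∈ Icc (0 : ℝ) 1, r i u = p i u + t i * k i u)
    (hf : ∀ᵐ y, y ∈ q '' Icc 0 1 → f y = fiberSum q 1 y)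
    (hγm : ∀ᶠ i in l, AEStronglyMeasurable (γ i) unif) (hgm : AEStronglyMeasurable g unif)
    (hb : Integrable b unif) (hγb : ∀ᶠ i in l, ∀ᵐ u ∂unif, |γ i u| ≤ b u)
    (hgb : ∀ᵐ u ∂unif, |g u| ≤ b u)
    (hγ : ∀ᵐ u ∂unif, Tendsto (fun i => γ i u) l (𝓝 (g u))) :
    Tendsto (fun i => (t i)⁻¹ * ∫ u, γ i u * (pathQuantile (r i) u - pathQuantile (p i) u) ∂unif) l
      (𝓝 (∫ v, g v * (1 / f (pathQuantile q v) * fiberSum q h (pathQuantile q v)) ∂unif)) := by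
  obtain ⟨c, hc⟩ := isCompact_Icc.exists_bound_of_continuousOn hh
  obtain ⟨hm, hbd, hint⟩ := hp.limit.quantile_derivative hf hh (c := c + 1)
    fun u hu => (hc u hu).trans (by linarith)
  have hpq : ∀ᶠ i in l, AEMeasurable (r i) unif ∧ ∃ R, (∀ u ∈ Icc (0 : ℝ) 1, |p i u| ≤ R) ∧
      ∀ u ∈ Icc (0 : ℝ) 1, |r i u| ≤ R := by
    filter_upwards [hp.regular, hk, hr, eventually_abs_le hkh hc] with i h1 h2 h3 h4
    refine ⟨(h1.aemeasurable.add (h2.const_mul (t i))).congr ?_, ?_⟩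
    · filter_upwards [ae_restrict_mem measurableSet_Icc] with u hu
      exact (h3 u hu).symm
    · obtain ⟨R, hR⟩ := h1.exists_bound
      have hc0 : 0 ≤ c := (norm_nonneg _).trans (hc 0 (by simp))
      refine ⟨R + |t i| * (c + 1), fun u hu => (hR u hu).trans ?_, fun u hu => ?_⟩
      · have : 0 ≤ |t i| * (c + 1) := by positivity
        linarith
      · rw [h3 u hu]
        refine (abs_add_le _ _).trans ?_
        rw [abs_mul]
        gcongr
        · exact hR u hu
        · exact h4 u hu
  have hmain := tendsto_integral_mul_of_dense (l := l) (μ := unif) (c := c + 1)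
    (ρ := fun i u => (t i)⁻¹ * (pathQuantile (r i) u - pathQuantile (p i) u))
    (γ := γ) (b := b) ?_ ?_ hm hbd ?_ hγm hgm hb hγb hgb hγ
  · refine hmain.congr fun i => ?_
    rw [← integral_const_mul]
    refine integral_congr_ae (ae_of_all _ fun u => ?_)
    simp only
    ring
  · filter_upwards [hpq, hp.regular] with i ⟨h1, R, h2, h3⟩ h4
    exact (((aemeasurable_pathQuantile h1 h3).sub
      (aemeasurable_pathQuantile h4.aemeasurable h2)).const_mul _).aestronglyMeasurable
  · filter_upwards [hpq, hp.regular, hr, eventually_abs_le hkh hc, ht0]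
      with i ⟨h1, R, h2, h3⟩ h4 h5 h6 h7
    filter_upwards [ae_unif_mem] with u hu
    rw [abs_mul, abs_inv, abs_of_pos h7, inv_mul_le_iff₀ h7]
    refine abs_pathQuantile_sub_le h1 h4.aemeasurable h3 h2 (fun v hv => ?_) hu
    rw [h5 v hv, add_sub_cancel_left, abs_mul, abs_of_pos h7]
    gcongr
    exact h6 v hv
  · intro κ hκ C hκC
    rw [hint κ hκ]
    refine (hp.tendsto_integral_pathQuantile_of_continuous ht ht0 hk hh hkh hr hκ hκC).congr
      fun i => ?_
    rw [← integral_const_mul]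
    refine integral_congr_ae (ae_of_all _ fun u => ?_)
    simp only
    ring

/-- Continuity of the derivative of the quantile functions, as a functional of the path, the
direction and the weight. -/
lemma PathConvergence.tendsto_integral_quantile_derivative (hp : PathConvergence l N p q)
    (hk : ∀ᶠ i in l, ContinuousOn (k i) (Icc 0 1)) (hh : ContinuousOn h (Icc 0 1))
    (hkh : TendstoUniformlyOn k h l (Icc 0 1))
    {φ : ι → ℝ → ℝ}
    (hφ : ∀ᶠ i in l, ∀ᵐ y, y ∈ p i '' Icc 0 1 → φ i y = fiberSum (p i) 1 y)
    (hf : ∀ᵐ y, y ∈ q '' Icc 0 1 → f y = fiberSum q 1 y)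
    (hγm : ∀ᶠ i in l, AEStronglyMeasurable (γ i) unif) (hgm : AEStronglyMeasurable g unif)
    (hb : Integrable b unif) (hγb : ∀ᶠ i in l, ∀ᵐ u ∂unif, |γ i u| ≤ b u)
    (hgb : ∀ᵐ u ∂unif, |g u| ≤ b u)
    (hγ : ∀ᵐ u ∂unif, Tendsto (fun i => γ i u) l (𝓝 (g u))) :
    Tendsto (fun i => ∫ v, γ i v * (1 / φ i (pathQuantile (p i) v) *
        fiberSum (p i) (k i) (pathQuantile (p i) v)) ∂unif) l
      (𝓝 (∫ v, g v * (1 / f (pathQuantile q v) * fiberSum q h (pathQuantile q v)) ∂unif)) := by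
  obtain ⟨c, hc⟩ := isCompact_Icc.exists_bound_of_continuousOn hh
  obtain ⟨hm, hbd, hint⟩ := hp.limit.quantile_derivative hf hh (c := c + 1)
    fun u hu => (hc u hu).trans (by linarith)
  have hev := eventually_abs_le hkh hc
  refine tendsto_integral_mul_of_dense (c := c + 1) ?_ ?_ hm hbd ?_ hγm hgm hb hγb hgb hγ
  · filter_upwards [hp.regular, hk, hφ, hev] with i h1 h2 h3 h4
    exact (h1.quantile_derivative h3 h2 h4).1
  · filter_upwards [hp.regular, hk, hφ, hev] with i h1 h2 h3 h4
    exact (h1.quantile_derivative h3 h2 h4).2.1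
  · intro κ hκ C hκC
    rw [hint κ hκ]
    refine (hp.tendsto_integral_comp_pathCdf
      (hk.mono fun i hi => hi.aemeasurable measurableSet_Icc) hh hkh hκ hκC).congr' ?_
    filter_upwards [hp.regular, hk, hφ, hev] with i h1 h2 h3 h4
    exact ((h1.quantile_derivative h3 h2 h4).2.2 κ hκ).symm

end

/-! ### The functional delta method in `ℓ^∞` -/

section EllInfty

variable {T T₁ T₂ : Type*} [MeasurableSpace T] [MeasurableSpace T₁] [MeasurableSpace T₂]

lemma exists_ellInfty {S : Set T} {f : T → ℝ} (hf : Measurable fun s : S => f s) {C : ℝ}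
    (hC : ∀ s ∈ S, |f s| ≤ C) : ∃ w : EllInfty S, ∀ s : S, w.1 s = f s :=
  ⟨⟨⟨fun s => f s, memℓp_infty ⟨C, by rintro _ ⟨s, rfl⟩; exact hC s s.2⟩⟩, hf⟩, fun _ => rfl⟩

lemma EllInfty.abs_sub_le_dist {S : Type*} [MeasurableSpace S] (w z : EllInfty S) (s : S) :
    |w.1 s - z.1 s| ≤ dist w z := by
  rw [Subtype.dist_eq, dist_eq_norm]
  exact lp.norm_apply_le_norm (by simp) (w.1 - z.1) s

lemma EllInfty.dist_le {S : Type*} [MeasurableSpace S] {w z : EllInfty S} {C : ℝ} (hC : 0 ≤ C)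
    (h : ∀ s, |w.1 s - z.1 s| ≤ C) : dist w z ≤ C := by
  rw [Subtype.dist_eq, dist_eq_norm]
  exact lp.norm_le_of_forall_le hC h

/-- **Functional delta method** for processes indexed by a compact set `S₂`: it is enough that the
functionals `Φ n` converge continuously, in the process and in the index jointly. -/
theorem ConvergesWeaklyInEllInfty.delta_method [TopologicalSpace T₂]
    {S₁ : Set T₁} {S₂ : Set T₂} (hS₂ : IsCompact S₂) [OpensMeasurableSpace S₂]
    [FirstCountableTopology T₂]
    {Ω : ℕ → Type*} [∀ n, MeasurableSpace (Ω n)] {P : ∀ n, Measure (Ω n)}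
    [∀ n, IsProbabilityMeasure (P n)] {X : ∀ n, Ω n → T₁ → ℝ}
    {Ω' : Type*} [MeasurableSpace Ω'] {P' : Measure Ω'} [IsProbabilityMeasure P']
    {Z : Ω' → T₁ → ℝ} (h : ConvergesWeaklyInEllInfty S₁ P X P' Z)
    {Φ : ℕ → EllInfty S₁ → T₂ → ℝ} {X' : ∀ n, Ω n → T₂ → ℝ} {Z' : Ω' → T₂ → ℝ}
    (hΦm : ∀ n w, Measurable fun s : S₂ => Φ n w s)
    (hΦb : ∀ n w, ∃ C : ℝ, ∀ s ∈ S₂, |Φ n w s| ≤ C)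
    (hΦ : ∀ n ω (w : EllInfty S₁), (∀ s : S₁, w.1 s = X n ω s) → ∀ s ∈ S₂, Φ n w s = X' n ω s)
    (hZ' : ∀ ω, ContinuousOn (Z' ω) S₂)
    (hlim : ∀ ω (z : EllInfty S₁), (∀ s : S₁, z.1 s = Z ω s) → ∀ p ∈ S₂,
      Tendsto (fun i : (ℕ × EllInfty S₁) × T₂ => Φ i.1.1 i.1.2 i.2)
        ((atTop ×ˢ 𝓝 z) ×ˢ 𝓝[S₂] p) (𝓝 (Z' ω p))) :
    ConvergesWeaklyInEllInfty S₂ P X' P' Z' := by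
  obtain ⟨Xe, Ze, hXe, hZe, hconv⟩ := h
  have hΨ : ∀ n w, ∃ v : EllInfty S₂, ∀ s : S₂, v.1 s = Φ n w s := fun n w => by
    obtain ⟨C, hC⟩ := hΦb n w
    exact exists_ellInfty (hΦm n w) hC
  choose Ψ hΨ using hΨ
  have hZ'e : ∀ ω, ∃ v : EllInfty S₂, ∀ s : S₂, v.1 s = Z' ω s := fun ω => by
    obtain ⟨C, hC⟩ := hS₂.exists_bound_of_continuousOn (hZ' ω)
    exact exists_ellInfty (continuousOn_iff_continuous_domRestrict.1 (hZ' ω)).measurable hC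
  choose Ze' hZe' using hZ'e
  refine ⟨fun n ω => Ψ n (Xe n ω), Ze', fun n ω s => ?_, hZe',
    hconv.extended_continuous_mapping Ψ (fun _ _ => rfl) fun ω => ?_⟩
  · rw [hΨ]
    exact hΦ n ω _ (hXe n ω) s s.2
  · have hunif : TendstoUniformlyOn (fun k : ℕ × EllInfty S₁ => Φ k.1 k.2) (Z' ω)
        (atTop ×ˢ 𝓝 (Ze ω)) S₂ := by
      rw [← tendstoLocallyUniformlyOn_iff_tendstoUniformlyOn_of_compact hS₂,
        tendstoLocallyUniformlyOn_iff_forall_tendsto]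
      intro p hp
      have h1 : Tendsto (fun i : (ℕ × EllInfty S₁) × T₂ => Z' ω i.2)
          ((atTop ×ˢ 𝓝 (Ze ω)) ×ˢ 𝓝[S₂] p) (𝓝 (Z' ω p)) := (hZ' ω p hp).tendsto.comp tendsto_snd
      exact (h1.prodMk_nhds (hlim ω (Ze ω) (hZe ω) p hp)).mono_right (nhds_le_uniformity _)
    rw [Metric.tendsto_nhds]
    intro ε hε
    filter_upwards [Metric.tendstoUniformlyOn_iff.1 hunif (ε / 2) (half_pos hε)] with k hk
    refine (EllInfty.dist_le (half_pos hε).le fun s => ?_).trans_lt (half_lt_self hε)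
    have := (hk s s.2).le
    rwa [dist_comm, Real.dist_eq, ← hΨ, ← hZe'] at this

open Classical in
/-- The extension by `0` of an element of `ℓ^∞(S)` to the ambient space. -/
def extendZero {S : Set T} (w : EllInfty S) (t : T) : ℝ := if h : t ∈ S then w.1 ⟨t, h⟩ else 0

lemma extendZero_of_mem {S : Set T} (w : EllInfty S) {t : T} (h : t ∈ S) :
    extendZero w t = w.1 ⟨t, h⟩ := dif_pos h

lemma measurable_extendZero {S : Set T} (w : EllInfty S) : Measurable fun s : S => extendZero w s := by
  have : (fun s : S => extendZero w s) = fun s => w.1 s := funext fun s => extendZero_of_mem w s.2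
  rw [this]
  exact w.2

end EllInfty

/-! ### Curves depending on a covariate -/

lemma derivF_eq {E : Type*} (Q H : ℝ → E → ℝ) (y : ℝ) (x : E) :
    derivF Q H y x = -fiberSum (fun u => Q u x) (fun u => H u x) y := rfl

lemma derivQ_eq {E : Type*} (Q H : ℝ → E → ℝ) (v : ℝ) (x : E) :
    derivQ Q H v x = 1 / densityY Q (pathQuantile (fun u => Q u x) v) x *
      fiberSum (fun u => Q u x) (fun u => H u x) (pathQuantile (fun u => Q u x) v) :=
  neg_mul_neg _ _

section Curve

variable {E : Type*} [NormedAddCommGroup E] {X : Set E} {Q H : ℝ → E → ℝ} {N : ℕ}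

lemma isCompact_regionUX (hX : IsCompact X) : IsCompact (regionUX X) := isCompact_Icc.prod hX

lemma continuousOn_path (hH : ContinuousOn (fun p : ℝ × E => H p.1 p.2) (regionUX X)) {x : E}
    (hx : x ∈ X) : ContinuousOn (fun u => H u x) (Icc 0 1) :=
  hH.comp (f := fun u : ℝ => (u, x)) (by fun_prop) fun _ hu => ⟨hu, hx⟩

lemma tendstoUniformlyOn_path (hX : IsCompact X)
    (hH : ContinuousOn (fun p : ℝ × E => H p.1 p.2) (regionUX X)) {x : E} (hx : x ∈ X)
    {ι : Type*} {l : Filter ι} {ξ : ι → E} (hξ : Tendsto ξ l (𝓝[X] x)) :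
    TendstoUniformlyOn (fun i u => H u (ξ i)) (fun u => H u x) l (Icc 0 1) := by
  have hc : ContinuousOn (fun p : E × ℝ => H p.2 p.1) (X ×ˢ Icc 0 1) :=
    hH.comp (f := fun p : E × ℝ => (p.2, p.1)) (by fun_prop) fun p hp => ⟨hp.2, hp.1⟩
  have huc := (hX.prod isCompact_Icc).uniformContinuousOn_of_continuous hc
  have := UniformContinuousOn.tendstoUniformlyOn (F := fun (x : E) (u : ℝ) => H u x) huc hx
  exact fun v hv => hξ.eventually (this v hv)

lemma tendsto_snd_of_region {S : Set (ℝ × E)} (hSX : ∀ p ∈ S, p.2 ∈ X) {ι : Type*} {l : Filter ι}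
    {π : ι → ℝ × E} {p : ℝ × E} (hπ : Tendsto π l (𝓝[S] p)) :
    Tendsto (fun i => (π i).2) l (𝓝[X] p.2) :=
  tendsto_nhdsWithin_iff.2 ⟨(continuous_snd.tendsto p).comp (hπ.mono_right nhdsWithin_le_nhds),
    (hπ.eventually self_mem_nhdsWithin).mono fun _ hi => hSX _ hi⟩

variable [NormedSpace ℝ E]

/-- A continuously differentiable curve on `[0,1] × X`, with `X` compact, whose paths have at most
`N` critical points each. -/
structure IsModel (X : Set E) (Q : ℝ → E → ℝ) (N : ℕ) : Prop where
  isCompact : IsCompact X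
  contDiffOn : ContDiffOn ℝ 1 (fun p : ℝ × E => Q p.1 p.2) (regionUX X)
  encard_le : ∀ x ∈ X, {u : ℝ | u ∈ Icc (0 : ℝ) 1 ∧ partialU Q u x = 0}.encard ≤ N

namespace IsModel

lemma continuousOn (hM : IsModel X Q N) : ContinuousOn (fun p : ℝ × E => Q p.1 p.2) (regionUX X) :=
  hM.contDiffOn.continuousOn

/-- The partial derivative is continuous, although `X` need not have unique derivatives: locally,
it is the value at `(1, 0)` of some continuous derivative along `[0,1] × X`. -/
lemma continuousOn_partialU (hM : IsModel X Q N) :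
    ContinuousOn (fun p : ℝ × E => partialU Q p.1 p.2) (regionUX X) := by
  intro p hp
  obtain ⟨U, hU, hUs, -, f', hf', hf'c⟩ :=
    (contDiffWithinAt_succ_iff_hasFDerivWithinAt' (n := 0) (by simp)).1
      (by simpa using hM.contDiffOn p hp)
  rw [insert_eq_of_mem hp] at hU hUs
  have heq : ∀ r ∈ U, partialU Q r.1 r.2 = f' r (1, 0) := by
    intro r hr
    have hr' := hUs hr
    have hd : HasDerivWithinAt (fun v : ℝ => (v, r.2)) ((1 : ℝ), (0 : E)) (Icc 0 1) r.1 :=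
      (hasDerivWithinAt_id _ _).prodMk (hasDerivWithinAt_const _ _ _)
    have hcomp := HasFDerivWithinAt.comp_hasDerivWithinAt (t := regionUX X) r.1
      (f := fun v : ℝ => (v, r.2)) (l := fun p : ℝ × E => Q p.1 p.2) (l' := f' r) (hf' r hr) hd
      fun v hv => ⟨hv, hr'.2⟩
    exact hcomp.derivWithin (uniqueDiffOn_Icc zero_lt_one _ hr'.1)
  have hc : ContinuousWithinAt (fun r => f' r (1, 0)) (regionUX X) p :=
    hf'c.continuousWithinAt.clm_apply continuousWithinAt_const
  exact hc.congr_of_eventuallyEq (eventually_of_mem hU heq) (heq p (mem_of_mem_nhdsWithin hp hU))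

lemma isRegularPath (hM : IsModel X Q N) {x : E} (hx : x ∈ X) :
    IsRegularPath N fun u => Q u x :=
  ⟨hM.contDiffOn.comp (f := fun u : ℝ => (u, x)) (by fun_prop) fun _ hu => ⟨hu, hx⟩,
    hM.encard_le x hx⟩

lemma pathConvergence (hM : IsModel X Q N) {x : E} (hx : x ∈ X) {ι : Type*} {l : Filter ι}
    {ξ : ι → E} (hξ : Tendsto ξ l (𝓝[X] x)) :
    PathConvergence l N (fun i u => Q u (ξ i)) fun u => Q u x where
  limit := hM.isRegularPath hx
  regular := by
    filter_upwards [hξ.eventually self_mem_nhdsWithin] with i hi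
    exact hM.isRegularPath hi
  tendsto_path := tendstoUniformlyOn_path hM.isCompact hM.continuousOn hx hξ
  tendsto_deriv := tendstoUniformlyOn_path hM.isCompact hM.continuousOn_partialU hx hξ

/-- The support of the law of a continuous path is its range. -/
lemma supportY_eq (hM : IsModel X Q N) {x : E} (hx : x ∈ X) :
    supportY Q x = (fun u => Q u x) '' Icc 0 1 := by
  have hc := continuousOn_path hM.continuousOn hx
  have hm := (hM.isRegularPath hx).aemeasurable
  apply Subset.antisymm
  · refine Measure.support_subset_of_isClosed (isCompact_Icc.image_of_continuousOn hc).isClosed ?_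
    rw [mem_ae_map_iff hm ((isCompact_Icc.image_of_continuousOn hc).measurableSet)]
    exact mem_of_superset (ae_restrict_mem measurableSet_Icc) fun u hu => ⟨u, hu, rfl⟩
  · rintro _ ⟨u, hu, rfl⟩
    rw [supportY, Measure.mem_support_iff_forall]
    intro U hU
    refine lt_of_lt_of_le ?_ (Measure.le_map_apply hm U)
    obtain ⟨O, hO, huO, hOU⟩ := mem_nhdsWithin.1 ((hc u hu).preimage_mem_nhdsWithin hU)
    have hne : (O ∩ Ioo (0 : ℝ) 1).Nonempty := by
      rw [← closure_Ioo zero_ne_one] at hu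
      exact mem_closure_iff.1 hu O hO huO
    calc (0 : ℝ≥0∞) < volume (O ∩ Ioo (0 : ℝ) 1) := (hO.inter isOpen_Ioo).measure_pos _ hne
      _ = (volume.restrict (Icc (0 : ℝ) 1)) (O ∩ Ioo (0 : ℝ) 1) :=
          (Measure.restrict_eq_self _ (inter_subset_right.trans Ioo_subset_Icc_self)).symm
      _ ≤ _ := measure_mono fun v hv => hOU ⟨hv.1, Ioo_subset_Icc_self hv.2⟩

lemma isCompact_regionYX (hM : IsModel X Q N) : IsCompact (regionYX Q X) := by
  have h : regionYX Q X = (fun p : ℝ × E => (Q p.1 p.2, p.2)) '' regionUX X := by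
    ext ⟨y, x⟩
    constructor
    · rintro ⟨hy, hx⟩
      obtain ⟨u, hu, rfl⟩ : y ∈ (fun u => Q u x) '' Icc 0 1 := hM.supportY_eq hx ▸ hy
      exact ⟨(u, x), ⟨hu, hx⟩, rfl⟩
    · rintro ⟨⟨u, x'⟩, ⟨hu, hx⟩, heq⟩
      obtain ⟨rfl, rfl⟩ := Prod.mk.inj heq
      refine ⟨?_, hx⟩
      rw [hM.supportY_eq hx]
      exact ⟨u, hu, rfl⟩
  rw [h]
  exact (isCompact_regionUX hM.isCompact).image_of_continuousOn
    (hM.continuousOn.prodMk continuousOn_snd)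

lemma ae_densityY (hM : IsModel X Q N) {x : E} (hx : x ∈ X) :
    ∀ᵐ y, y ∈ (fun u => Q u x) '' Icc 0 1 → densityY Q y x = fiberSum (fun u => Q u x) 1 y := by
  have hq := hM.isRegularPath hx
  filter_upwards [hq.ae_hasDerivAt_pathCdf, hq.ae_notMem_image_critSet] with y h1 h2 hy
  have hreg : y ∈ regularY Q x :=
    ⟨by rwa [hM.supportY_eq hx], hy, fun u hu huy h0 => h2 ⟨u, ⟨hu, h0⟩, huy⟩⟩
  rw [densityY, if_pos hreg]
  exact h1.deriv

lemma exists_bound (hM : IsModel X Q N) : ∃ C, ∀ p ∈ regionUX X, |Q p.1 p.2| ≤ C :=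
  (isCompact_regionUX hM.isCompact).exists_bound_of_continuousOn hM.continuousOn

end IsModel

end Curve

/-! ### Joint measurability -/

/-- An integrable majorant of the weights. -/
lemma HasIntegrableSup.exists_bound {E : Type*} {V : Set ℝ} {S : Set (ℝ × E)}
    {g : ℝ → ℝ × E → ℝ} (hg : HasIntegrableSup V S g) :
    ∃ b : ℝ → ℝ, Integrable b (volume.restrict V) ∧
      ∀ᵐ v ∂(volume.restrict V), ∀ p ∈ S, |g v p| ≤ b v := by
  refine ⟨fun v => (⨆ p ∈ S, ‖g v p‖ₑ).toReal, integrable_toReal_of_lintegral_ne_top hg.1 hg.2.ne, ?_⟩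
  filter_upwards [ae_lt_top' hg.1 hg.2.ne] with v hv p hp
  have h1 : ‖g v p‖ₑ ≤ ⨆ p ∈ S, ‖g v p‖ₑ := le_iSup₂ (f := fun p (_ : p ∈ S) => ‖g v p‖ₑ) p hp
  have h2 := ENNReal.toReal_mono hv.ne h1
  rwa [toReal_enorm, Real.norm_eq_abs] at h2

section Measurability

variable {E : Type*} [MeasurableSpace E] {X : Set E} {R : ℝ → E → ℝ}

lemma aemeasurable_path (hR : Measurable fun p : ↥(regionUX X) => R p.1.1 p.1.2) {x : E}
    (hx : x ∈ X) : AEMeasurable (fun u => R u x) unif := by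
  refine aemeasurable_restrict_of_measurable_subtype measurableSet_Icc ?_
  exact hR.comp (g := fun p : ↥(regionUX X) => R p.1.1 p.1.2)
    (f := fun u : Icc (0 : ℝ) 1 => ⟨(u, x), u.2, hx⟩)
    ((measurable_subtype_coe.prodMk measurable_const).subtype_mk)

lemma measurable_setIntegral {α : Type*} [MeasurableSpace α] {V : Set ℝ} (hV : MeasurableSet V)
    (hVfin : volume V ≠ ∞) {f : ℝ → α → ℝ} (hf : Measurable fun z : α × V => f z.2 z.1) :
    Measurable fun s => ∫ v in V, f v s := by
  have : IsFiniteMeasure (volume.restrict V) := ⟨by simpa using hVfin.lt_top⟩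
  have heq : ∀ s, ∫ v in V, f v s =
      ∫ v : V, f v s ∂(Measure.comap Subtype.val (volume.restrict V)) := fun s => by
    rw [integral_subtype_comap hV (μ := volume.restrict V) (f := fun v => f v s),
      Measure.restrict_restrict_of_subset subset_rfl]
  simp only [heq]
  exact (StronglyMeasurable.integral_prod_right (f := fun (s : α) (v : V) => f v s)
    hf.stronglyMeasurable).measurable

lemma measurable_distFn {α : Type*} [MeasurableSpace α]
    (hR : Measurable fun p : ↥(regionUX X) => R p.1.1 p.1.2) {y : α → ℝ} (hy : Measurable y)
    {ξ : α → E} (hξ : Measurable ξ) (hξX : ∀ z, ξ z ∈ X) :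
    Measurable fun z => distFn R (y z) (ξ z) := by
  have heq : (fun z => distFn R (y z) (ξ z)) =
      fun z => ∫ u in Icc (0 : ℝ) 1, if R u (ξ z) ≤ y z then 1 else 0 :=
    funext fun z => pathCdf_eq_integral (fun u => R u (ξ z)) (y z)
  rw [heq]
  refine measurable_setIntegral measurableSet_Icc (by simp) (f := fun u z => if R u (ξ z) ≤ y z then 1 else 0) ?_
  refine Measurable.ite (measurableSet_le ?_ (hy.comp measurable_fst)) measurable_const
    measurable_const
  exact hR.comp (g := fun p : ↥(regionUX X) => R p.1.1 p.1.2)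
    (f := fun z : α × Icc (0 : ℝ) 1 => ⟨(z.2, ξ z.1), z.2.2, hξX _⟩)
    (((measurable_subtype_coe.comp measurable_snd).prodMk (hξ.comp measurable_fst)).subtype_mk)

lemma measurable_rearranged {α : Type*} [MeasurableSpace α]
    (hR : Measurable fun p : ↥(regionUX X) => R p.1.1 p.1.2) {C : ℝ}
    (hC : ∀ p ∈ regionUX X, |R p.1 p.2| ≤ C) {u : α → ℝ} (hu : Measurable u)
    (huI : ∀ z, u z ∈ Icc (0 : ℝ) 1) {ξ : α → E} (hξ : Measurable ξ) (hξX : ∀ z, ξ z ∈ X) :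
    Measurable fun z => rearranged R (u z) (ξ z) := by
  refine measurable_of_Iic fun c => ?_
  -- at `u = 0` the infimum is over all of `ℝ`, with the conventional value `0`
  have hset : (fun z => rearranged R (u z) (ξ z)) ⁻¹' Iic c =
      ({z | u z = 0} ∩ {_z | 0 ≤ c}) ∪ ({z | u z ≠ 0} ∩ {z | u z ≤ distFn R c (ξ z)}) := by
    ext z
    have hm := aemeasurable_path hR (hξX z)
    have hb : ∀ v ∈ Icc (0 : ℝ) 1, |R v (ξ z)| ≤ C := fun v hv => hC (v, ξ z) ⟨hv, hξX z⟩
    simp only [mem_preimage, mem_Iic, mem_union, mem_inter_iff, mem_ofPred_eq]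
    by_cases h0 : u z = 0
    · have h1 : {y : ℝ | 0 ≤ distFn R y (ξ z)} = univ :=
        eq_univ_of_forall fun y => (pathCdf_mem_Icc hm y).1
      simp [h0, rearranged, h1]
    · have h1 : u z ∈ Ioc (0 : ℝ) 1 := ⟨lt_of_le_of_ne (huI z).1 (Ne.symm h0), (huI z).2⟩
      simp only [h0, false_and, false_or, not_false_eq_true, true_and, ne_eq]
      exact (le_pathCdf_iff hm hb h1).symm
  rw [hset]
  exact ((hu (measurableSet_singleton 0)).inter (.const _)).union
    ((hu (measurableSet_singleton 0)).compl.inter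
      (measurableSet_le hu (measurable_distFn hR measurable_const hξ hξX)))

variable [TopologicalSpace E] {V : Set ℝ} {S : Set (ℝ × E)} {g : ℝ → ℝ × E → ℝ}

lemma IsWeight.measurable_prod (hg : IsWeight V S g) :
    Measurable fun z : S × V => g z.2 z.1 :=
  hg.1.comp (g := fun q : ↥(V ×ˢ S) => g q.1.1 q.1.2)
    (f := fun z : S × V => ⟨((z.2 : ℝ), (z.1 : ℝ × E)), z.2.2, z.1.2⟩)
    (((measurable_subtype_coe.comp measurable_snd).prodMk
      (measurable_subtype_coe.comp measurable_fst)).subtype_mk)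

lemma IsWeight.measurable_section (hg : IsWeight V S g) {p : ℝ × E} (hp : p ∈ S) :
    Measurable fun v : V => g v p :=
  hg.measurable_prod.comp (f := fun v : V => ((⟨p, hp⟩ : S), v))
    (measurable_const.prodMk measurable_id)

lemma IsWeight.measurable_indicator (hg : IsWeight V S g) (hV : MeasurableSet V) {p : ℝ × E}
    (hp : p ∈ S) : Measurable (V.indicator fun v => g v p) := by
  refine measurable_of_restrict_of_restrict_compl hV ?_ ?_
  · have : V.domRestrict (V.indicator fun v => g v p) = fun v : V => g v p :=
      funext fun v => indicator_of_mem v.2 fun v => g v p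
    rw [this]
    exact hg.measurable_section hp
  · have : Vᶜ.domRestrict (V.indicator fun v => g v p) = fun _ => 0 :=
      funext fun v => indicator_of_notMem v.2 fun v => g v p
    rw [this]
    exact measurable_const

lemma IsWeight.aemeasurable (hg : IsWeight V S g) (hV : MeasurableSet V) {p : ℝ × E}
    (hp : p ∈ S) : AEMeasurable (fun v => g v p) (volume.restrict V) :=
  aemeasurable_restrict_of_measurable_subtype hV (hg.measurable_section hp)

lemma IsWeight.weightConvergence (hg : IsWeight V S g) (hV : IsCompact V) {C : ℝ} (hC0 : 0 ≤ C)
    (hC : ∀ v ∈ V, ∀ p ∈ S, |g v p| ≤ C) {ι : Type*} {l : Filter ι} {π : ι → ℝ × E} {p : ℝ × E}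
    (hp : p ∈ S) (hπ : Tendsto π l (𝓝[S] p)) :
    WeightConvergence l V C (fun i => V.indicator fun v => g v (π i)) (V.indicator fun v => g v p) := by
  have hbound : ∀ r ∈ S, ∀ v, |V.indicator (fun v => g v r) v| ≤ C := by
    intro r hr v
    by_cases hv : v ∈ V
    · rw [indicator_of_mem hv]
      exact hC v hv r hr
    · rw [indicator_of_notMem hv, abs_zero]
      exact hC0
  have hmem := hπ.eventually self_mem_nhdsWithin
  refine ⟨hV.measurableSet, hV.measure_lt_top.ne, hg.measurable_indicator hV.measurableSet hp,
    ?_, hbound p hp, ?_, fun v hv => indicator_of_notMem hv _,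
    Eventually.of_forall fun i v hv => indicator_of_notMem hv _, ?_⟩
  · filter_upwards [hmem] with i hi
    exact hg.measurable_indicator hV.measurableSet hi
  · filter_upwards [hmem] with i hi
    exact hbound _ hi
  · have := (ae_restrict_iff' hV.measurableSet).1 (hg.2 p hp)
    filter_upwards [this] with v hv
    by_cases hvV : v ∈ V
    · simp only [indicator_of_mem hvV]
      exact (hv hvV).tendsto.comp hπ
    · simp only [indicator_of_notMem hvV]
      exact tendsto_const_nhds

end Measurability

section

/-! ### Integral functionals of the estimators -/

section Perturb

variable {E : Type*} [MeasurableSpace E] {X : Set E} {Q R : ℝ → E → ℝ}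

/-- The curve `Q + s * w`. -/
def perturb (Q : ℝ → E → ℝ) (s : ℝ) (w : EllInfty (regionUX X)) (u : ℝ) (x : E) : ℝ :=
  Q u x + s * extendZero w (u, x)

/-- The estimator is recovered from its standardized version, unless `α = 0`. -/
lemma perturb_eq {α : ℝ} {w : EllInfty (regionUX X)}
    (hw : ∀ s : regionUX X, w.1 s = α * (R s.1.1 s.1.2 - Q s.1.1 s.1.2)) (hα : α ≠ 0)
    {u : ℝ} (hu : u ∈ Icc (0 : ℝ) 1) {x : E} (hx : x ∈ X) :
    perturb Q α⁻¹ w u x = R u x := by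
  have hmem : (u, x) ∈ regionUX X := ⟨hu, hx⟩
  rw [perturb, extendZero_of_mem w hmem, hw]
  field_simp
  ring

end Perturb

lemma tendstoUniformlyOn_extendZero {E : Type*} [NormedAddCommGroup E] [MeasurableSpace E]
    {X : Set E} (hX : IsCompact X) {H : ℝ → E → ℝ}
    (hH : ContinuousOn (fun p : ℝ × E => H p.1 p.2) (regionUX X)) {z : EllInfty (regionUX X)}
    (hz : ∀ s : regionUX X, z.1 s = H s.1.1 s.1.2) {x : E} (hx : x ∈ X) {ι : Type*} {l : Filter ι}
    {w : ι → EllInfty (regionUX X)} (hw : Tendsto w l (𝓝 z)) {ξ : ι → E}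
    (hξ : Tendsto ξ l (𝓝[X] x)) :
    TendstoUniformlyOn (fun i u => extendZero (w i) (u, ξ i)) (fun u => H u x) l (Icc 0 1) := by
  rw [Metric.tendstoUniformlyOn_iff]
  intro ε hε
  filter_upwards [Metric.tendstoUniformlyOn_iff.1 (tendstoUniformlyOn_path hX hH hx hξ) (ε / 2)
    (half_pos hε), Metric.tendsto_nhds.1 hw (ε / 2) (half_pos hε),
    hξ.eventually self_mem_nhdsWithin] with i h1 h2 h3 u hu
  have hmem : (u, ξ i) ∈ regionUX X := ⟨hu, h3⟩
  have h4 := EllInfty.abs_sub_le_dist (w i) z ⟨_, hmem⟩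
  rw [hz, ← extendZero_of_mem, ← Real.dist_eq, dist_comm] at h4
  calc dist (H u x) (extendZero (w i) (u, ξ i))
      ≤ dist (H u x) (H u (ξ i)) + dist (H u (ξ i)) (extendZero (w i) (u, ξ i)) :=
        dist_triangle _ _ _
    _ < ε := by linarith [h1 u hu]

variable {E : Type*} [NormedAddCommGroup E] [NormedSpace ℝ E] [MeasurableSpace E]
  {X : Set E} {Q R : ℝ → E → ℝ} {N : ℕ} {Y : Set ℝ} {g : ℝ → ℝ × E → ℝ} {C : ℝ} {b : ℝ → ℝ}

lemma IsModel.exists_bound_perturb (hM : IsModel X Q N) (s : ℝ) (w : EllInfty (regionUX X)) :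
    ∃ C, ∀ p ∈ regionUX X, |perturb Q s w p.1 p.2| ≤ C := by
  obtain ⟨C, hC⟩ := hM.exists_bound
  refine ⟨C + |s| * ‖w.1‖, fun p hp => ?_⟩
  rw [perturb, Prod.mk.eta, extendZero_of_mem w hp]
  refine (abs_add_le _ _).trans ?_
  rw [abs_mul]
  gcongr
  · exact hC p hp
  · exact lp.norm_apply_le_norm (by simp) w.1 ⟨p, hp⟩

lemma integrableOn_mul_distFn_sub (hM : IsModel X Q N) (hY : IsCompact Y)
    (hg : IsWeight Y (regionYX Q X) g) (hC : ∀ v ∈ Y, ∀ p ∈ regionYX Q X, |g v p| ≤ C)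
    (hR : Measurable fun p : ↥(regionUX X) => R p.1.1 p.1.2) {p : ℝ × E} (hp : p ∈ regionYX Q X) :
    IntegrableOn (fun y => g y p * (distFn R y p.2 - distFn Q y p.2)) Y ∧
      |∫ y in Y, g y p * (distFn R y p.2 - distFn Q y p.2)| ≤ C * volume.real Y := by
  have hRm := aemeasurable_path hR hp.2
  have hQm := (hM.isRegularPath hp.2).aemeasurable
  have hbound : ∀ y ∈ Y, ‖g y p * (distFn R y p.2 - distFn Q y p.2)‖ ≤ C := by
    intro y hy
    have h1 : distFn R y p.2 ∈ Icc (0 : ℝ) 1 := pathCdf_mem_Icc hRm y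
    have h2 : distFn Q y p.2 ∈ Icc (0 : ℝ) 1 := pathCdf_mem_Icc hQm y
    have h3 := hC y hy p hp
    rw [norm_mul, Real.norm_eq_abs, Real.norm_eq_abs]
    calc |g y p| * |distFn R y p.2 - distFn Q y p.2| ≤ C * 1 := by
          gcongr
          · exact (abs_nonneg _).trans h3
          · exact abs_le.2 ⟨by linarith [h1.1, h2.2], by linarith [h1.2, h2.1]⟩
      _ = C := mul_one C
  refine ⟨?_, norm_setIntegral_le_of_norm_le_const hY.measure_lt_top hbound⟩
  refine IntegrableOn.of_bound hY.measure_lt_top ?_ C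
    (ae_restrict_of_forall_mem hY.measurableSet hbound)
  exact ((hg.aemeasurable hY.measurableSet hp).mul
    ((measurable_pathCdf hRm).sub (measurable_pathCdf hQm)).aemeasurable).aestronglyMeasurable

/-- The limit in the first part, as an integral over `[0,1]` by the area formula. -/
lemma integral_mul_derivF (hM : IsModel X Q N) (hY : IsCompact Y)
    (hg : IsWeight Y (regionYX Q X) g) (hC : ∀ v ∈ Y, ∀ p ∈ regionYX Q X, |g v p| ≤ C)
    {H : ℝ → E → ℝ} (hH : ContinuousOn (fun p : ℝ × E => H p.1 p.2) (regionUX X)) {p : ℝ × E}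
    (hp : p ∈ regionYX Q X) :
    IntegrableOn (fun y => g y p * derivF Q H y p.2) Y ∧
      ∫ y in Y, g y p * derivF Q H y p.2 =
        -∫ u, Y.indicator (fun y => g y p) (Q u p.2) * H u p.2 ∂unif := by
  have hq := hM.isRegularPath hp.2
  have hHc := continuousOn_path hH hp.2
  have hHi : Integrable (fun u => H u p.2) unif := hHc.integrableOn_compact isCompact_Icc
  have hint : Integrable (fun u => Y.indicator (fun y => g y p) (Q u p.2) * H u p.2) unif := by
    refine Integrable.bdd_mul (c := max C 0) hHi ?_ (ae_of_all _ fun u => ?_)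
    · exact ((hg.measurable_indicator hY.measurableSet hp).comp_aemeasurable
        hq.aemeasurable).aestronglyMeasurable
    · by_cases hu : Q u p.2 ∈ Y
      · rw [indicator_of_mem hu]
        exact (hC _ hu p hp).trans (le_max_left _ _)
      · rw [indicator_of_notMem hu, norm_zero]
        exact le_max_right _ _
  obtain ⟨h1, h2⟩ := hq.integral_mul_fiberSum hint
  have heq : (fun y => Y.indicator (fun y => g y p) y *
      fiberSum (fun u => Q u p.2) (fun u => H u p.2) y) =
      Y.indicator fun y => -(g y p * derivF Q H y p.2) := by
    ext y
    by_cases hy : y ∈ Y <;> simp [hy, derivF_eq]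
  rw [heq] at h1 h2
  rw [integral_indicator hY.measurableSet, integral_neg] at h2
  refine ⟨by simpa using ((integrable_indicator_iff hY.measurableSet).1 h1).neg, ?_⟩
  rw [← h2, neg_neg]

lemma continuousOn_integral_mul_derivF (hM : IsModel X Q N) (hY : IsCompact Y) (hg : IsWeight Y (regionYX Q X) g)
    (hC : ∀ v ∈ Y, ∀ p ∈ regionYX Q X, |g v p| ≤ C) {H : ℝ → E → ℝ}
    (hH : ContinuousOn (fun p : ℝ × E => H p.1 p.2) (regionUX X)) :
    ContinuousOn (fun p : ℝ × E => ∫ y in Y, g y p * derivF Q H y p.2) (regionYX Q X) := by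
  intro p hp
  have hsnd := tendsto_snd_of_region (fun p (hp : p ∈ regionYX Q X) => hp.2)
    (tendsto_id (x := 𝓝[regionYX Q X] p))
  have hw := hg.weightConvergence hY (le_max_right C 0)
    (fun v hv r hr => (hC v hv r hr).trans (le_max_left _ _)) hp tendsto_id
  have hlim := (hM.pathConvergence hp.2 hsnd).tendsto_integral_comp hw
    (k := fun r u => H u r.2)
    (eventually_of_mem self_mem_nhdsWithin fun r hr =>
      (continuousOn_path hH hr.2).aemeasurable measurableSet_Icc)
    (continuousOn_path hH hp.2) (tendstoUniformlyOn_path hM.isCompact hH hp.2 hsnd)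
  rw [ContinuousWithinAt, (integral_mul_derivF hM hY hg hC hH hp).2]
  refine hlim.congr' (eventually_of_mem self_mem_nhdsWithin fun r hr => ?_)
  exact ((integral_mul_derivF hM hY hg hC hH hr).2).symm

lemma integrableOn_mul_rearranged_sub (hM : IsModel X Q N)
    (hg : IsWeight (Icc 0 1) (regionUX X) g) (hb : Integrable b unif)
    (hgb : ∀ᵐ v ∂unif, ∀ p ∈ regionUX X, |g v p| ≤ b v)
    (hR : Measurable fun p : ↥(regionUX X) => R p.1.1 p.1.2)
    (hRC : ∀ p ∈ regionUX X, |R p.1 p.2| ≤ C) (hQC : ∀ p ∈ regionUX X, |Q p.1 p.2| ≤ C)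
    {p : ℝ × E} (hp : p ∈ regionUX X) :
    IntegrableOn (fun u => g u p * (rearranged R u p.2 - rearranged Q u p.2)) (Icc 0 1) ∧
      |∫ u in Icc (0 : ℝ) 1, g u p * (rearranged R u p.2 - rearranged Q u p.2)| ≤
        ∫ u, b u * (C + C) ∂unif := by
  have hRm := aemeasurable_path hR hp.2
  have hQm := (hM.isRegularPath hp.2).aemeasurable
  have hR1 : ∀ u ∈ Icc (0 : ℝ) 1, |R u p.2| ≤ C := fun u hu => hRC (u, p.2) ⟨hu, hp.2⟩
  have hQ1 : ∀ u ∈ Icc (0 : ℝ) 1, |Q u p.2| ≤ C := fun u hu => hQC (u, p.2) ⟨hu, hp.2⟩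
  have hbound : ∀ᵐ u ∂unif,
      ‖g u p * (rearranged R u p.2 - rearranged Q u p.2)‖ ≤ b u * (C + C) := by
    filter_upwards [hgb, ae_unif_mem] with u h1 h2
    have h3 : |rearranged R u p.2| ≤ C := abs_pathQuantile_le hRm hR1 h2
    have h4 : |rearranged Q u p.2| ≤ C := abs_pathQuantile_le hQm hQ1 h2
    rw [norm_mul]
    exact mul_le_mul (h1 p hp) ((abs_sub _ _).trans (add_le_add h3 h4)) (norm_nonneg _)
      ((abs_nonneg _).trans (h1 p hp))
  refine ⟨(hb.mul_const _).mono' ?_ hbound, norm_integral_le_of_norm_le (hb.mul_const _) hbound⟩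
  exact ((hg.aemeasurable measurableSet_Icc hp).mul ((aemeasurable_pathQuantile hRm hR1).sub
    (aemeasurable_pathQuantile hQm hQ1))).aestronglyMeasurable

lemma integrableOn_mul_derivQ (hM : IsModel X Q N)
    (hg : IsWeight (Icc 0 1) (regionUX X) g) (hb : Integrable b unif)
    (hgb : ∀ᵐ v ∂unif, ∀ p ∈ regionUX X, |g v p| ≤ b v)
    {H : ℝ → E → ℝ} (hH : ContinuousOn (fun p : ℝ × E => H p.1 p.2) (regionUX X)) {p : ℝ × E}
    (hp : p ∈ regionUX X) :
    IntegrableOn (fun u => g u p * derivQ Q H u p.2) (Icc 0 1) := by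
  have hHc := continuousOn_path hH hp.2
  obtain ⟨c, hc⟩ := isCompact_Icc.exists_bound_of_continuousOn hHc
  obtain ⟨h1, h2, -⟩ := (hM.isRegularPath hp.2).quantile_derivative (hM.ae_densityY hp.2) hHc hc
  have hgi : Integrable (fun v => g v p) unif :=
    hb.mono' (hg.aemeasurable measurableSet_Icc hp).aestronglyMeasurable
      (hgb.mono fun v hv => hv p hp)
  simp only [derivQ_eq]
  exact hgi.mul_bdd (c := c) h1 h2

lemma continuousOn_integral_mul_derivQ (hM : IsModel X Q N)
    (hg : IsWeight (Icc 0 1) (regionUX X) g)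
    (hb : Integrable b unif) (hgb : ∀ᵐ v ∂unif, ∀ p ∈ regionUX X, |g v p| ≤ b v) {H : ℝ → E → ℝ}
    (hH : ContinuousOn (fun p : ℝ × E => H p.1 p.2) (regionUX X)) :
    ContinuousOn (fun p : ℝ × E => ∫ u in Icc (0 : ℝ) 1, g u p * derivQ Q H u p.2)
      (regionUX X) := by
  intro p hp
  have hsnd : Tendsto (fun r : ℝ × E => r.2) (𝓝[regionUX X] p) (𝓝[X] p.2) :=
    tendsto_snd_of_region (fun p (hp : p ∈ regionUX X) => hp.2) tendsto_id
  have hmem : ∀ᶠ r in 𝓝[regionUX X] p, r ∈ regionUX X := self_mem_nhdsWithin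
  simp only [derivQ_eq]
  have hlim := (hM.pathConvergence hp.2 hsnd).tendsto_integral_quantile_derivative (g := fun v => g v p)
    (k := fun r u => H u r.2) (φ := fun r y => densityY Q y r.2) (γ := fun r v => g v r)
    (hmem.mono fun r hr => continuousOn_path hH hr.2) (continuousOn_path hH hp.2)
    (tendstoUniformlyOn_path hM.isCompact hH hp.2 hsnd)
    (hmem.mono fun r hr => hM.ae_densityY hr.2) (hM.ae_densityY hp.2)
    (hmem.mono fun r hr => (hg.aemeasurable measurableSet_Icc hr).aestronglyMeasurable)
    (hg.aemeasurable measurableSet_Icc hp).aestronglyMeasurable hb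
    (hmem.mono fun r hr => hgb.mono fun v hv => hv r hr) (hgb.mono fun v hv => hv p hp)
    ((hg.2 p hp).mono fun v hv => hv.tendsto)
  exact hlim

variable [BorelSpace E] [SecondCountableTopology E]

lemma IsModel.measurable (hM : IsModel X Q N) :
    Measurable fun p : ↥(regionUX X) => Q p.1.1 p.1.2 :=
  (continuousOn_iff_continuous_domRestrict.1 hM.continuousOn).measurable

lemma IsModel.measurable_perturb (hM : IsModel X Q N) (s : ℝ) (w : EllInfty (regionUX X)) :
    Measurable fun p : ↥(regionUX X) => perturb Q s w p.1.1 p.1.2 :=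
  hM.measurable.add ((measurable_extendZero w).const_mul s)

lemma measurable_integral_mul_distFn_sub (hM : IsModel X Q N) (hY : IsCompact Y)
    (hg : IsWeight Y (regionYX Q X) g)
    (hR : Measurable fun p : ↥(regionUX X) => R p.1.1 p.1.2) :
    Measurable fun s : regionYX Q X =>
      ∫ y in Y, g y s * (distFn R y s.1.2 - distFn Q y s.1.2) := by
  refine measurable_setIntegral hY.measurableSet hY.measure_lt_top.ne
    (f := fun y (s : regionYX Q X) => g y s * (distFn R y s.1.2 - distFn Q y s.1.2)) ?_
  have hy : Measurable fun z : regionYX Q X × Y => (z.2 : ℝ) :=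
    measurable_subtype_coe.comp measurable_snd
  have hx : Measurable fun z : regionYX Q X × Y => z.1.1.2 :=
    measurable_snd.comp (measurable_subtype_coe.comp measurable_fst)
  exact hg.measurable_prod.mul ((measurable_distFn hR hy hx fun z => z.1.2.2).sub
    (measurable_distFn hM.measurable hy hx fun z => z.1.2.2))

lemma measurable_integral_mul_rearranged_sub (hM : IsModel X Q N)
    (hg : IsWeight (Icc 0 1) (regionUX X) g)
    (hR : Measurable fun p : ↥(regionUX X) => R p.1.1 p.1.2)
    (hRC : ∀ p ∈ regionUX X, |R p.1 p.2| ≤ C) (hQC : ∀ p ∈ regionUX X, |Q p.1 p.2| ≤ C) :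
    Measurable fun s : regionUX X =>
      ∫ u in Icc (0 : ℝ) 1, g u s * (rearranged R u s.1.2 - rearranged Q u s.1.2) := by
  refine measurable_setIntegral measurableSet_Icc (by simp)
    (f := fun u (s : regionUX X) => g u s * (rearranged R u s.1.2 - rearranged Q u s.1.2)) ?_
  have hu : Measurable fun z : regionUX X × Icc (0 : ℝ) 1 => (z.2 : ℝ) :=
    measurable_subtype_coe.comp measurable_snd
  have hx : Measurable fun z : regionUX X × Icc (0 : ℝ) 1 => z.1.1.2 :=
    measurable_snd.comp (measurable_subtype_coe.comp measurable_fst)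
  exact hg.measurable_prod.mul
    ((measurable_rearranged hR hRC hu (fun z => z.2.2) hx fun z => z.1.2.2).sub
      (measurable_rearranged hM.measurable hQC hu (fun z => z.2.2) hx fun z => z.1.2.2))

/-! ### The two limit theorems -/

section Limit

variable {Ω : ℕ → Type*} [∀ n, MeasurableSpace (Ω n)] {P : ∀ n, Measure (Ω n)}
  [∀ n, IsProbabilityMeasure (P n)] {Ω' : Type*} [MeasurableSpace Ω'] {P' : Measure Ω'}
  [IsProbabilityMeasure P'] {Qhat : ∀ n, Ω n → ℝ → E → ℝ} {a : ℕ → ℝ} {G : Ω' → ℝ → E → ℝ}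

/-- Weak convergence of weighted integrals of the estimated distribution functions. -/
theorem convergesWeakly_integral_distFn
    (hM : IsModel X Q N) (ha : Tendsto a atTop atTop)
    (hG : ∀ ω, ContinuousOn (fun p : ℝ × E => G ω p.1 p.2) (regionUX X))
    (hFCLT : ConvergesWeaklyInEllInfty (regionUX X)
      P (fun n ω p => a n * (Qhat n ω p.1 p.2 - Q p.1 p.2)) P' (fun ω p => G ω p.1 p.2))
    (hY : IsCompact Y) (hg : IsWeight Y (regionYX Q X) g)
    (hC : ∀ v ∈ Y, ∀ p ∈ regionYX Q X, |g v p| ≤ C) :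
    ConvergesWeaklyInEllInfty (regionYX Q X)
      P (fun n ω p => a n * ∫ y in Y, g y p * (distFn (Qhat n ω) y p.2 - distFn Q y p.2))
      P' (fun ω p => ∫ y in Y, g y p * derivF Q (G ω) y p.2) := by
  refine ConvergesWeaklyInEllInfty.delta_method hM.isCompact_regionYX hFCLT
    (Φ := fun n w p => a n *
      ∫ y in Y, g y p * (distFn (perturb Q (a n)⁻¹ w) y p.2 - distFn Q y p.2))
    (fun n w => ?_) (fun n w => ?_) (fun n ω w hw p hp => ?_)
    (fun ω => continuousOn_integral_mul_derivF hM hY hg hC (hG ω)) (fun ω z hz p hp => ?_)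
  · exact (measurable_integral_mul_distFn_sub hM hY hg (hM.measurable_perturb _ w)).const_mul _
  · refine ⟨|a n| * (C * volume.real Y), fun p hp => ?_⟩
    rw [abs_mul]
    gcongr
    exact (integrableOn_mul_distFn_sub hM hY hg hC (hM.measurable_perturb _ w) hp).2
  · by_cases hn : a n = 0
    · simp [hn]
    · congr 2
      ext y
      congr 2
      exact congrFun (pathCdf_congr (q := fun u => perturb Q (a n)⁻¹ w u p.2)
        (r := fun u => Qhat n ω u p.2) fun u hu => perturb_eq hw hn hu hp.2) y
  · set l := ((atTop : Filter ℕ) ×ˢ 𝓝 z) ×ˢ 𝓝[regionYX Q X] p with hl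
    have hn : Tendsto (fun i : (ℕ × EllInfty (regionUX X)) × (ℝ × E) => a i.1.1) l atTop :=
      ha.comp (tendsto_fst.comp tendsto_fst)
    have hw : Tendsto (fun i : (ℕ × EllInfty (regionUX X)) × (ℝ × E) => i.1.2) l (𝓝 z) :=
      tendsto_snd.comp tendsto_fst
    have hπ : Tendsto (fun i : (ℕ × EllInfty (regionUX X)) × (ℝ × E) => i.2) l
      (𝓝[regionYX Q X] p) := tendsto_snd
    have hsnd := tendsto_snd_of_region (fun p (hp : p ∈ regionYX Q X) => hp.2) hπ
    have hmem := hπ.eventually self_mem_nhdsWithin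
    have hlim := (hM.pathConvergence hp.2 hsnd).tendsto_integral_pathCdf
      (hg.weightConvergence hY (le_max_right C 0)
        (fun v hv r hr => (hC v hv r hr).trans (le_max_left _ _)) hp hπ)
      (t := fun i => (a i.1.1)⁻¹) (tendsto_inv_atTop_zero.comp hn)
      ((hn.eventually_gt_atTop 0).mono fun i hi => inv_pos.2 hi)
      (k := fun i u => extendZero i.1.2 (u, i.2.2))
      (hmem.mono fun i hi => aemeasurable_path (R := fun u x => extendZero i.1.2 (u, x))
        (measurable_extendZero i.1.2) hi.2)
      (continuousOn_path (hG ω) hp.2)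
      (tendstoUniformlyOn_extendZero hM.isCompact (hG ω) hz hp.2 hw hsnd)
      (r := fun i u => perturb Q (a i.1.1)⁻¹ i.1.2 u i.2.2)
      (Eventually.of_forall fun i u _ => rfl)
    rw [(integral_mul_derivF hM hY hg hC (hG ω) hp).2]
    refine hlim.congr fun i => ?_
    rw [inv_inv, ← integral_indicator hY.measurableSet]
    congr 2
    ext y
    by_cases hy : y ∈ Y
    · simp only [indicator_of_mem hy]
      rfl
    · simp only [indicator_of_notMem hy, zero_mul]

/-- Weak convergence of weighted integrals of the rearranged estimators. -/
theorem convergesWeakly_integral_rearranged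
    (hM : IsModel X Q N) (ha : Tendsto a atTop atTop)
    (hG : ∀ ω, ContinuousOn (fun p : ℝ × E => G ω p.1 p.2) (regionUX X))
    (hFCLT : ConvergesWeaklyInEllInfty (regionUX X)
      P (fun n ω p => a n * (Qhat n ω p.1 p.2 - Q p.1 p.2)) P' (fun ω p => G ω p.1 p.2))
    (hg : IsWeight (Icc 0 1) (regionUX X) g)
    (hb : Integrable b unif) (hgb : ∀ᵐ v ∂unif, ∀ p ∈ regionUX X, |g v p| ≤ b v) :
    ConvergesWeaklyInEllInfty (regionUX X)
      P (fun n ω p => a n * ∫ u in Icc (0 : ℝ) 1,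
        g u p * (rearranged (Qhat n ω) u p.2 - rearranged Q u p.2))
      P' (fun ω p => ∫ u in Icc (0 : ℝ) 1, g u p * derivQ Q (G ω) u p.2) := by
  have hmax : ∀ s w, ∃ C, (∀ p ∈ regionUX X, |perturb Q s w p.1 p.2| ≤ C) ∧
      ∀ p ∈ regionUX X, |Q p.1 p.2| ≤ C := fun s w => by
    obtain ⟨C₁, h₁⟩ := hM.exists_bound_perturb s w
    obtain ⟨C₂, h₂⟩ := hM.exists_bound
    exact ⟨max C₁ C₂, fun p hp => (h₁ p hp).trans (le_max_left _ _),
      fun p hp => (h₂ p hp).trans (le_max_right _ _)⟩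
  refine ConvergesWeaklyInEllInfty.delta_method (isCompact_regionUX hM.isCompact) hFCLT
    (Φ := fun n w p => a n * ∫ u in Icc (0 : ℝ) 1,
      g u p * (rearranged (perturb Q (a n)⁻¹ w) u p.2 - rearranged Q u p.2))
    (fun n w => ?_) (fun n w => ?_) (fun n ω w hw p hp => ?_)
    (fun ω => continuousOn_integral_mul_derivQ hM hg hb hgb (hG ω)) (fun ω z hz p hp => ?_)
  · obtain ⟨C, h₁, h₂⟩ := hmax (a n)⁻¹ w
    exact (measurable_integral_mul_rearranged_sub hM hg (hM.measurable_perturb _ w) h₁ h₂).const_mul _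
  · obtain ⟨C, h₁, h₂⟩ := hmax (a n)⁻¹ w
    refine ⟨|a n| * ∫ u, b u * (C + C) ∂unif, fun p hp => ?_⟩
    rw [abs_mul]
    gcongr
    exact (integrableOn_mul_rearranged_sub hM hg hb hgb (hM.measurable_perturb _ w) h₁ h₂ hp).2
  · by_cases hn : a n = 0
    · simp [hn]
    · congr 2
      ext u
      congr 2
      have h := pathCdf_congr (q := fun u => perturb Q (a n)⁻¹ w u p.2)
        (r := fun u => Qhat n ω u p.2) fun u hu => perturb_eq hw hn hu hp.2
      change pathQuantile (fun u => perturb Q (a n)⁻¹ w u p.2) u =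
        pathQuantile (fun u => Qhat n ω u p.2) u
      rw [pathQuantile, pathQuantile, h]
  · set l := ((atTop : Filter ℕ) ×ˢ 𝓝 z) ×ˢ 𝓝[regionUX X] p with hl
    have hn : Tendsto (fun i : (ℕ × EllInfty (regionUX X)) × (ℝ × E) => a i.1.1) l atTop :=
      ha.comp (tendsto_fst.comp tendsto_fst)
    have hw : Tendsto (fun i : (ℕ × EllInfty (regionUX X)) × (ℝ × E) => i.1.2) l (𝓝 z) :=
      tendsto_snd.comp tendsto_fst
    have hπ : Tendsto (fun i : (ℕ × EllInfty (regionUX X)) × (ℝ × E) => i.2) l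
      (𝓝[regionUX X] p) := tendsto_snd
    have hsnd := tendsto_snd_of_region (fun p (hp : p ∈ regionUX X) => hp.2) hπ
    have hmem := hπ.eventually self_mem_nhdsWithin
    have hγ : ∀ᵐ v ∂unif, Tendsto
        (fun i : (ℕ × EllInfty (regionUX X)) × (ℝ × E) => g v i.2) l (𝓝 (g v p)) :=
      (hg.2 p hp).mono fun v hv => hv.tendsto.comp hπ
    have hlim := (hM.pathConvergence hp.2 hsnd).tendsto_integral_pathQuantile
      (γ := fun i v => g v i.2) (g := fun v => g v p)
      (t := fun i => (a i.1.1)⁻¹) (tendsto_inv_atTop_zero.comp hn)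
      ((hn.eventually_gt_atTop 0).mono fun i hi => inv_pos.2 hi)
      (k := fun i u => extendZero i.1.2 (u, i.2.2))
      (hmem.mono fun i hi => aemeasurable_path (R := fun u x => extendZero i.1.2 (u, x))
        (measurable_extendZero i.1.2) hi.2)
      (continuousOn_path (hG ω) hp.2)
      (tendstoUniformlyOn_extendZero hM.isCompact (hG ω) hz hp.2 hw hsnd)
      (r := fun i u => perturb Q (a i.1.1)⁻¹ i.1.2 u i.2.2)
      (Eventually.of_forall fun i u _ => rfl) (hM.ae_densityY hp.2)
      (hmem.mono fun r hr => (hg.aemeasurable measurableSet_Icc hr).aestronglyMeasurable)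
      (hg.aemeasurable measurableSet_Icc hp).aestronglyMeasurable hb
      (hmem.mono fun r hr => hgb.mono fun v hv => hv r.2 hr) (hgb.mono fun v hv => hv p hp)
      hγ
    simp only [derivQ_eq]
    refine hlim.congr fun i => ?_
    rw [inv_inv]
    rfl

end Limit

end

end Rearrangement

end

open Rearrangement in
theorem proposition6
    -- the covariate region, the population curve and the range of the responses
    {d : ℕ} (X : Set (EuclideanSpace ℝ (Fin d))) (hX : IsCompact X)
    (Q : ℝ → EuclideanSpace ℝ (Fin d) → ℝ)
    (hQ : ContDiffOn ℝ 1 (fun p : ℝ × EuclideanSpace ℝ (Fin d) => Q p.1 p.2) (regionUX X))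
    (hcrit : ∃ N : ℕ, ∀ x ∈ X, {u : ℝ | u ∈ Icc (0 : ℝ) 1 ∧ partialU Q u x = 0}.encard ≤ N)
    (Y : Set ℝ) (hY : IsCompact Y) (hYsupp : ∀ x ∈ X, supportY Q x ⊆ Y)
    -- the estimators and the limit process
    {Ω : ℕ → Type*} [∀ n, MeasurableSpace (Ω n)] (P : ∀ n, Measure (Ω n))
    [∀ n, IsProbabilityMeasure (P n)]
    {Ω' : Type*} [MeasurableSpace Ω'] (P' : Measure Ω') [IsProbabilityMeasure P']
    (Qhat : ∀ n, Ω n → ℝ → EuclideanSpace ℝ (Fin d) → ℝ)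
    (hQhat_meas : ∀ n ω, Measurable (fun p : ↥(regionUX X) => Qhat n ω p.1.1 p.1.2))
    (hQhat_bdd : ∀ n ω, ∃ C : ℝ, ∀ p ∈ regionUX X, |Qhat n ω p.1 p.2| ≤ C)
    (a : ℕ → ℝ) (ha : Tendsto a atTop atTop)
    (G : Ω' → ℝ → EuclideanSpace ℝ (Fin d) → ℝ)
    (hG : ∀ ω, ContinuousOn (fun p : ℝ × EuclideanSpace ℝ (Fin d) => G ω p.1 p.2) (regionUX X))
    (hFCLT : ConvergesWeaklyInEllInfty (regionUX X)
      P (fun n ω p => a n * (Qhat n ω p.1 p.2 - Q p.1 p.2))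
      P' (fun ω p => G ω p.1 p.2)) :
    -- part 1
    (∀ g : ℝ → ℝ × EuclideanSpace ℝ (Fin d) → ℝ,
      IsWeight Y (regionYX Q X) g → IsBoundedWeight Y (regionYX Q X) g →
        (∀ n ω, ∀ p ∈ regionYX Q X, IntegrableOn
          (fun y => g y p * (distFn (Qhat n ω) y p.2 - distFn Q y p.2)) Y) ∧
        (∀ ω, ∀ p ∈ regionYX Q X, IntegrableOn (fun y => g y p * derivF Q (G ω) y p.2) Y) ∧
        (∀ ω, ContinuousOn (fun p : ℝ × EuclideanSpace ℝ (Fin d) =>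
          ∫ y in Y, g y p * derivF Q (G ω) y p.2) (regionYX Q X)) ∧
        ConvergesWeaklyInEllInfty (regionYX Q X)
          P (fun n ω p => a n * ∫ y in Y, g y p * (distFn (Qhat n ω) y p.2 - distFn Q y p.2))
          P' (fun ω p => ∫ y in Y, g y p * derivF Q (G ω) y p.2)) ∧
    -- part 2
    (∀ g : ℝ → ℝ × EuclideanSpace ℝ (Fin d) → ℝ,
      IsWeight (Icc 0 1) (regionUX X) g → HasIntegrableSup (Icc 0 1) (regionUX X) g →
        (∀ n ω, ∀ p ∈ regionUX X, IntegrableOn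
          (fun u => g u p * (rearranged (Qhat n ω) u p.2 - rearranged Q u p.2)) (Icc 0 1)) ∧
        (∀ ω, ∀ p ∈ regionUX X, IntegrableOn
          (fun u => g u p * derivQ Q (G ω) u p.2) (Icc 0 1)) ∧
        (∀ ω, ContinuousOn (fun p : ℝ × EuclideanSpace ℝ (Fin d) =>
          ∫ u in Icc (0 : ℝ) 1, g u p * derivQ Q (G ω) u p.2) (regionUX X)) ∧
        ConvergesWeaklyInEllInfty (regionUX X)
          P (fun n ω p => a n * ∫ u in Icc (0 : ℝ) 1,
            g u p * (rearranged (Qhat n ω) u p.2 - rearranged Q u p.2))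
          P' (fun ω p => ∫ u in Icc (0 : ℝ) 1, g u p * derivQ Q (G ω) u p.2)) := by
  obtain ⟨N, hN⟩ := hcrit
  have hM : IsModel X Q N := ⟨hX, hQ, hN⟩
  refine ⟨fun g hg ⟨C, hC⟩ => ⟨fun n ω p hp => ?_, fun ω p hp => ?_, fun ω => ?_, ?_⟩,
    fun g hg hsup => ?_⟩
  · exact (integrableOn_mul_distFn_sub hM hY hg hC (hQhat_meas n ω) hp).1
  · exact (integral_mul_derivF hM hY hg hC (hG ω) hp).1
  · exact continuousOn_integral_mul_derivF hM hY hg hC (hG ω)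
  · exact convergesWeakly_integral_distFn hM ha hG hFCLT hY hg hC
  · obtain ⟨b, hb, hgb⟩ := hsup.exists_bound
    refine ⟨fun n ω p hp => ?_, fun ω p hp => ?_, fun ω => ?_, ?_⟩
    · obtain ⟨C₁, h₁⟩ := hQhat_bdd n ω
      obtain ⟨C₂, h₂⟩ := hM.exists_bound
      exact (integrableOn_mul_rearranged_sub hM hg hb hgb (hQhat_meas n ω)
        (fun r hr => (h₁ r hr).trans (le_max_left C₁ C₂))
        (fun r hr => (h₂ r hr).trans (le_max_right C₁ C₂)) hp).1
    · exact integrableOn_mul_derivQ hM hg hb hgb (hG ω) hp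
    · exact continuousOn_integral_mul_derivQ hM hg hb hgb (hG ω)
    · exact convergesWeakly_integral_rearranged hM ha hG hFCLT hg hb hgb
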